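/- A \emph{simple rectilinear polygon} $P$ is the closed region bounded by a simple closed polygonal curve whose edges are alternately horizontal and vertical, so that every internal angle is $90^\circ$ or $270^\circ$; vertices with internal angle $270^\circ$ are \emph{reflex}, and an edge between two reflex vertices is a \emph{reflex edge}. For an edge $e$, let $H_e$ be the closed half-plane whose boundary line contains $e$ and whose interior contains the interior of $P$ locally at $e$. Let $\mathcal R(P)$ be the intersection of the half-planes $H_e$ over all reflex edges $e$ of $P$ (the whole plane if there are none). A beacon $b\in P$ pulls an object $p\in P$ as follows: the object moves straight towards $b$ as long as this is possible within $P$; if it is blocked at an edge, it slides along that edge in the direction in which the Euclidean distance to $b$ decreases, up to the point of the edge nearest to $b$; these moves are repeated. The beacon $b$ \emph{attracts} $p$ if the object reaches $b$. The \emph{beacon kernel} $\mathcal K(P)$ is the set of all $b\in P$ that attract every point of $P$. \textbf{Theorem.} For every simple rectilinear polygon $P$, a point $p\in P$ lies in $\mathcal K(P)$ if and only if $p\in H_e$ for every reflex edge $e$ of $P$. Therefore $\mathcal K(P)=\mathcal R(P)\cap P$, where $\mathcal R(P)$ is a closed axis-parallel rectangle (possibly unbounded, degenerate or empty). Moreover,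 $\mathcal K(P)$ can be computed in linear time: there are a program for the real RAM with unit costs and a constant $C$ such that for every simple rectilinear polygon $P$ with $n$ vertices, given by the cyclic sequence of its vertices, the program halts after at most $Cn$ steps and outputs the vertices of a closed polygonal chain that traces exactly the boundary of $\mathcal K(P)$ and bounds $\mathcal K(P)$, that is, $\mathcal K(P)$ consists of this chain and the points that it separates from infinity (the empty chain if $\mathcal K(P)=\emptyset$). -/

import Mathlib

open Set Filter Topology

noncomputable section

/-- The Euclidean plane; `p 0` is the horizontal and `p 1` the vertical coordinate. -/
abbrev Plane : Type := EuclideanSpace ℝ (Fin 2)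

/-! ### Closed polygonal chains -/

/-- The `i`-th edge of the closed chain with vertices `w 0, …, w (k - 1)`: it joins `w i` to the
cyclically next vertex (`finRotate k` is the cyclic successor on `Fin k`). -/
def chainEdge {k : ℕ} (w : Fin k → Plane) (i : Fin k) : Set Plane :=
  segment ℝ (w i) (w (finRotate k i))

/-- The trace of a closed polygonal chain. -/
def chainTrace {k : ℕ} (w : Fin k → Plane) : Set Plane :=
  ⋃ i, chainEdge w i

/-- The closed region bounded by a closed chain: the chain itself and all points that it separates
from infinity. -/
def chainRegion {k : ℕ} (w : Fin k → Plane) : Set Plane :=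
  chainTrace w ∪
    {x | x ∉ chainTrace w ∧ Bornology.IsBounded (connectedComponentIn (chainTrace w)ᶜ x)}

/-! ### Simple rectilinear polygons -/

/-- A simple rectilinear polygon, given by its cyclic sequence of vertices (in either orientation).
Horizontal and vertical edges alternate, so that every internal angle is `90°` or `270°`. -/
structure RectilinearPolygon where
  /-- the number of vertices -/
  n : ℕ
  four_le : 4 ≤ n
  /-- the vertices in their order along the boundary -/
  vertex : Fin n → Plane
  /-- edges are not degenerate -/
  edge_ne : ∀ i, vertex i ≠ vertex (finRotate n i)
  /-- of two consecutive edges, one is horizontal and the other one is vertical -/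
  alternating : ∀ i,
    (vertex i 1 = vertex (finRotate n i) 1 ∧
      vertex (finRotate n i) 0 = vertex (finRotate n (finRotate n i)) 0) ∨
    (vertex i 0 = vertex (finRotate n i) 0 ∧
      vertex (finRotate n i) 1 = vertex (finRotate n (finRotate n i)) 1)
  /-- two different edges meet at most in a common endpoint of consecutive edges -/
  simple : ∀ i j x, x ∈ chainEdge vertex i → x ∈ chainEdge vertex j →
    i = j ∨ (j = finRotate n i ∧ x = vertex j) ∨ (i = finRotate n j ∧ x = vertex i)

namespace RectilinearPolygon

variable (P : RectilinearPolygon)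

/-- The cyclic successor of an index. -/
def next (i : Fin P.n) : Fin P.n := finRotate P.n i

/-- The cyclic predecessor of an index. -/
def prev (i : Fin P.n) : Fin P.n := (finRotate P.n).symm i

/-- The edge from the `i`-th vertex to the next one. -/
def edge (i : Fin P.n) : Set Plane := chainEdge P.vertex i

/-- The polygon as a closed subset of the plane. -/
def region : Set Plane := chainRegion P.vertex

/-- The `i`-th vertex is reflex (internal angle `270°`): the `90°` sector spanned by the two
incident edges lies, close to the vertex, outside the polygon. -/
def IsReflexVertex (i : Fin P.n) : Prop :=
  ∃ δ : ℝ, 0 < δ ∧ ∀ s t : ℝ, 0 < s → s < δ → 0 < t → t < δ →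
    P.vertex i + s • (P.vertex (P.prev i) - P.vertex i)
      + t • (P.vertex (P.next i) - P.vertex i) ∉ P.region

/-- A reflex edge is an edge between two reflex vertices. -/
def IsReflexEdge (i : Fin P.n) : Prop :=
  P.IsReflexVertex i ∧ P.IsReflexVertex (P.next i)

/-- `ν` is a normal vector of the `i`-th edge that points, along the whole open edge, into the
interior of the polygon. -/
def IsInnerNormal (i : Fin P.n) (ν : Plane) : Prop :=
  ν ≠ 0 ∧ inner ℝ ν (P.vertex (P.next i) - P.vertex i) = 0 ∧
    ∀ x ∈ openSegment ℝ (P.vertex i) (P.vertex (P.next i)),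
      ∀ᶠ ε : ℝ in 𝓝[>] 0, x + ε • ν ∈ interior P.region

/-- The half-plane supporting the `i`-th edge: the closed half-plane bounded by the line through the
edge, on the side on which the interior of the polygon lies locally at the edge. -/
def halfPlane (i : Fin P.n) : Set Plane :=
  {p | ∃ ν, P.IsInnerNormal i ν ∧ 0 ≤ inner ℝ ν (p - P.vertex i)}

/-- The intersection of the half-planes supporting the reflex edges. -/
def reflexRectangle : Set Plane :=
  {p | ∀ i, P.IsReflexEdge i → p ∈ P.halfPlane i}

/-! ### Beacon attraction -/

/-- An object at `x` that is pulled by a beacon at `b` moves straight towards `b`, to `y`: it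
moves as far along the ray as it can without leaving the (closed) polygon or passing `b`. -/
def StraightMove (b x y : Plane) : Prop :=
  y ∈ segment ℝ x b ∧ y ≠ x ∧ segment ℝ x y ⊆ P.region ∧
    ∀ z ∈ segment ℝ x b, segment ℝ x z ⊆ P.region → z ∈ segment ℝ x y

/-- At `x`, no straight move towards `b` is possible. -/
def Blocked (b x : Plane) : Prop :=
  ∀ z ∈ segment ℝ x b, segment ℝ x z ⊆ P.region → z = x

/-- An object at `x` on an edge that cannot move straight towards `b` slides along the edge in the
direction in which the distance to `b` decreases, up to the point `y` of the edge that is nearest to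
`b` (an endpoint of the edge, or an inner point of it at which the object is stuck). -/
def SlideMove (b x y : Plane) : Prop :=
  P.Blocked b x ∧ ∃ i, x ∈ P.edge i ∧ y ∈ P.edge i ∧ y ≠ x ∧ ∀ z ∈ P.edge i, dist y b ≤ dist z b

/-- A beacon at `b` attracts an object at `p`: the piecewise linear attraction path of `p` reaches
`b`. -/
def Attracts (b p : Plane) : Prop :=
  Relation.ReflTransGen (fun x y => P.StraightMove b x y ∨ P.SlideMove b x y) p b

/-- The beacon kernel: the points of the polygon at which a beacon attracts all its points. -/
def kernel : Set Plane :=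
  {b | b ∈ P.region ∧ ∀ p ∈ P.region, P.Attracts b p}

end RectilinearPolygon

/-- A closed axis-parallel rectangle, possibly unbounded, degenerate or empty. -/
def IsAxisParallelRectangle (S : Set Plane) : Prop :=
  ∃ I J : Set ℝ, IsClosed I ∧ I.OrdConnected ∧ IsClosed J ∧ J.OrdConnected ∧
    S = {p | p 0 ∈ I ∧ p 1 ∈ J}

/-! ### A real RAM with unit costs -/

/-- A memory configuration of the machine. -/
structure RAMState where
  /-- index registers, holding natural numbers -/
  idx : ℕ → ℕ
  /-- real registers -/
  reg : ℕ → ℝ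
  /-- random access memory for natural numbers -/
  imem : ℕ → ℕ
  /-- random access memory for real numbers -/
  rmem : ℕ → ℝ

/-- Elementary instructions. There are no integer multiplication, no conversion between reals and
integers, and no rounding. -/
inductive RAMInstr where
  | iconst (a k : ℕ)
  | iadd (a b c : ℕ)
  | isub (a b c : ℕ)
  | iload (a b : ℕ)
  | istore (a b : ℕ)
  | rconst (a : ℕ) (q : ℚ)
  | radd (a b c : ℕ)
  | rsub (a b c : ℕ)
  | rmul (a b c : ℕ)
  | rdiv (a b c : ℕ)
  | rload (a b : ℕ)
  | rstore (a b : ℕ)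

/-- The effect of an instruction. The first argument of an instruction names the target register,
except for `istore` and `rstore`, where it names the index register that holds the address.
Subtraction of natural numbers is truncated, and division by `0` returns `0`. -/
def RAMInstr.apply : RAMInstr → RAMState → RAMState
  | .iconst a k, s => { s with idx := Function.update s.idx a k }
  | .iadd a b c, s => { s with idx := Function.update s.idx a (s.idx b + s.idx c) }
  | .isub a b c, s => { s with idx := Function.update s.idx a (s.idx b - s.idx c) }
  | .iload a b, s => { s with idx := Function.update s.idx a (s.imem (s.idx b)) }
  | .istore a b, s => { s with imem := Function.update s.imem (s.idx a) (s.idx b) }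
  | .rconst a q, s => { s with reg := Function.update s.reg a (q : ℝ) }
  | .radd a b c, s => { s with reg := Function.update s.reg a (s.reg b + s.reg c) }
  | .rsub a b c, s => { s with reg := Function.update s.reg a (s.reg b - s.reg c) }
  | .rmul a b c, s => { s with reg := Function.update s.reg a (s.reg b * s.reg c) }
  | .rdiv a b c, s => { s with reg := Function.update s.reg a (s.reg b / s.reg c) }
  | .rload a b, s => { s with reg := Function.update s.reg a (s.rmem (s.idx b)) }
  | .rstore a b, s => { s with rmem := Function.update s.rmem (s.idx a) (s.reg b) }

/-- Elementary tests: comparisons of two index registers or of two real registers. -/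
inductive RAMTest where
  | ilt (a b : ℕ)
  | ieq (a b : ℕ)
  | rlt (a b : ℕ)
  | req (a b : ℕ)

/-- The outcome of a test. -/
def RAMTest.Holds : RAMTest → RAMState → Prop
  | .ilt a b, s => s.idx a < s.idx b
  | .ieq a b, s => s.idx a = s.idx b
  | .rlt a b, s => s.reg a < s.reg b
  | .req a b, s => s.reg a = s.reg b

/-- Programs. -/
inductive RAMProgram where
  | skip
  | instr (i : RAMInstr)
  | seq (c d : RAMProgram)
  | ite (b : RAMTest) (c d : RAMProgram)
  | loop (b : RAMTest) (c : RAMProgram)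

/-- `RAMExec c s t s'`: started in `s`, the program `c` halts in `s'` after exactly `t` steps, where
every executed instruction and every evaluated test counts as one step. `loop b c` repeats `c` while
`b` holds. -/
inductive RAMExec : RAMProgram → RAMState → ℕ → RAMState → Prop where
  | skip (s : RAMState) : RAMExec .skip s 1 s
  | instr (i : RAMInstr) (s : RAMState) : RAMExec (.instr i) s 1 (i.apply s)
  | seq {c d : RAMProgram} {s s' s'' : RAMState} {t t' : ℕ} :
      RAMExec c s t s' → RAMExec d s' t' s'' → RAMExec (.seq c d) s (t + t') s''
  | ite_true {b : RAMTest} {c d : RAMProgram} {s s' : RAMState} {t : ℕ} :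
      b.Holds s → RAMExec c s t s' → RAMExec (.ite b c d) s (t + 1) s'
  | ite_false {b : RAMTest} {c d : RAMProgram} {s s' : RAMState} {t : ℕ} :
      ¬ b.Holds s → RAMExec d s t s' → RAMExec (.ite b c d) s (t + 1) s'
  | loop_true {b : RAMTest} {c : RAMProgram} {s s' s'' : RAMState} {t t' : ℕ} :
      b.Holds s → RAMExec c s t s' → RAMExec (.loop b c) s' t' s'' →
        RAMExec (.loop b c) s (t + t' + 1) s''
  | loop_false {b : RAMTest} {c : RAMProgram} {s : RAMState} :
      ¬ b.Holds s → RAMExec (.loop b c) s 1 s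

/-- The initial configuration for the input `v 0, …, v (n - 1)`: index register `0` holds `n`, the
real memory holds the coordinates `v 0 0, v 0 1, v 1 0, v 1 1, …` from address `0` on, and everything
else is `0`. -/
def RAMState.input {n : ℕ} (v : Fin n → Plane) : RAMState where
  idx := fun a => if a = 0 then n else 0
  reg := fun _ => 0
  imem := fun _ => 0
  rmem := fun m => if h : m / 2 < n then v ⟨m / 2, h⟩ (if m % 2 = 0 then 0 else 1) else 0

/-- The sequence of points that a final configuration represents: their number is in index register
`0`, and their coordinates are in the real memory, from the address in index register `1` on. -/
def RAMState.output (s : RAMState) : Fin (s.idx 0) → Plane :=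
  fun j => !₂[s.rmem (s.idx 1 + 2 * (j : ℕ)), s.rmem (s.idx 1 + 2 * (j : ℕ) + 1)]

end

/-!
# Beacon kernels of rectilinear polygons

**Topology.** The polygon is defined by boundedness of components of the complement of its boundary.
The Jordan curve theorem is not needed for it; the one separation fact that is used, `separation`,
says that a closed polygonal curve separates the two sides of any of its segments: the total
angle that the curve sweeps out, seen from a point off the curve, is locally constant, and it jumps
by `2π` across the segment. Close to an edge, in coordinates along the edge
(`frame`), the boundary consists of the edge and pieces of its two neighbours. Hence the type
(inside or outside) of the left side of an edge is inherited by the next edge (`sideInside_next`),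
and it is known for an edge on the left side of the bounding box. So the polygon has an orientation
`η = ±1` (`exists_isOrientation`), and reflex vertices and supporting half-planes become sign
conditions on local coordinates.

**Necessity of the half-planes.** Attraction paths stay in the rectangle spanned by the object and
the beacon. Let the beacon `b` lie on the outer side of a reflex edge. Both neighbouring edges lead
to that side too; if `b` attracted a point just beyond each end, the two attraction paths and the
edge would form a closed curve in the polygon, which separates the two sides of the edge. But the
outer side is joined to infinity by the exterior, and so is the inner side by the half-plane that
the curve does not enter (`mem_halfPlane_of_mem_kernel`).

**Sufficiency.** Let `b` respect all reflex edges. If an object `x ≠ b` were stuck, the ray from `x`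
to `b` would leave the polygon at `x` and enter it again later, and the chord between would cut a
pocket off the exterior. The extreme edge of the pocket, in a suitable axis direction, is a reflex
edge that `b` violates (`exists_reflexEdge_of_pocket`, `notMem_reflexRectangle_of_leaving`,
`exists_slideMove`). The motion terminates, because each slide ends at the point of an edge nearest
to `b` and thus decreases the number of edges that are closer to `b` than the object
(`closerEdges`).

**Computation.** Attraction paths are monotone in both coordinates. Hence the kernel is convex in
the two axis directions, and clamping to its bounding box maps the polygon into the kernel and the
boundary of the polygon onto the boundary of the kernel (`clamp_mem_kernel`, `frontier_kernel`). So
the clamped vertices are a valid output (`chain_clamp`), and only the bounding box has to be found.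
It is the bounding box of the part of the boundary in the reflex rectangle, cut with the bounding
box of the polygon, and of those of two opposite corners of this rectangle that lie in the polygon
(`exists_coord_le_of_mem_kernel`). A corner is tested by the nearest vertical edge to its left
(`mem_region_iff_of_leftRay`). All this takes a constant number of passes over the vertices, each of
which looks at windows of four consecutive vertices (`kernelProgram`).
-/

/-! ### Coordinates of the plane -/

/-- Rotation of the plane by a right angle, counterclockwise. -/
def rot (v : Plane) : Plane := !₂[-v 1, v 0]

@[simp] lemma rot_zero_coord (v : Plane) : rot v 0 = -v 1 := rfl
@[simp] lemma rot_one_coord (v : Plane) : rot v 1 = v 0 := rfl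

lemma plane_ext {x y : Plane} (h0 : x 0 = y 0) (h1 : x 1 = y 1) : x = y := by
  ext i; fin_cases i <;> assumption

lemma inner_plane (x y : Plane) : inner ℝ x y = x 0 * y 0 + x 1 * y 1 := by
  simp [PiLp.inner_apply, Fin.sum_univ_two]; ring

/-- The plane as the field of complex numbers, which makes the argument function available. -/
def toComplex (v : Plane) : ℂ := ⟨v 0, v 1⟩

lemma continuous_toComplex : Continuous toComplex := by
  have : toComplex = fun v : Plane => ((v 0 : ℝ) : ℂ) + ((v 1 : ℝ) : ℂ) * Complex.I := by
    funext v
    apply Complex.ext <;> simp [toComplex]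
  rw [this]
  fun_prop

lemma toComplex_sub_ne_zero {x y : Plane} (h : x ≠ y) : toComplex x - toComplex y ≠ 0 := by
  intro h0
  have := sub_eq_zero.1 h0
  exact h (plane_ext (congrArg Complex.re this) (congrArg Complex.im this))

/-! ### Polygonal connection and continuous choice of angles -/

/-- `x` and `y` are joined by a polygonal path inside `S`. -/
def PolyJoined (S : Set Plane) : Plane → Plane → Prop :=
  Relation.ReflTransGen fun x y => segment ℝ x y ⊆ S

namespace PolyJoined

variable {S T : Set Plane} {x y z : Plane}

lemma symm (h : PolyJoined S x y) : PolyJoined S y x := by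
  induction h with
  | refl => exact Relation.ReflTransGen.refl
  | tail _ h ih => exact Relation.ReflTransGen.head (by rwa [segment_symm]) ih

lemma trans (h : PolyJoined S x y) (h' : PolyJoined S y z) : PolyJoined S x z :=
  Relation.ReflTransGen.trans h h'

lemma of_segment (h : segment ℝ x y ⊆ S) : PolyJoined S x y := Relation.ReflTransGen.single h

lemma mono (hST : S ⊆ T) (h : PolyJoined S x y) : PolyJoined T x y :=
  Relation.ReflTransGen.mono (fun _ _ (h : _ ⊆ S) => h.trans hST) _ _ h

/-- A polygonal path sits inside a connected subset of `S`. -/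
lemma exists_preconnected (h : PolyJoined S x y) (hx : x ∈ S) :
    ∃ T ⊆ S, IsPreconnected T ∧ x ∈ T ∧ y ∈ T := by
  induction h with
  | refl => exact ⟨{x}, by simpa using hx, isPreconnected_singleton, rfl, rfl⟩
  | @tail b c _ h ih =>
    obtain ⟨T, hT, hc, hxT, hyT⟩ := ih
    refine ⟨T ∪ segment ℝ b c, union_subset hT h, ?_, Or.inl hxT, Or.inr (right_mem_segment ℝ b c)⟩
    exact IsPreconnected.union b hyT (left_mem_segment ℝ b c) hc (convex_segment b c).isPreconnected

end PolyJoined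

/-- The quotient of the directions from `z` to the endpoints of a segment is not a negative real
number, so that the angle under which the segment is seen from `z` varies continuously. -/
lemma div_mem_slitPlane {a b z : Plane} (h : z ∉ segment ℝ a b) :
    (toComplex b - toComplex z) / (toComplex a - toComplex z) ∈ Complex.slitPlane := by
  have ha : z ≠ a := fun e => h (e ▸ left_mem_segment ℝ a b)
  have hb : z ≠ b := fun e => h (e ▸ right_mem_segment ℝ a b)
  have ha' := toComplex_sub_ne_zero (Ne.symm ha)
  have hb' := toComplex_sub_ne_zero (Ne.symm hb)
  rw [Complex.mem_slitPlane_iff_not_le_zero]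
  intro hle
  obtain ⟨hre, him⟩ := Complex.le_def.1 hle
  set q := (toComplex b - toComplex z) / (toComplex a - toComplex z) with hq
  have hqe : toComplex b - toComplex z = q * (toComplex a - toComplex z) := by
    rw [hq]; field_simp
  have hq' : q = ((q.re : ℝ) : ℂ) := Complex.ext rfl (by simpa using him)
  rw [hq'] at hqe
  have h0 := congrArg Complex.re hqe
  have h1 := congrArg Complex.im hqe
  simp [toComplex] at h0 h1
  have hr : q.re ≤ 0 := by simpa using hre
  apply h
  have hpos : 0 < 1 - q.re := by linarith
  refine ⟨-q.re / (1 - q.re), 1 / (1 - q.re), by apply div_nonneg <;> linarith, by positivity,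
    by field_simp; ring, ?_⟩
  apply plane_ext
  · simp; field_simp; linarith
  · simp; field_simp; linarith

lemma continuousAt_segment_angle {a b z : Plane} (h : z ∉ segment ℝ a b) :
    ContinuousAt (fun z => Complex.arg
      ((toComplex b - toComplex z) / (toComplex a - toComplex z))) z := by
  have ha : z ≠ a := fun e => h (e ▸ left_mem_segment ℝ a b)
  have ha' := toComplex_sub_ne_zero (Ne.symm ha)
  have hc := continuous_toComplex
  refine ContinuousAt.comp (g := Complex.arg) (Complex.continuousAt_arg (div_mem_slitPlane h)) ?_
  exact ContinuousAt.div (by fun_prop) (by fun_prop) ha'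

lemma segment_angle_coe {a b z : Plane} (ha : z ≠ a) (hb : z ≠ b) :
    ((Complex.arg ((toComplex b - toComplex z) / (toComplex a - toComplex z)) : ℝ) : Real.Angle)
      = ((toComplex b - toComplex z).arg : Real.Angle) - ((toComplex a - toComplex z).arg : ℝ) :=
  Complex.arg_div_coe_angle (toComplex_sub_ne_zero hb.symm) (toComplex_sub_ne_zero ha.symm)

/-- Off a polygonal path, the angle that the path sweeps out can be chosen continuously. -/
lemma PolyJoined.exists_angle {S : Set Plane} {x y : Plane} (h : PolyJoined S x y) :
    ∃ θ : Plane → ℝ, (∀ z ∉ S, ContinuousAt θ z) ∧ ∀ z ∉ S,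
      (θ z : Real.Angle) = ((toComplex y - toComplex z).arg : Real.Angle)
        - ((toComplex x - toComplex z).arg : ℝ) := by
  induction h with
  | refl => exact ⟨0, fun z _ => continuousAt_const, fun z _ => by simp⟩
  | @tail b c _ h ih =>
    obtain ⟨θ, hθ, hθ'⟩ := ih
    refine ⟨fun z => θ z + Complex.arg
      ((toComplex c - toComplex z) / (toComplex b - toComplex z)), fun z hz => ?_, fun z hz => ?_⟩
    · exact (hθ z hz).add (continuousAt_segment_angle fun h' => hz (h h'))
    · have hb : z ≠ b := fun e => hz (h (e ▸ left_mem_segment ℝ b c))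
      have hc : z ≠ c := fun e => hz (h (e ▸ right_mem_segment ℝ b c))
      rw [Real.Angle.coe_add, hθ' z hz, segment_angle_coe hb hc]
      abel

/-- The tool that replaces the Jordan curve theorem: a closed polygonal curve separates the two
sides of each of its edges `[a, b]`, locally at a point `m` of the edge that the rest of the curve
avoids. The total angle of the curve is locally constant off the curve, and it jumps by `2π` at
`m`. -/
lemma separation {S : Set Plane} {a b m : Plane} (hab : a ≠ b) (hm : m ∈ openSegment ℝ a b)
    (hmS : m ∉ S) (hj : PolyJoined S b a) :
    ∀ᶠ ε : ℝ in 𝓝[>] 0, ∀ D : Set Plane, IsPreconnected D → Disjoint D S →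
      Disjoint D (segment ℝ a b) → m + ε • rot (b - a) ∈ D → m - ε • rot (b - a) ∉ D := by
  obtain ⟨θ, hθ, hθ'⟩ := hj.exists_angle
  obtain ⟨s, ρ, hs, hρ, hsρ, rfl⟩ := hm
  obtain rfl : s = 1 - ρ := by linarith
  set m := (1 - ρ) • a + ρ • b with hmdef
  have hcont : ContinuousAt θ m := hθ m hmS
  have hT1 : Tendsto (fun ε : ℝ => m + ε • rot (b - a)) (𝓝[>] 0) (𝓝 m) := by
    have : Continuous (fun ε : ℝ => m + ε • rot (b - a)) := by fun_prop
    simpa using (this.tendsto 0).mono_left nhdsWithin_le_nhds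
  have hT2 : Tendsto (fun ε : ℝ => m - ε • rot (b - a)) (𝓝[>] 0) (𝓝 m) := by
    have : Continuous (fun ε : ℝ => m - ε • rot (b - a)) := by fun_prop
    simpa using (this.tendsto 0).mono_left nhdsWithin_le_nhds
  have hev : ∀ᶠ z in 𝓝 m, |θ z - θ m| < Real.pi / 2 :=
    (Metric.tendsto_nhds.1 hcont) _ (by positivity)
  have hsmall : ∀ᶠ ε : ℝ in 𝓝[>] 0, ε ^ 2 < ρ * (1 - ρ) := by
    have : Tendsto (fun ε : ℝ => ε ^ 2) (𝓝[>] 0) (𝓝 0) := by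
      have h : Continuous (fun ε : ℝ => ε ^ 2) := by fun_prop
      simpa using (h.tendsto 0).mono_left nhdsWithin_le_nhds
    exact this.eventually_lt_const (by positivity)
  have hba : 0 < (b 0 - a 0) ^ 2 + (b 1 - a 1) ^ 2 := by
    by_contra hcon
    have h0 : b 0 - a 0 = 0 := by nlinarith [sq_nonneg (b 0 - a 0), sq_nonneg (b 1 - a 1)]
    have h1 : b 1 - a 1 = 0 := by nlinarith [sq_nonneg (b 0 - a 0), sq_nonneg (b 1 - a 1)]
    exact hab (plane_ext (by linarith) (by linarith))
  filter_upwards [hT1.eventually hev, hT2.eventually hev, hsmall, self_mem_nhdsWithin]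
    with ε h1 h2 hε hε0 D hD hDS hDab hp hn
  have hε0 : 0 < ε := hε0
  -- the two sides of the edge see it under angles close to `π` and to `-π`
  have key : ∀ e : ℝ, e ^ 2 < ρ * (1 - ρ) → e ≠ 0 → ∃ c : ℝ, 0 < c ∧
      (toComplex b - toComplex (m + e • rot (b - a))) /
        (toComplex a - toComplex (m + e • rot (b - a))) =
        (c : ℂ) * (⟨e ^ 2 - ρ * (1 - ρ), e⟩ : ℂ) := by
    intro e he he0
    have hpos : 0 < ρ ^ 2 + e ^ 2 := by positivity
    obtain ⟨c, hc⟩ : ∃ c : ℝ, c * (ρ ^ 2 + e ^ 2) = 1 := ⟨_, inv_mul_cancel₀ hpos.ne'⟩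
    refine ⟨c, pos_of_mul_pos_left (by rw [hc]; exact one_pos) hpos.le, ?_⟩
    have hne : toComplex a - toComplex (m + e • rot (b - a)) ≠ 0 := by
      intro h0
      have h0r := congrArg Complex.re h0
      have h0i := congrArg Complex.im h0
      simp [toComplex, hmdef] at h0r h0i
      have : (ρ ^ 2 + e ^ 2) * ((b 0 - a 0) ^ 2 + (b 1 - a 1) ^ 2) = 0 := by
        linear_combination (a 0 - ((1 - ρ) * a 0 + ρ * b 0 + e * (a 1 - b 1))) * h0r +
          (a 1 - ((1 - ρ) * a 1 + ρ * b 1 + e * (b 0 - a 0))) * h0i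
      have h' : 0 < (ρ ^ 2 + e ^ 2) * ((b 0 - a 0) ^ 2 + (b 1 - a 1) ^ 2) := by positivity
      linarith
    rw [div_eq_iff hne]
    apply Complex.ext
    · simp [toComplex, hmdef]
      linear_combination (-(b 0 - ((1 - ρ) * a 0 + ρ * b 0 + e * (a 1 - b 1)))) * hc
    · simp [toComplex, hmdef]
      linear_combination (-(b 1 - ((1 - ρ) * a 1 + ρ * b 1 + e * (b 0 - a 0)))) * hc
  have hp1 : Real.pi / 2 < Complex.arg ((toComplex b - toComplex (m + ε • rot (b - a))) /
        (toComplex a - toComplex (m + ε • rot (b - a)))) := by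
    obtain ⟨c, hc, he⟩ := key ε hε hε0.ne'
    rw [he]
    have h' : ¬ |((c : ℂ) * (⟨ε ^ 2 - ρ * (1 - ρ), ε⟩ : ℂ)).arg| ≤ Real.pi / 2 := by
      rw [Complex.abs_arg_le_pi_div_two_iff]
      simp
      nlinarith
    have h'' : 0 ≤ ((c : ℂ) * (⟨ε ^ 2 - ρ * (1 - ρ), ε⟩ : ℂ)).arg := by
      rw [Complex.arg_nonneg_iff]; simp; positivity
    rwa [abs_of_nonneg h'', not_le] at h'
  have hp2 : Complex.arg ((toComplex b - toComplex (m - ε • rot (b - a))) /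
        (toComplex a - toComplex (m - ε • rot (b - a)))) < -(Real.pi / 2) := by
    obtain ⟨c, hc, he⟩ := key (-ε) (by simpa using hε) (by linarith)
    rw [neg_smul, ← sub_eq_add_neg] at he
    rw [he]
    have h' : ¬ |((c : ℂ) * (⟨(-ε) ^ 2 - ρ * (1 - ρ), -ε⟩ : ℂ)).arg| ≤ Real.pi / 2 := by
      rw [Complex.abs_arg_le_pi_div_two_iff]
      simp
      nlinarith
    have h'' : ((c : ℂ) * (⟨(-ε) ^ 2 - ρ * (1 - ρ), -ε⟩ : ℂ)).arg < 0 := by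
      rw [Complex.arg_neg_iff]; simp; positivity
    rw [abs_of_neg h'', not_le] at h'
    linarith
  -- the total angle is a multiple of `2π` and hence constant on `D`
  let Θ : Plane → ℝ := fun z => θ z + Complex.arg
    ((toComplex b - toComplex z) / (toComplex a - toComplex z))
  have hΘc : ContinuousOn Θ D := fun z hz =>
    ((hθ z (disjoint_left.1 hDS hz)).add
      (continuousAt_segment_angle (disjoint_left.1 hDab hz))).continuousWithinAt
  have hΘi : ∀ z ∈ D, ∃ k : ℤ, Θ z / (2 * Real.pi) = k := by
    intro z hz
    have hzab := disjoint_left.1 hDab hz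
    have h : (Θ z : Real.Angle) = 0 := by
      have hb : z ≠ b := fun e => hzab (e ▸ right_mem_segment ℝ a b)
      have ha : z ≠ a := fun e => hzab (e ▸ left_mem_segment ℝ a b)
      rw [Real.Angle.coe_add, hθ' z (disjoint_left.1 hDS hz), segment_angle_coe ha hb]
      abel
    obtain ⟨k, hk⟩ := Real.Angle.coe_eq_zero_iff.1 h
    refine ⟨k, ?_⟩
    rw [← hk]
    have := Real.pi_pos
    simp
  have hconst :
      Θ (m + ε • rot (b - a)) / (2 * Real.pi) = Θ (m - ε • rot (b - a)) / (2 * Real.pi) := by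
    refine hD.constant_of_mapsTo (T := range ((↑) : ℤ → ℝ)) (f := fun z => Θ z / (2 * Real.pi)) ?_
      (hΘc.div_const _) ?_ hp hn
    · exact Int.isClosedEmbedding_coe_real.isInducing.isDiscrete_range
    · intro z hz
      obtain ⟨k, hk⟩ := hΘi z hz
      exact ⟨k, hk.symm⟩
  have hpi := Real.pi_pos
  have hconst' : Θ (m + ε • rot (b - a)) = Θ (m - ε • rot (b - a)) := by
    field_simp at hconst; exact hconst
  simp only [Θ] at hconst'
  rw [abs_lt] at h1 h2
  linarith [h1.1, h1.2, h2.1, h2.2]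

/-! ### Components of the complement of a bounded set -/

/-- The points with a coordinate that exceeds `M` in absolute value. -/
def farRegion (M : ℝ) : Set Plane := {z | M < |z 0| ∨ M < |z 1|}

lemma convex_halfplane_gt (k : Fin 2) (c : ℝ) : Convex ℝ {z : Plane | c < z k} :=
  convex_halfSpace_gt (f := fun z : Plane => z k) ⟨fun _ _ => rfl, fun _ _ => rfl⟩ c

lemma convex_halfplane_lt (k : Fin 2) (c : ℝ) : Convex ℝ {z : Plane | z k < c} :=
  convex_halfSpace_lt (f := fun z : Plane => z k) ⟨fun _ _ => rfl, fun _ _ => rfl⟩ c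

lemma isPreconnected_farRegion (M : ℝ) : IsPreconnected (farRegion M) := by
  have h1 := (convex_halfplane_gt 0 M).isPreconnected
  have h2 := (convex_halfplane_gt 1 M).isPreconnected
  have h3 := (convex_halfplane_lt 0 (-M)).isPreconnected
  have h4 := (convex_halfplane_lt 1 (-M)).isPreconnected
  have e : farRegion M = (({z : Plane | M < z 0} ∪ {z : Plane | M < z 1}) ∪ {z : Plane | z 0 < -M})
      ∪ {z : Plane | z 1 < -M} := by
    ext z
    simp only [farRegion, lt_abs, mem_ofPred_eq, mem_union]
    constructor
    · rintro ((h | h) | (h | h))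
      · tauto
      · exact Or.inl (Or.inr (by linarith))
      · tauto
      · exact Or.inr (by linarith)
    · rintro (((h | h) | h) | h)
      · tauto
      · tauto
      · exact Or.inl (Or.inr (by linarith))
      · exact Or.inr (Or.inr (by linarith))
  rw [e]
  refine ((h1.union (!₂[M + 1, M + 1] : Plane) ?_ ?_ h2).union (!₂[-(M + 1), M + 1] : Plane)
    (Or.inr ?_) ?_ h3).union (!₂[-(M + 1), -(M + 1)] : Plane) (Or.inr ?_) ?_ h4 <;>
  simp

/-- Any unbounded component of the complement of a bounded set contains all points far away. -/
lemma farRegion_subset_component {T : Set Plane} {M : ℝ} (hM : 0 ≤ M)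
    (hT : Disjoint (farRegion M) T) {x : Plane}
    (hu : ¬ Bornology.IsBounded (connectedComponentIn Tᶜ x)) :
    farRegion M ⊆ connectedComponentIn Tᶜ x := by
  have : ∃ y ∈ connectedComponentIn Tᶜ x, y ∈ farRegion M := by
    by_contra hcon
    push Not at hcon
    apply hu
    rw [Metric.isBounded_iff_subset_closedBall (0 : Plane)]
    refine ⟨2 * M, fun y hy => ?_⟩
    have h := hcon y hy
    simp only [farRegion, mem_ofPred_eq, not_or, not_lt] at h
    rw [mem_closedBall_zero_iff, EuclideanSpace.norm_eq, Real.sqrt_le_left (by linarith)]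
    simp only [Real.norm_eq_abs, sq_abs, Fin.sum_univ_two]
    nlinarith [abs_le.1 h.1, abs_le.1 h.2]
  obtain ⟨y, hy, hyf⟩ := this
  rw [connectedComponentIn_eq hy]
  exact (isPreconnected_farRegion M).subset_connectedComponentIn hyf
    (disjoint_left.1 hT)

/-! ### Combinatorics of the vertex indices -/

namespace RectilinearPolygon

variable (P : RectilinearPolygon)

@[simp] lemma next_prev (i : Fin P.n) : P.next (P.prev i) = i :=
  (finRotate P.n).apply_symm_apply i
@[simp] lemma prev_next (i : Fin P.n) : P.prev (P.next i) = i :=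
  (finRotate P.n).symm_apply_apply i

lemma val_next (i : Fin P.n) : (P.next i : ℕ) = (i + 1) % P.n := by
  have key : ∀ (n : ℕ) (i : Fin n), (finRotate n i : ℕ) = (i + 1) % n := by
    intro n i
    cases n with
    | zero => exact i.elim0
    | succ n =>
      rw [coe_finRotate]
      split_ifs with h
      · simp [h]
      · rw [Nat.mod_eq_of_lt]
        have := i.2
        have h' : (i : ℕ) ≠ n := fun e => h (Fin.ext e)
        omega
  exact key _ i

lemma val_next_iterate (i : Fin P.n) (k : ℕ) : (P.next^[k] i : ℕ) = (i + k) % P.n := by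
  induction k with
  | zero => simp [Nat.mod_eq_of_lt i.2]
  | succ k ih => rw [Function.iterate_succ_apply', val_next, ih]; simp [add_assoc]

lemma exists_next_iterate (i j : Fin P.n) : ∃ k, k < P.n ∧ P.next^[k] i = j := by
  have hi := i.2
  have hj := j.2
  by_cases h : (i : ℕ) ≤ j
  · refine ⟨j - i, by omega, Fin.ext ?_⟩
    rw [val_next_iterate, show (i : ℕ) + (j - i) = j by omega, Nat.mod_eq_of_lt hj]
  · refine ⟨j + P.n - i, by omega, Fin.ext ?_⟩
    rw [val_next_iterate, show (i : ℕ) + (j + P.n - i) = j + P.n by omega]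
    simp [Nat.mod_eq_of_lt hj]

/-- Induction along the boundary. -/
lemma boundary_induction {Q : Fin P.n → Prop} {i : Fin P.n} (h0 : Q i)
    (h : ∀ j, Q j → Q (P.next j)) (j : Fin P.n) : Q j := by
  obtain ⟨k, -, rfl⟩ := P.exists_next_iterate i j
  induction k with
  | zero => exact h0
  | succ k ih => rw [Function.iterate_succ_apply']; exact h _ ih

lemma next_iterate_ne (i : Fin P.n) {k : ℕ} (h0 : 0 < k) (h : k < P.n) : P.next^[k] i ≠ i := by
  intro e
  have := congrArg Fin.val e
  rw [val_next_iterate] at this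
  have hi := i.2
  by_cases hlt : (i : ℕ) + k < P.n
  · rw [Nat.mod_eq_of_lt hlt] at this; omega
  · rw [Nat.mod_eq_sub_mod (by omega), Nat.mod_eq_of_lt (by omega)] at this; omega

/-! ### Edges and the trace -/

/-- The boundary of the polygon. -/
abbrev trace : Set Plane := chainTrace P.vertex

lemma mem_trace {z : Plane} : z ∈ P.trace ↔ ∃ i, z ∈ P.edge i := by
  simp [trace, chainTrace, edge]

lemma edge_eq (i : Fin P.n) : P.edge i = segment ℝ (P.vertex i) (P.vertex (P.next i)) := rfl

lemma edge_subset_trace (i : Fin P.n) : P.edge i ⊆ P.trace := fun _ h => P.mem_trace.2 ⟨i, h⟩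

lemma vertex_mem_edge (i : Fin P.n) : P.vertex i ∈ P.edge i := left_mem_segment ℝ _ _

lemma vertex_next_mem_edge (i : Fin P.n) : P.vertex (P.next i) ∈ P.edge i :=
  right_mem_segment ℝ _ _

lemma isCompact_segment (x y : Plane) : IsCompact (segment ℝ x y) := by
  rw [← convexHull_pair]
  exact (Set.toFinite _).isCompact_convexHull (𝕜 := ℝ)

lemma isCompact_edge (i : Fin P.n) : IsCompact (P.edge i) := isCompact_segment _ _

lemma isCompact_trace : IsCompact P.trace := isCompact_iUnion fun i => P.isCompact_edge i

lemma polyJoined_iterate {S : Set Plane} (i : Fin P.n) (k : ℕ)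
    (h : ∀ l < k, P.edge (P.next^[l] i) ⊆ S) :
    PolyJoined S (P.vertex i) (P.vertex (P.next^[k] i)) := by
  induction k with
  | zero => exact Relation.ReflTransGen.refl
  | succ k ih =>
    refine Relation.ReflTransGen.tail (ih fun l hl => h l (by omega)) ?_
    rw [Function.iterate_succ_apply']
    exact h k (by omega)

/-- Any two boundary points are joined along the boundary. -/
lemma polyJoined_trace {x y : Plane} (hx : x ∈ P.trace) (hy : y ∈ P.trace) :
    PolyJoined P.trace x y := by
  have key : ∀ i x, x ∈ P.edge i → PolyJoined P.trace (P.vertex i) x := fun i x hx =>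
    PolyJoined.of_segment <| Subset.trans
      ((convex_segment _ _).segment_subset (P.vertex_mem_edge i) hx) (P.edge_subset_trace i)
  obtain ⟨i, hi⟩ := P.mem_trace.1 hx
  obtain ⟨j, hj⟩ := P.mem_trace.1 hy
  obtain ⟨k, -, rfl⟩ := P.exists_next_iterate i j
  exact ((key _ _ hi).symm.trans
    (P.polyJoined_iterate i k fun l _ => P.edge_subset_trace _)).trans (key _ _ hj)

/-- The boundary without one edge still joins the endpoints of that edge. -/
lemma polyJoined_compl_edge (i : Fin P.n) :
    PolyJoined (⋃ j ∈ {j | j ≠ i}, P.edge j) (P.vertex (P.next i)) (P.vertex i) := by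
  have h4 := P.four_le
  have h := P.polyJoined_iterate (S := ⋃ j ∈ {j | j ≠ i}, P.edge j) (P.next i) (P.n - 1) ?_
  · have e : P.next^[P.n - 1] (P.next i) = i := by
      rw [← Function.iterate_succ_apply, Fin.ext_iff, val_next_iterate,
        show (i : ℕ) + (P.n - 1).succ = i + P.n by omega]
      simp [Nat.mod_eq_of_lt i.2]
    rwa [e] at h
  · intro l hl
    refine subset_biUnion_of_mem (u := fun j => P.edge j) ?_
    rw [← Function.iterate_succ_apply]
    exact P.next_iterate_ne i (by omega) (by omega)

/-! ### The region -/

lemma trace_subset_region : P.trace ⊆ P.region := subset_union_left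

lemma mem_region_iff {z : Plane} (hz : z ∉ P.trace) :
    z ∈ P.region ↔ Bornology.IsBounded (connectedComponentIn P.traceᶜ z) := by
  simp [region, chainRegion, hz]

/-- A connected set that avoids the boundary lies inside or outside the polygon. -/
lemma mem_region_of_preconnected {D : Set Plane} (hD : IsPreconnected D) (h : Disjoint D P.trace)
    {x y : Plane} (hx : x ∈ D) (hy : y ∈ D) (hxP : x ∈ P.region) : y ∈ P.region := by
  rw [P.mem_region_iff (disjoint_left.1 h hx)] at hxP
  rw [P.mem_region_iff (disjoint_left.1 h hy)]
  have : y ∈ connectedComponentIn P.traceᶜ x :=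
    hD.subset_connectedComponentIn hx (disjoint_left.1 h) hy
  rwa [← connectedComponentIn_eq this]

lemma component_disjoint_region {z : Plane} (hz : z ∉ P.region) :
    Disjoint (connectedComponentIn P.traceᶜ z) P.region := by
  have hz' : z ∈ P.traceᶜ := fun h => hz (P.trace_subset_region h)
  refine disjoint_left.2 fun y hy hyP => hz ?_
  exact P.mem_region_of_preconnected isPreconnected_connectedComponentIn
    (disjoint_left.2 (connectedComponentIn_subset _ _)) hy (mem_connectedComponentIn hz') hyP

lemma isOpen_component (z : Plane) : IsOpen (connectedComponentIn P.traceᶜ z) :=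
  P.isCompact_trace.isClosed.isOpen_compl.connectedComponentIn

lemma isClosed_region : IsClosed P.region := by
  rw [← isOpen_compl_iff, isOpen_iff_mem_nhds]
  intro z hz
  have hz' : z ∈ P.traceᶜ := fun h => hz (P.trace_subset_region h)
  filter_upwards [(P.isOpen_component z).mem_nhds (mem_connectedComponentIn hz')] with y hy
  exact disjoint_left.1 (P.component_disjoint_region hz) hy

lemma mem_interior_region {z : Plane} (hz : z ∉ P.trace) (h : z ∈ P.region) :
    z ∈ interior P.region := by
  rw [mem_interior_iff_mem_nhds]
  filter_upwards [(P.isOpen_component z).mem_nhds (mem_connectedComponentIn hz)] with y hy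
  exact P.mem_region_of_preconnected isPreconnected_connectedComponentIn
    (disjoint_left.2 (connectedComponentIn_subset _ _)) (mem_connectedComponentIn hz) hy h

/-- A half-plane that misses the boundary is outside the polygon. -/
lemma notMem_region_of_forall_lt {k : Fin 2} {c : ℝ} (h : ∀ z ∈ P.trace, c ≤ z k) {z : Plane}
    (hz : z k < c) : z ∉ P.region := by
  have hzt : z ∉ P.trace := fun h' => absurd (h z h') (by linarith)
  rw [P.mem_region_iff hzt]
  intro hb
  have hsub := (convex_halfplane_lt k c).isPreconnected.subset_connectedComponentIn
    (F := P.traceᶜ) hz (fun y hy h' => absurd (h y h') (not_le.2 hy))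
  obtain ⟨r, hr⟩ := (Metric.isBounded_iff_subset_closedBall (0 : Plane)).1 (hb.subset hsub)
  have := hr (show (EuclideanSpace.single k (-(|c| + |r| + 1)) : Plane) ∈ _ by
    have := neg_abs_le c
    have := abs_nonneg r
    simp; linarith)
  rw [mem_closedBall_zero_iff, PiLp.norm_single, Real.norm_eq_abs, abs_neg] at this
  linarith [le_abs_self (|c| + |r| + 1), abs_nonneg c, le_abs_self r]

lemma notMem_region_of_forall_gt {k : Fin 2} {c : ℝ} (h : ∀ z ∈ P.trace, z k ≤ c) {z : Plane}
    (hz : c < z k) : z ∉ P.region := by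
  have hzt : z ∉ P.trace := fun h' => absurd (h z h') (by linarith)
  rw [P.mem_region_iff hzt]
  intro hb
  have hsub := (convex_halfplane_gt k c).isPreconnected.subset_connectedComponentIn
    (F := P.traceᶜ) hz (fun y hy h' => absurd (h y h') (not_le.2 hy))
  obtain ⟨r, hr⟩ := (Metric.isBounded_iff_subset_closedBall (0 : Plane)).1 (hb.subset hsub)
  have := hr (show (EuclideanSpace.single k (|c| + |r| + 1) : Plane) ∈ _ by
    have := le_abs_self c
    have := abs_nonneg r
    simp; linarith)
  rw [mem_closedBall_zero_iff, PiLp.norm_single, Real.norm_eq_abs] at this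
  linarith [le_abs_self (|c| + |r| + 1), abs_nonneg c, le_abs_self r]

lemma segment_coord_le {x y z : Plane} {k : Fin 2} {c : ℝ} (hx : x k ≤ c) (hy : y k ≤ c)
    (hz : z ∈ segment ℝ x y) : z k ≤ c := by
  obtain ⟨a, b, ha, hb, hab, rfl⟩ := hz
  obtain rfl : a = 1 - b := by linarith
  simp only [PiLp.add_apply, PiLp.smul_apply, smul_eq_mul]
  nlinarith [mul_nonneg ha (sub_nonneg.2 hx), mul_nonneg hb (sub_nonneg.2 hy)]

lemma le_segment_coord {x y z : Plane} {k : Fin 2} {c : ℝ} (hx : c ≤ x k) (hy : c ≤ y k)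
    (hz : z ∈ segment ℝ x y) : c ≤ z k := by
  obtain ⟨a, b, ha, hb, hab, rfl⟩ := hz
  obtain rfl : a = 1 - b := by linarith
  simp only [PiLp.add_apply, PiLp.smul_apply, smul_eq_mul]
  nlinarith [mul_nonneg ha (sub_nonneg.2 hx), mul_nonneg hb (sub_nonneg.2 hy)]

/-- Bounds for the vertices are bounds for the region. -/
lemma region_coord_le {k : Fin 2} {c : ℝ} (h : ∀ i, P.vertex i k ≤ c) {z : Plane}
    (hz : z ∈ P.region) : z k ≤ c := by
  by_contra hcon
  refine P.notMem_region_of_forall_gt (k := k) (c := c) (fun y hy => ?_) (not_le.1 hcon) hz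
  obtain ⟨i, hi⟩ := P.mem_trace.1 hy
  exact segment_coord_le (h i) (h _) hi

lemma le_region_coord {k : Fin 2} {c : ℝ} (h : ∀ i, c ≤ P.vertex i k) {z : Plane}
    (hz : z ∈ P.region) : c ≤ z k := by
  by_contra hcon
  refine P.notMem_region_of_forall_lt (k := k) (c := c) (fun y hy => ?_) (not_le.1 hcon) hz
  obtain ⟨i, hi⟩ := P.mem_trace.1 hy
  exact le_segment_coord (h i) (h _) hi

lemma exists_farRegion_disjoint : ∃ M, 0 ≤ M ∧ Disjoint (farRegion M) P.region := by
  have hfin : ∃ M, ∀ i k, |P.vertex i k| ≤ M := by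
    obtain ⟨M, hM⟩ := (Set.finite_range fun q : Fin P.n × Fin 2 => |P.vertex q.1 q.2|).bddAbove
    exact ⟨M, fun i k => hM ⟨(i, k), rfl⟩⟩
  obtain ⟨M, hM⟩ := hfin
  have h4 := P.four_le
  refine ⟨M, (abs_nonneg _).trans (hM ⟨0, by omega⟩ 0), disjoint_left.2 fun z hz hzP => ?_⟩
  have hb : ∀ k, |z k| ≤ M := fun k => abs_le.2
    ⟨P.le_region_coord (fun i => (abs_le.1 (hM i k)).1) hzP,
      P.region_coord_le (fun i => (abs_le.1 (hM i k)).2) hzP⟩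
  rcases hz with h | h
  · exact absurd (hb 0) (not_le.2 h)
  · exact absurd (hb 1) (not_le.2 h)

lemma isCompact_region : IsCompact P.region := by
  obtain ⟨M, -, hM⟩ := P.exists_farRegion_disjoint
  refine Metric.isCompact_of_isClosed_isBounded P.isClosed_region ?_
  rw [Metric.isBounded_iff_subset_closedBall (0 : Plane)]
  refine ⟨|M| + |M|, fun z hz => ?_⟩
  have h := disjoint_right.1 hM hz
  simp only [farRegion, mem_ofPred_eq, not_or, not_lt] at h
  rw [mem_closedBall_zero_iff, EuclideanSpace.norm_eq, Real.sqrt_le_left (by positivity)]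
  simp only [Real.norm_eq_abs, sq_abs, Fin.sum_univ_two]
  have := le_abs_self M
  nlinarith [abs_le.1 h.1, abs_le.1 h.2, abs_nonneg M]

end RectilinearPolygon

/-- Two points in unbounded components of the complement of a bounded set lie in one component. -/
lemma exists_preconnected_of_unbounded {T : Set Plane} {M : ℝ} (hM : 0 ≤ M)
    (hT : Disjoint (farRegion M) T) {x y : Plane} (hx : x ∉ T) (hy : y ∉ T)
    (hux : ¬ Bornology.IsBounded (connectedComponentIn Tᶜ x))
    (huy : ¬ Bornology.IsBounded (connectedComponentIn Tᶜ y)) :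
    ∃ D : Set Plane, IsPreconnected D ∧ Disjoint D T ∧ x ∈ D ∧ y ∈ D := by
  have h1 := farRegion_subset_component hM hT hux
  have h2 := farRegion_subset_component hM hT huy
  have hp : (!₂[M + 1, 0] : Plane) ∈ farRegion M := by
    left
    simp only [Matrix.cons_val_zero]
    rw [abs_of_pos] <;> linarith
  refine ⟨_, IsPreconnected.union _ (h1 hp) (h2 hp) isPreconnected_connectedComponentIn
    isPreconnected_connectedComponentIn, ?_, Or.inl (mem_connectedComponentIn hx),
    Or.inr (mem_connectedComponentIn hy)⟩
  rw [disjoint_union_left]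
  exact ⟨disjoint_left.2 (connectedComponentIn_subset _ _),
    disjoint_left.2 (connectedComponentIn_subset _ _)⟩

namespace RectilinearPolygon

variable (P : RectilinearPolygon)

/-! ### Local coordinates along an edge -/

/-- The direction vector of an edge. -/
def dir (i : Fin P.n) : Plane := P.vertex (P.next i) - P.vertex i

/-- Coordinates along an edge: `frame i s t` is reached from the `i`-th vertex by going the fraction
`s` of the edge, and then to the left by the fraction `t` of the length of the edge. -/
def frame (i : Fin P.n) (s t : ℝ) : Plane := P.vertex i + s • P.dir i + t • rot (P.dir i)

variable {P} {i : Fin P.n}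

@[simp] lemma frame_zero_coord (s t : ℝ) :
    P.frame i s t 0 = P.vertex i 0 + s * P.dir i 0 - t * P.dir i 1 := by
  simp [frame]; ring

@[simp] lemma frame_one_coord (s t : ℝ) :
    P.frame i s t 1 = P.vertex i 1 + s * P.dir i 1 + t * P.dir i 0 := by
  simp [frame]

lemma frame_zero_zero : P.frame i 0 0 = P.vertex i := by simp [frame]

lemma frame_one_zero : P.frame i 1 0 = P.vertex (P.next i) := by simp [frame, dir]

lemma dir_coord (k : Fin 2) : P.dir i k = P.vertex (P.next i) k - P.vertex i k := rfl

lemma dir_ne_zero : P.dir i ≠ 0 := fun h => P.edge_ne i (sub_eq_zero.1 h).symm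

variable (P i) in
/-- The squared length of an edge. -/
def sqLen : ℝ := P.dir i 0 ^ 2 + P.dir i 1 ^ 2

lemma sqLen_pos : 0 < P.sqLen i := by
  by_contra h
  apply P.dir_ne_zero (i := i)
  have h' : P.dir i 0 ^ 2 + P.dir i 1 ^ 2 ≤ 0 := not_lt.1 h
  apply plane_ext
  · have : P.dir i 0 ^ 2 = 0 := by nlinarith [sq_nonneg (P.dir i 0), sq_nonneg (P.dir i 1)]
    simpa using this
  · have : P.dir i 1 ^ 2 = 0 := by nlinarith [sq_nonneg (P.dir i 0), sq_nonneg (P.dir i 1)]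
    simpa using this

variable (P i) in
/-- The first local coordinate of a point. -/
noncomputable def frameFst (z : Plane) : ℝ :=
  ((z 0 - P.vertex i 0) * P.dir i 0 + (z 1 - P.vertex i 1) * P.dir i 1) / P.sqLen i

variable (P i) in
/-- The second local coordinate of a point. -/
noncomputable def frameSnd (z : Plane) : ℝ :=
  ((z 1 - P.vertex i 1) * P.dir i 0 - (z 0 - P.vertex i 0) * P.dir i 1) / P.sqLen i

lemma frame_frameFst_frameSnd (z : Plane) : P.frame i (P.frameFst i z) (P.frameSnd i z) = z := by
  have := (sqLen_pos (P := P) (i := i)).ne'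
  apply plane_ext
  · simp only [frame_zero_coord, frameFst, frameSnd]; field_simp; simp only [sqLen]; ring
  · simp only [frame_one_coord, frameFst, frameSnd]; field_simp; simp only [sqLen]; ring

@[simp] lemma frameFst_frame (s t : ℝ) : P.frameFst i (P.frame i s t) = s := by
  have := (sqLen_pos (P := P) (i := i)).ne'
  simp only [frame_zero_coord, frame_one_coord, frameFst]; field_simp; simp only [sqLen]; ring

@[simp] lemma frameSnd_frame (s t : ℝ) : P.frameSnd i (P.frame i s t) = t := by
  have := (sqLen_pos (P := P) (i := i)).ne'
  simp only [frame_zero_coord, frame_one_coord, frameSnd]; field_simp; simp only [sqLen]; ring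

lemma frame_inj {s t s' t' : ℝ} (h : P.frame i s t = P.frame i s' t') : s = s' ∧ t = t' := by
  have h1 := congrArg (P.frameFst i) h
  have h2 := congrArg (P.frameSnd i) h
  simp at h1 h2
  exact ⟨h1, h2⟩

lemma continuous_frame : Continuous fun q : ℝ × ℝ => P.frame i q.1 q.2 := by
  unfold frame; fun_prop

lemma continuous_frameFst : Continuous (P.frameFst i) := by
  unfold frameFst; fun_prop

lemma continuous_frameSnd : Continuous (P.frameSnd i) := by
  unfold frameSnd; fun_prop

/-- Points near a given point have local coordinates near those of this point. -/
lemma eventually_frame (s t : ℝ) {r : ℝ} (hr : 0 < r) :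
    ∀ᶠ z in 𝓝 (P.frame i s t), ∃ s' t', z = P.frame i s' t' ∧ |s' - s| < r ∧ |t' - t| < r := by
  have h1 := Metric.tendsto_nhds.1 ((continuous_frameFst (P := P) (i := i)).tendsto
    (P.frame i s t)) r hr
  have h2 := Metric.tendsto_nhds.1 ((continuous_frameSnd (P := P) (i := i)).tendsto
    (P.frame i s t)) r hr
  filter_upwards [h1, h2] with z h1 h2
  rw [frameFst_frame, Real.dist_eq] at h1
  rw [frameSnd_frame, Real.dist_eq] at h2
  exact ⟨_, _, (frame_frameFst_frameSnd z).symm, h1, h2⟩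

lemma frame_segment (s t s' t' θ : ℝ) : (1 - θ) • P.frame i s t + θ • P.frame i s' t' =
    P.frame i ((1 - θ) * s + θ * s') ((1 - θ) * t + θ * t') := by
  apply plane_ext <;> simp <;> ring

lemma mem_edge_iff {z : Plane} : z ∈ P.edge i ↔ ∃ s, 0 ≤ s ∧ s ≤ 1 ∧ z = P.frame i s 0 := by
  rw [edge_eq, ← frame_one_zero, ← frame_zero_zero, segment_eq_image]
  constructor
  · rintro ⟨θ, ⟨h0, h1⟩, rfl⟩
    exact ⟨θ, h0, h1, by simp only [frame_segment]; simp⟩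
  · rintro ⟨s, h0, h1, rfl⟩
    exact ⟨s, ⟨h0, h1⟩, by simp only [frame_segment]; simp⟩

lemma frame_mem_edge {s : ℝ} (h0 : 0 ≤ s) (h1 : s ≤ 1) : P.frame i s 0 ∈ P.edge i :=
  mem_edge_iff.2 ⟨s, h0, h1, rfl⟩

/-- Edges are axis-parallel, in alternation. -/
lemma dir_alternating (i : Fin P.n) : (P.dir i 1 = 0 ∧ P.dir (P.next i) 0 = 0) ∨
    (P.dir i 0 = 0 ∧ P.dir (P.next i) 1 = 0) := by
  rcases P.alternating i with ⟨h1, h2⟩ | ⟨h1, h2⟩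
  · left; simp only [dir_coord, next] at *; constructor <;> linarith
  · right; simp only [dir_coord, next] at *; constructor <;> linarith

lemma dir_axis (i : Fin P.n) : P.dir i 1 = 0 ∨ P.dir i 0 = 0 := by
  rcases dir_alternating i with h | h
  exacts [Or.inl h.1, Or.inr h.1]

/-- A vector that is perpendicular to the nonzero vector `u` is a multiple of the rotated `u`. -/
lemma exists_smul_rot {u v : Plane} (hv : v ≠ 0) (hu : 0 < u 0 ^ 2 + u 1 ^ 2)
    (h : u 0 * v 0 + u 1 * v 1 = 0) : ∃ c : ℝ, c ≠ 0 ∧ v = c • rot u := by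
  have e : v = ((u 0 * v 1 - u 1 * v 0) / (u 0 ^ 2 + u 1 ^ 2)) • rot u := by
    apply plane_ext
    · simp; field_simp; linear_combination (u 0) * h
    · simp; field_simp; linear_combination (u 1) * h
  refine ⟨_, fun h0 => hv ?_, e⟩
  rw [e, h0, zero_smul]

lemma exists_endTurn (i : Fin P.n) : ∃ b : ℝ, b ≠ 0 ∧ P.dir (P.next i) = b • rot (P.dir i) := by
  apply exists_smul_rot dir_ne_zero sqLen_pos
  rcases dir_alternating i with h | h <;> rw [h.1, h.2] <;> ring

lemma exists_startTurn (i : Fin P.n) :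
    ∃ a : ℝ, a ≠ 0 ∧ P.vertex (P.prev i) = P.frame i 0 a := by
  have hd : P.dir (P.prev i) = P.vertex i - P.vertex (P.prev i) := by simp [dir]
  obtain ⟨a, ha, e⟩ := exists_smul_rot (u := P.dir i) (v := -P.dir (P.prev i))
    (neg_ne_zero.2 dir_ne_zero) sqLen_pos (by
      have := dir_alternating (P.prev i)
      rw [next_prev] at this
      rcases this with h | h <;> simp [h.1, h.2])
  refine ⟨a, ha, ?_⟩
  rw [frame, ← e, hd]; simp

variable (P i) in
/-- The second local coordinate, along the `i`-th edge, of the vertex after this edge. -/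
noncomputable def endTurn : ℝ := (exists_endTurn i).choose

variable (P i) in
/-- The second local coordinate, along the `i`-th edge, of the vertex before this edge. -/
noncomputable def startTurn : ℝ := (exists_startTurn i).choose

lemma endTurn_ne_zero : P.endTurn i ≠ 0 := (exists_endTurn i).choose_spec.1
lemma startTurn_ne_zero : P.startTurn i ≠ 0 := (exists_startTurn i).choose_spec.1

lemma dir_next : P.dir (P.next i) = P.endTurn i • rot (P.dir i) := (exists_endTurn i).choose_spec.2

lemma vertex_prev : P.vertex (P.prev i) = P.frame i 0 (P.startTurn i) :=
  (exists_startTurn i).choose_spec.2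

lemma frame_next (s t : ℝ) :
    P.frame (P.next i) s t = P.frame i (1 - P.endTurn i * t) (P.endTurn i * s) := by
  have h0 := congrArg (fun v : Plane => v 0) (dir_next (i := i))
  have h1 := congrArg (fun v : Plane => v 1) (dir_next (i := i))
  have e0 := dir_coord (P := P) (i := i) 0
  have e1 := dir_coord (P := P) (i := i) 1
  simp at h0 h1
  apply plane_ext
  · simp [h0, h1]; linarith
  · simp [h0, h1]; linarith

lemma endTurn_mul_startTurn_next : P.endTurn i * P.startTurn (P.next i) = 1 := by
  have h : P.frame i 0 0 = P.frame i (1 - P.endTurn i * P.startTurn (P.next i)) 0 := by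
    have := vertex_prev (P := P) (i := P.next i)
    rw [prev_next, frame_next, mul_zero] at this
    rw [frame_zero_zero, this]
  linarith [(frame_inj h).1]

lemma mem_edge_next_iff {z : Plane} :
    z ∈ P.edge (P.next i) ↔ ∃ s, 0 ≤ s ∧ s ≤ 1 ∧ z = P.frame i 1 (P.endTurn i * s) := by
  simp [mem_edge_iff, frame_next]

lemma mem_edge_prev_iff {z : Plane} :
    z ∈ P.edge (P.prev i) ↔ ∃ s, 0 ≤ s ∧ s ≤ 1 ∧ z = P.frame i 0 (P.startTurn i * s) := by
  rw [edge_eq, next_prev, vertex_prev, ← frame_zero_zero, segment_symm, segment_eq_image]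
  constructor
  · rintro ⟨θ, ⟨h0, h1⟩, rfl⟩
    exact ⟨θ, h0, h1, by simp only [frame_segment]; simp [mul_comm]⟩
  · rintro ⟨s, h0, h1, rfl⟩
    exact ⟨s, ⟨h0, h1⟩, by simp only [frame_segment]; simp [mul_comm]⟩

lemma norm_rot (v : Plane) : ‖rot v‖ = ‖v‖ := by
  rw [EuclideanSpace.norm_eq, EuclideanSpace.norm_eq]
  simp [Fin.sum_univ_two, add_comm]

/-- Around an edge, the boundary consists of this edge and of initial pieces of the two adjacent
edges, which are perpendicular to it. -/
lemma exists_margin (i : Fin P.n) : ∃ δ : ℝ, 0 < δ ∧ ∀ s t : ℝ, -δ < s → s < 1 + δ → |t| < δ →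
    (P.frame i s t ∈ P.trace ↔ (t = 0 ∧ 0 ≤ s ∧ s ≤ 1) ∨ (s = 0 ∧ 0 ≤ P.startTurn i * t) ∨
      (s = 1 ∧ 0 ≤ P.endTurn i * t)) := by
  have hF : IsClosed (⋃ j ∈ {j | j ≠ i ∧ j ≠ P.next i ∧ j ≠ P.prev i}, P.edge j) :=
    (Set.toFinite _).isClosed_biUnion fun j _ => (P.isCompact_edge j).isClosed
  have hdis : P.edge i ⊆ (⋃ j ∈ {j | j ≠ i ∧ j ≠ P.next i ∧ j ≠ P.prev i}, P.edge j)ᶜ := by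
    intro z hz hz'
    simp only [mem_iUnion] at hz'
    obtain ⟨j, ⟨h1, h2, h3⟩, hj⟩ := hz'
    rcases P.simple i j z hz hj with h | h | h
    · exact h1 h.symm
    · exact h2 h.1
    · apply h3
      rw [show i = P.next j from h.1, prev_next]
  obtain ⟨ε, hε, hth⟩ := (P.isCompact_edge i).exists_thickening_subset_open hF.isOpen_compl hdis
  set L := ‖P.dir i‖ with hL
  have hL0 : 0 ≤ L := norm_nonneg _
  have ha := abs_pos.2 (startTurn_ne_zero (P := P) (i := i))
  have hb := abs_pos.2 (endTurn_ne_zero (P := P) (i := i))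
  refine ⟨min (ε / (2 * (L + 1))) (min |P.startTurn i| |P.endTurn i|), by positivity, ?_⟩
  intro s t hs0 hs1 ht
  set δ := min (ε / (2 * (L + 1))) (min |P.startTurn i| |P.endTurn i|)
  have hδε : δ * (2 * (L + 1)) ≤ ε := by
    rw [← le_div_iff₀ (by positivity)]; exact min_le_left _ _
  have hδa : δ ≤ |P.startTurn i| := (min_le_right _ _).trans (min_le_left _ _)
  have hδb : δ ≤ |P.endTurn i| := (min_le_right _ _).trans (min_le_right _ _)
  have hnear : P.frame i s t ∈ Metric.thickening ε (P.edge i) := by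
    rw [Metric.mem_thickening_iff]
    refine ⟨P.frame i (max 0 (min s 1)) 0, frame_mem_edge (le_max_left _ _)
      (max_le zero_le_one (min_le_right _ _)), ?_⟩
    have e : P.frame i s t - P.frame i (max 0 (min s 1)) 0 =
        (s - max 0 (min s 1)) • P.dir i + t • rot (P.dir i) := by
      simp only [frame, sub_smul, zero_smul]; abel
    rw [dist_eq_norm, e]
    have hsc : |s - max 0 (min s 1)| < δ := by
      rw [abs_lt]
      rcases max_cases 0 (min s 1) with h | h <;> rcases min_cases s 1 with h' | h' <;>
        constructor <;> linarith [abs_nonneg t]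
    calc _ ≤ |s - max 0 (min s 1)| * L + |t| * L := by
            refine (norm_add_le _ _).trans ?_
            rw [norm_smul, norm_smul, norm_rot, Real.norm_eq_abs, Real.norm_eq_abs]
      _ ≤ δ * L + δ * L := by gcongr
      _ < ε := by nlinarith [abs_nonneg t]
  constructor
  · intro h
    obtain ⟨j, hj⟩ := P.mem_trace.1 h
    have hj' : ¬ (j ≠ i ∧ j ≠ P.next i ∧ j ≠ P.prev i) := fun hne =>
      hth hnear (mem_iUnion₂.2 ⟨j, hne, hj⟩)
    by_cases h1 : j = i
    · subst h1
      obtain ⟨s', h0, h1, e⟩ := mem_edge_iff.1 hj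
      obtain ⟨rfl, rfl⟩ := frame_inj e
      exact Or.inl ⟨rfl, h0, h1⟩
    · by_cases h2 : j = P.next i
      · subst h2
        obtain ⟨s', h0, h1, e⟩ := mem_edge_next_iff.1 hj
        obtain ⟨rfl, rfl⟩ := frame_inj e
        refine Or.inr (Or.inr ⟨rfl, ?_⟩)
        rw [← mul_assoc]; exact mul_nonneg (mul_self_nonneg _) h0
      · have h3 : j = P.prev i := by tauto
        subst h3
        obtain ⟨s', h0, h1, e⟩ := mem_edge_prev_iff.1 hj
        obtain ⟨rfl, rfl⟩ := frame_inj e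
        refine Or.inr (Or.inl ⟨rfl, ?_⟩)
        rw [← mul_assoc]; exact mul_nonneg (mul_self_nonneg _) h0
  · -- a number of the sign of `c` and of smaller absolute value is a fraction of `c`
    have frac : ∀ c : ℝ, c ≠ 0 → δ ≤ |c| → 0 ≤ c * t → ∃ x, 0 ≤ x ∧ x ≤ 1 ∧ t = c * x := by
      intro c hc hδ h
      refine ⟨t / c, ?_, ?_, by field_simp⟩
      · rw [← mul_div_mul_left _ _ hc]; exact div_nonneg h (mul_self_nonneg c)
      · refine (le_abs_self _).trans ?_
        rw [abs_div, div_le_one (abs_pos.2 hc)]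
        linarith
    rintro (⟨rfl, h0, h1⟩ | ⟨rfl, h⟩ | ⟨rfl, h⟩)
    · exact P.edge_subset_trace i (frame_mem_edge h0 h1)
    · obtain ⟨x, h0, h1, rfl⟩ := frac _ startTurn_ne_zero hδa h
      exact P.edge_subset_trace _ (mem_edge_prev_iff.2 ⟨x, h0, h1, rfl⟩)
    · obtain ⟨x, h0, h1, rfl⟩ := frac _ endTurn_ne_zero hδb h
      exact P.edge_subset_trace _ (mem_edge_next_iff.2 ⟨x, h0, h1, rfl⟩)

variable (P i) in
/-- A bound within which local coordinates along the `i`-th edge see no other edges than this one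
and its two neighbours. -/
noncomputable def margin : ℝ := (exists_margin i).choose

lemma margin_pos : 0 < P.margin i := (exists_margin i).choose_spec.1

lemma frame_mem_trace_iff {s t : ℝ} (h0 : -P.margin i < s) (h1 : s < 1 + P.margin i)
    (ht : |t| < P.margin i) :
    P.frame i s t ∈ P.trace ↔ (t = 0 ∧ 0 ≤ s ∧ s ≤ 1) ∨ (s = 0 ∧ 0 ≤ P.startTurn i * t) ∨
      (s = 1 ∧ 0 ≤ P.endTurn i * t) :=
  (exists_margin i).choose_spec.2 s t h0 h1 ht

variable (P i) in
/-- A rectangle in local coordinates; `η = ±1` chooses the side of the edge on which the second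
coordinate is counted as positive. -/
def frameRect (η s₁ s₂ t₁ t₂ : ℝ) : Set Plane :=
  (fun q : ℝ × ℝ => P.frame i q.1 (η * q.2)) '' (Ioo s₁ s₂ ×ˢ Ioo t₁ t₂)

lemma isPreconnected_frameRect (η s₁ s₂ t₁ t₂ : ℝ) :
    IsPreconnected (P.frameRect i η s₁ s₂ t₁ t₂) := by
  refine (((convex_Ioo _ _).prod (convex_Ioo _ _)).isPreconnected).image _ ?_
  have : Continuous fun q : ℝ × ℝ => P.frame i q.1 (η * q.2) := by unfold frame; fun_prop
  exact this.continuousOn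

lemma mem_frameRect {η s₁ s₂ t₁ t₂ s t : ℝ} (h1 : s₁ < s) (h2 : s < s₂) (h3 : t₁ < t)
    (h4 : t < t₂) :
    P.frame i s (η * t) ∈ P.frameRect i η s₁ s₂ t₁ t₂ := ⟨(s, t), ⟨⟨h1, h2⟩, h3, h4⟩, rfl⟩

/-- A rectangle in local coordinates that misses the boundary. -/
lemma frameRect_disjoint_trace {η : ℝ} (hη : η = 1 ∨ η = -1) {s₁ s₂ t₁ t₂ : ℝ}
    (hs₁ : -P.margin i ≤ s₁) (hs₂ : s₂ ≤ 1 + P.margin i) (ht₁ : -P.margin i ≤ t₁)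
    (ht₂ : t₂ ≤ P.margin i)
    (h : ∀ s t, s₁ < s → s < s₂ → t₁ < t → t < t₂ → ¬ ((t = 0 ∧ 0 ≤ s ∧ s ≤ 1) ∨
      (s = 0 ∧ 0 ≤ P.startTurn i * η * t) ∨ (s = 1 ∧ 0 ≤ P.endTurn i * η * t))) :
    Disjoint (P.frameRect i η s₁ s₂ t₁ t₂) P.trace := by
  rw [disjoint_left]
  rintro _ ⟨⟨s, t⟩, ⟨⟨h1, h2⟩, h3, h4⟩, rfl⟩ hz
  simp only at h1 h2 h3 h4 hz
  have habs : |η * t| < P.margin i := by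
    rw [abs_lt]; rcases hη with rfl | rfl <;> constructor <;> linarith
  rw [frame_mem_trace_iff (by linarith) (by linarith) habs] at hz
  apply h s t h1 h2 h3 h4
  have hη0 : η ≠ 0 := by rcases hη with rfl | rfl <;> norm_num
  simpa [hη0, mul_assoc] using hz

lemma frameRect_region {η : ℝ} {s₁ s₂ t₁ t₂ s t s' t' : ℝ}
    (hd : Disjoint (P.frameRect i η s₁ s₂ t₁ t₂) P.trace)
    (h1 : s₁ < s) (h2 : s < s₂) (h3 : t₁ < t) (h4 : t < t₂)
    (h1' : s₁ < s') (h2' : s' < s₂) (h3' : t₁ < t') (h4' : t' < t₂) :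
    P.frame i s (η * t) ∈ P.region ↔ P.frame i s' (η * t') ∈ P.region :=
  ⟨P.mem_region_of_preconnected (isPreconnected_frameRect _ _ _ _ _) hd
    (mem_frameRect h1 h2 h3 h4) (mem_frameRect h1' h2' h3' h4'),
   P.mem_region_of_preconnected (isPreconnected_frameRect _ _ _ _ _) hd
    (mem_frameRect h1' h2' h3' h4') (mem_frameRect h1 h2 h3 h4)⟩

end RectilinearPolygon

namespace RectilinearPolygon

variable {P : RectilinearPolygon} {i : Fin P.n}

/-! ### Inside and outside along the boundary -/

lemma collar_disjoint_trace {η : ℝ} (hη : η = 1 ∨ η = -1) :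
    Disjoint (P.frameRect i η 0 1 0 (P.margin i)) P.trace := by
  have := margin_pos (i := i)
  refine frameRect_disjoint_trace hη (by linarith) (by linarith) (by linarith) le_rfl ?_
  rintro s t h1 h2 h3 h4 (h | h | h) <;> linarith [h.1]

lemma before_disjoint_trace {η : ℝ} (hη : η = 1 ∨ η = -1) :
    Disjoint (P.frameRect i η (-P.margin i) 0 (-P.margin i) (P.margin i)) P.trace := by
  have := margin_pos (i := i)
  refine frameRect_disjoint_trace hη le_rfl (by linarith) le_rfl le_rfl ?_
  rintro s t h1 h2 h3 h4 (h | h | h) <;> linarith [h.1, h.2]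

lemma after_disjoint_trace {η : ℝ} (hη : η = 1 ∨ η = -1) :
    Disjoint (P.frameRect i η 1 (1 + P.margin i) (-P.margin i) (P.margin i)) P.trace := by
  have := margin_pos (i := i)
  refine frameRect_disjoint_trace hη (by linarith) le_rfl le_rfl le_rfl ?_
  rintro s t h1 h2 h3 h4 (h | h | h) <;> linarith [h.1, h.2]

/-- If the next edge turns away from a side of an edge, this side extends beyond the end. -/
lemma collar_after_disjoint_trace {η : ℝ} (hη : η = 1 ∨ η = -1) (h : P.endTurn i * η < 0) :
    Disjoint (P.frameRect i η 0 (1 + P.margin i) 0 (P.margin i)) P.trace := by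
  have := margin_pos (i := i)
  refine frameRect_disjoint_trace hη (by linarith) le_rfl (by linarith) le_rfl ?_
  rintro s t h1 h2 h3 h4 (h | h | h)
  · linarith [h.1]
  · linarith [h.1]
  · nlinarith [h.2]

/-- If the previous edge arrives from the other side of an edge, this side extends beyond the
start. -/
lemma collar_before_disjoint_trace {η : ℝ} (hη : η = 1 ∨ η = -1) (h : P.startTurn i * η < 0) :
    Disjoint (P.frameRect i η (-P.margin i) 1 0 (P.margin i)) P.trace := by
  have := margin_pos (i := i)
  refine frameRect_disjoint_trace hη le_rfl (by linarith) (by linarith) le_rfl ?_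
  rintro s t h1 h2 h3 h4 (h | h | h)
  · linarith [h.1]
  · nlinarith [h.2]
  · linarith [h.1]

lemma mem_openSegment_iff {z : Plane} : z ∈ openSegment ℝ (P.vertex i) (P.vertex (P.next i)) ↔
    ∃ s, 0 < s ∧ s < 1 ∧ z = P.frame i s 0 := by
  rw [← frame_one_zero, ← frame_zero_zero, openSegment_eq_image]
  constructor
  · rintro ⟨θ, ⟨h0, h1⟩, rfl⟩
    exact ⟨θ, h0, h1, by simp only [frame_segment]; simp⟩
  · rintro ⟨s, h0, h1, rfl⟩
    exact ⟨s, ⟨h0, h1⟩, by simp only [frame_segment]; simp⟩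

/-- A closed curve through an edge separates the two sides of the edge near its midpoint, if the
rest of the curve avoids this midpoint. -/
lemma edge_separation {S : Set Plane} (hS : P.frame i (1 / 2) 0 ∉ S)
    (hj : PolyJoined S (P.vertex (P.next i)) (P.vertex i)) :
    ∃ ε, 0 < ε ∧ ε < P.margin i ∧ ∀ D : Set Plane, IsPreconnected D → Disjoint D S →
      Disjoint D (P.edge i) → P.frame i (1 / 2) ε ∈ D → P.frame i (1 / 2) (-ε) ∉ D := by
  have hsep := separation (P.edge_ne i)
    (mem_openSegment_iff.2 ⟨1 / 2, by norm_num, by norm_num, rfl⟩) hS hj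
  obtain ⟨ε, hε, hε0, hεm⟩ := (hsep.and (Ioo_mem_nhdsGT (margin_pos (i := i)))).exists
  refine ⟨ε, hε0, hεm, fun D h1 h2 h3 h4 h5 => ?_⟩
  have hp : ∀ ε : ℝ, P.frame i (1 / 2) 0 + ε • rot (P.vertex (P.next i) - P.vertex i) =
      P.frame i (1 / 2) ε := fun ε => by simp [frame, dir]
  exact hε D h1 h2 h3 (by rw [← hp] at h4; exact h4)
    (by rw [← hp, neg_smul, ← sub_eq_add_neg] at h5; exact h5)

variable (P) in
/-- The side `η = ±1` of an edge lies in the polygon. -/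
def SideInside (i : Fin P.n) (η : ℝ) : Prop :=
  P.frame i (1 / 2) (η * (P.margin i / 2)) ∈ P.region

lemma sideInside_iff {η : ℝ} (hη : η = 1 ∨ η = -1) {s t : ℝ} (h1 : 0 < s) (h2 : s < 1) (h3 : 0 < t)
    (h4 : t < P.margin i) : P.SideInside i η ↔ P.frame i s (η * t) ∈ P.region := by
  have := margin_pos (i := i)
  exact frameRect_region (collar_disjoint_trace hη) (by norm_num) (by norm_num) (by linarith)
    (by linarith) h1 h2 h3 h4

/-- The same side of consecutive edges is inside. -/
lemma sideInside_next {η : ℝ} (hη : η = 1 ∨ η = -1) :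
    P.SideInside (P.next i) η ↔ P.SideInside i η := by
  have hm := margin_pos (i := i)
  have hm' := margin_pos (i := P.next i)
  have hb0 := endTurn_ne_zero (i := i)
  set b := P.endTurn i with hb
  have hbp := abs_pos.2 hb0
  obtain ⟨ρ, hρ0, hρ⟩ : ∃ ρ : ℝ, 0 < ρ ∧ ρ < min (min 1 (P.margin (P.next i)))
      (min (1 / |b|) (P.margin i / |b|)) :=
    exists_between (by positivity)
  have h1 : ρ < 1 := hρ.trans_le ((min_le_left _ _).trans (min_le_left _ _))
  have h2 : ρ < P.margin (P.next i) := hρ.trans_le ((min_le_left _ _).trans (min_le_right _ _))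
  have h3 : |b| * ρ < 1 := by
    rw [mul_comm, ← lt_div_iff₀ hbp]
    exact hρ.trans_le ((min_le_right _ _).trans (min_le_left _ _))
  have h4 : |b| * ρ < P.margin i := by
    rw [mul_comm, ← lt_div_iff₀ hbp]
    exact hρ.trans_le ((min_le_right _ _).trans (min_le_right _ _))
  have h5 : 0 < |b| * ρ := by positivity
  rw [sideInside_iff hη hρ0 h1 hρ0 h2, frame_next, ← hb]
  have hηη : η * η = 1 := by rcases hη with rfl | rfl <;> norm_num
  rcases lt_or_gt_of_ne (show b * η ≠ 0 by
    rcases hη with rfl | rfl <;> simpa using hb0) with hneg | hpos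
  · -- a turn away from the side: go around the corner
    have e : b = -(|b| * η) := by
      rcases hη with rfl | rfl
      · rw [abs_of_neg (by linarith)]; ring
      · rw [abs_of_pos (by linarith)]; ring
    have e1 : 1 - b * (η * ρ) = 1 + |b| * ρ := by
      rw [e, abs_neg, abs_mul, abs_abs, show |η| = 1 by rcases hη with rfl | rfl <;> norm_num]
      linear_combination (|b| * ρ) * hηη
    have e2 : b * ρ = η * (-(|b| * ρ)) := by
      nth_rewrite 1 [e]; ring
    rw [e1, e2, frameRect_region (after_disjoint_trace hη) (s' := 1 + |b| * ρ) (t' := |b| * ρ)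
      (by linarith) (by linarith) (by linarith) (by linarith) (by linarith) (by linarith)
      (by linarith) (by linarith),
      frameRect_region (collar_after_disjoint_trace hη hneg) (s' := 1 / 2) (t' := P.margin i / 2)
      (by linarith) (by linarith) (by linarith) (by linarith) (by linarith) (by linarith)
      (by linarith) (by linarith)]
    rfl
  · have e : b = |b| * η := by
      rcases hη with rfl | rfl
      · rw [abs_of_pos (by linarith)]; ring
      · rw [abs_of_neg (by linarith)]; ring
    have e1 : 1 - b * (η * ρ) = 1 - |b| * ρ := by
      rw [e, abs_mul, abs_abs, show |η| = 1 by rcases hη with rfl | rfl <;> norm_num]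
      linear_combination (-(|b| * ρ)) * hηη
    have e2 : b * ρ = η * (|b| * ρ) := by
      nth_rewrite 1 [e]; ring
    rw [e1, e2, ← sideInside_iff hη (by linarith) (by linarith) (by linarith) (by linarith)]

variable (P) in
/-- `η = 1` if the interior lies to the left of the edges, and `η = -1` if it lies to the right. -/
def IsOrientation (η : ℝ) : Prop :=
  (η = 1 ∨ η = -1) ∧ ∀ i s t, 0 < s → s < 1 → 0 < t → t < P.margin i →
    P.frame i s (η * t) ∈ P.region ∧ P.frame i s (-η * t) ∉ P.region

variable (P) in
/-- A vertical edge on the left side of the bounding box. -/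
def IsLeftmost (i : Fin P.n) : Prop :=
  P.vertex i 0 = P.vertex (P.next i) 0 ∧ ∀ k, P.vertex i 0 ≤ P.vertex k 0

variable (P) in
lemma exists_isLeftmost : ∃ i, P.IsLeftmost i := by
  have h4 := P.four_le
  have : Nonempty (Fin P.n) := ⟨⟨0, by omega⟩⟩
  obtain ⟨i, hi⟩ := Finite.exists_min fun i => P.vertex i 0
  rcases dir_alternating (P.prev i) with h | h
  · refine ⟨i, ?_, hi⟩
    have := h.2
    rw [next_prev, dir_coord] at this
    linarith
  · have h' := h.1
    rw [dir_coord, next_prev] at h'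
    refine ⟨P.prev i, by rw [next_prev]; linarith, fun k => by have := hi k; linarith⟩

/-- The orientation can be read off from the direction of a leftmost edge. -/
lemma IsLeftmost.isOrientation (hi : P.IsLeftmost i) {η : ℝ} (hη : η = 1 ∨ η = -1)
    (h : 0 < η * (P.vertex i 1 - P.vertex (P.next i) 1)) : P.IsOrientation η := by
  have hm := margin_pos (i := i)
  have hη' : -η = 1 ∨ -η = -1 := by rcases hη with rfl | rfl <;> simp
  have hd0 : P.dir i 0 = 0 := by rw [dir_coord, hi.1, sub_self]
  have hd1 : η * P.dir i 1 < 0 := by rw [dir_coord]; linarith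
  -- the outer side is separated from the polygon by a vertical line
  have hout : ¬ P.SideInside i (-η) := by
    refine P.notMem_region_of_forall_lt (k := 0) (c := P.vertex i 0) (fun z hz => ?_) ?_
    · exact P.le_region_coord hi.2 (P.trace_subset_region hz)
    · rw [frame_zero_coord, hd0]
      nlinarith
  -- the inner side cannot be outside as well
  have hin : P.SideInside i η := by
    by_contra hin
    have hmS : P.frame i (1 / 2) 0 ∉ ⋃ j ∈ {j | j ≠ i}, P.edge j := by
      intro hz
      simp only [mem_iUnion] at hz
      obtain ⟨j, hj, hz⟩ := hz
      rcases P.simple i j _ (frame_mem_edge (by norm_num) (by norm_num)) hz with h | ⟨rfl, h⟩ | h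
      · exact hj h.symm
      · have h : P.frame i (1 / 2) 0 = P.vertex (P.next i) := h
        rw [← frame_one_zero] at h
        linarith [(frame_inj h).1]
      · have h := h.2
        rw [← frame_zero_zero] at h
        linarith [(frame_inj h).1]
    obtain ⟨ε, hε0, hεm, hε⟩ := edge_separation hmS (P.polyJoined_compl_edge i)
    obtain ⟨M, hM, hMd⟩ := P.exists_farRegion_disjoint
    have hbu : ∀ η : ℝ, (η = 1 ∨ η = -1) → ¬ P.SideInside i η →
        P.frame i (1 / 2) (η * ε) ∉ P.trace ∧ ¬ Bornology.IsBounded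
          (connectedComponentIn P.traceᶜ (P.frame i (1 / 2) (η * ε))) := by
      intro η hη h
      rw [sideInside_iff hη (s := 1 / 2) (by norm_num) (by norm_num) hε0 hεm] at h
      have h' : P.frame i (1 / 2) (η * ε) ∉ P.trace := fun h' => h (P.trace_subset_region h')
      exact ⟨h', by rwa [P.mem_region_iff h'] at h⟩
    have hone : ∀ η : ℝ, (η = 1 ∨ η = -1) → ¬ P.SideInside i η := by
      rcases hη with rfl | rfl <;> rintro η' (rfl | rfl) <;> first | assumption | simpa using hout
    obtain ⟨D, hD, hDT, hx, hy⟩ := exists_preconnected_of_unbounded hM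
      (hMd.mono_right P.trace_subset_region) (hbu 1 (by simp) (hone _ (by simp))).1
      (hbu (-1) (by simp) (hone _ (by simp))).1 (hbu 1 (by simp) (hone _ (by simp))).2
      (hbu (-1) (by simp) (hone _ (by simp))).2
    refine hε D hD (hDT.mono_right ?_) (hDT.mono_right (P.edge_subset_trace i)) (by simpa using hx)
      (by simpa using hy)
    exact iUnion₂_subset fun j _ => P.edge_subset_trace j
  have hall : ∀ j, P.SideInside j η ∧ ¬ P.SideInside j (-η) :=
    P.boundary_induction ⟨hin, hout⟩ fun j hj => by
      rwa [sideInside_next hη, sideInside_next hη']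
  exact ⟨hη, fun j s t h1 h2 h3 h4 => ⟨(sideInside_iff hη h1 h2 h3 h4).1 (hall j).1,
    fun h => (hall j).2 ((sideInside_iff hη' h1 h2 h3 h4).2 h)⟩⟩

variable (P) in
lemma exists_isOrientation : ∃ η, P.IsOrientation η := by
  obtain ⟨i, hi⟩ := P.exists_isLeftmost
  have hne : P.vertex i 1 - P.vertex (P.next i) 1 ≠ 0 := by
    intro h
    have h1 : _ = P.vertex (P.next i) 1 := sub_eq_zero.1 h
    exact P.edge_ne i (plane_ext hi.1 h1)
  rcases lt_or_gt_of_ne hne with h | h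
  · exact ⟨-1, hi.isOrientation (by simp) (by linarith)⟩
  · exact ⟨1, hi.isOrientation (by simp) (by linarith)⟩

/-! ### Consequences: frontier, inner normals and reflex vertices -/

lemma frame_add_smul_rot (s t ε : ℝ) :
    P.frame i s t + ε • rot (P.dir i) = P.frame i s (t + ε) := by
  simp only [frame, add_smul]; abel

lemma collar_notMem_trace {s t : ℝ} (h1 : 0 < s) (h2 : s < 1) (h3 : t ≠ 0)
    (h4 : |t| < P.margin i) : P.frame i s t ∉ P.trace := by
  have := margin_pos (i := i)
  rw [frame_mem_trace_iff (by linarith) (by linarith) h4]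
  rintro (h | h | h)
  exacts [h3 h.1, by linarith [h.1], by linarith [h.1]]

namespace IsOrientation

variable {η : ℝ}

lemma mul_self (hη : P.IsOrientation η) : η * η = 1 := by
  rcases hη.1 with rfl | rfl <;> norm_num

lemma inside (hη : P.IsOrientation η) {s t : ℝ} (h1 : 0 < s) (h2 : s < 1) (h3 : 0 < η * t)
    (h4 : |t| < P.margin i) : P.frame i s t ∈ P.region := by
  have := (hη.2 i s (η * t) h1 h2 h3 (by
    rcases hη.1 with rfl | rfl <;> linarith [le_abs_self t, neg_abs_le t])).1
  rwa [← mul_assoc, hη.mul_self, one_mul] at this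

lemma outside (hη : P.IsOrientation η) {s t : ℝ} (h1 : 0 < s) (h2 : s < 1) (h3 : η * t < 0)
    (h4 : |t| < P.margin i) : P.frame i s t ∉ P.region := by
  have := (hη.2 i s (-(η * t)) h1 h2 (by linarith) (by
    rcases hη.1 with rfl | rfl <;> linarith [le_abs_self t, neg_abs_le t])).2
  rwa [neg_mul_neg, ← mul_assoc, hη.mul_self, one_mul] at this

lemma isInnerNormal_iff (hη : P.IsOrientation η) {ν : Plane} :
    P.IsInnerNormal i ν ↔ ∃ c, 0 < c ∧ ν = (η * c) • rot (P.dir i) := by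
  have hm := margin_pos (i := i)
  -- for small `ε`, the second coordinate `ε * c` stays within the margin
  have hsmall : ∀ c : ℝ, ∀ᶠ ε : ℝ in 𝓝[>] 0, |ε * c| < P.margin i := fun c => by
    have h : Continuous fun ε : ℝ => |ε * c| := by fun_prop
    have := (h.tendsto 0).mono_left (nhdsWithin_le_nhds (s := Ioi 0))
    rw [zero_mul, abs_zero] at this
    exact this.eventually_lt_const hm
  constructor
  · rintro ⟨h0, hperp, hin⟩
    obtain ⟨c, hc, rfl⟩ := exists_smul_rot (u := P.dir i) h0 sqLen_pos (by
      rw [inner_plane] at hperp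
      linear_combination (norm := (simp only [dir]; ring)) hperp)
    refine ⟨η * c, ?_, by rw [← mul_assoc, hη.mul_self, one_mul]⟩
    by_contra hneg
    have hneg : η * c < 0 := lt_of_le_of_ne (not_lt.1 hneg) (by
      rcases hη.1 with rfl | rfl <;> simpa using hc)
    obtain ⟨ε, hε, hεm, hε0⟩ := ((hin (P.frame i (1 / 2) 0)
      (mem_openSegment_iff.2 ⟨_, by norm_num, by norm_num, rfl⟩)).and
        ((hsmall c).and self_mem_nhdsWithin)).exists
    have hε0 : 0 < ε := hε0
    rw [smul_smul, frame_add_smul_rot, zero_add] at hε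
    exact hη.outside (by norm_num) (by norm_num) (by nlinarith) hεm (interior_subset hε)
  · rintro ⟨c, hc, rfl⟩
    have hη0 : η ≠ 0 := by rcases hη.1 with rfl | rfl <;> norm_num
    refine ⟨?_, ?_, ?_⟩
    · intro h
      have h1 := congrArg norm h
      rw [norm_smul, norm_rot, norm_zero, mul_eq_zero, norm_eq_zero, norm_eq_zero] at h1
      exact h1.elim (mul_ne_zero hη0 hc.ne') dir_ne_zero
    · rw [inner_plane]
      simp [← dir_coord]; ring
    · intro x hx
      obtain ⟨s, h0, h1, rfl⟩ := mem_openSegment_iff.1 hx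
      filter_upwards [hsmall (η * c), self_mem_nhdsWithin] with ε hε hε0
      have hε0 : 0 < ε := hε0
      rw [smul_smul, frame_add_smul_rot, zero_add]
      refine P.mem_interior_region (collar_notMem_trace h0 h1 (by positivity) hε)
        (hη.inside h0 h1 ?_ hε)
      have : η * (ε * (η * c)) = ε * c := by linear_combination (ε * c) * hη.mul_self
      rw [this]; positivity

/-- In local coordinates, the half-plane that supports an edge is given by a sign condition. -/
lemma mem_halfPlane_iff (hη : P.IsOrientation η) {p : Plane} :
    p ∈ P.halfPlane i ↔ 0 ≤ η * P.frameSnd i p := by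
  have hL := sqLen_pos (i := i)
  have key : ∀ c : ℝ, inner ℝ ((η * c) • rot (P.dir i)) (p - P.vertex i) =
      c * P.sqLen i * (η * P.frameSnd i p) := by
    intro c
    rw [inner_plane, frameSnd]
    simp
    field_simp
    ring
  constructor
  · rintro ⟨ν, hν, h⟩
    obtain ⟨c, hc, rfl⟩ := hη.isInnerNormal_iff.1 hν
    rw [key] at h
    exact nonneg_of_mul_nonneg_right h (by positivity)
  · intro h
    refine ⟨_, hη.isInnerNormal_iff.2 ⟨1, one_pos, rfl⟩, ?_⟩
    rw [key]
    positivity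

lemma isReflexVertex_iff (hη : P.IsOrientation η) :
    P.IsReflexVertex i ↔ η * P.startTurn i < 0 := by
  have hm := margin_pos (i := i)
  have ha := abs_pos.2 (startTurn_ne_zero (i := i))
  have key : ∀ s t : ℝ, P.vertex i + s • (P.vertex (P.prev i) - P.vertex i)
      + t • (P.vertex (P.next i) - P.vertex i) = P.frame i t (s * P.startTurn i) := by
    intro s t
    rw [vertex_prev]
    simp only [frame, dir, zero_smul, add_zero, add_sub_cancel_left, mul_smul]
    abel
  simp only [IsReflexVertex, key]
  constructor
  · rintro ⟨δ, hδ, h⟩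
    by_contra hneg
    have hpos : 0 < η * P.startTurn i := lt_of_le_of_ne (not_lt.1 hneg) (Ne.symm (by
      have := startTurn_ne_zero (i := i)
      rcases hη.1 with rfl | rfl <;> simpa using this))
    obtain ⟨s, hs0, hs⟩ : ∃ s : ℝ, 0 < s ∧ s < min δ (P.margin i / |P.startTurn i|) :=
      exists_between (by positivity)
    obtain ⟨t, ht0, ht⟩ : ∃ t : ℝ, 0 < t ∧ t < min δ 1 := exists_between (by positivity)
    refine h s t hs0 (hs.trans_le (min_le_left _ _)) ht0 (ht.trans_le (min_le_left _ _)) ?_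
    refine hη.inside ht0 (ht.trans_le (min_le_right _ _)) (by nlinarith) ?_
    rw [abs_mul, abs_of_pos hs0, ← lt_div_iff₀ ha]
    exact hs.trans_le (min_le_right _ _)
  · intro hneg
    refine ⟨min 1 (P.margin i / |P.startTurn i|), by positivity, fun s t hs0 hs ht0 ht => ?_⟩
    refine hη.outside ht0 (ht.trans_le (min_le_left _ _)) (by nlinarith) ?_
    rw [abs_mul, abs_of_pos hs0, ← lt_div_iff₀ ha]
    exact hs.trans_le (min_le_right _ _)

lemma isReflexVertex_next_iff (hη : P.IsOrientation η) :
    P.IsReflexVertex (P.next i) ↔ η * P.endTurn i < 0 := by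
  rw [hη.isReflexVertex_iff]
  have h := endTurn_mul_startTurn_next (i := i)
  have h0 := endTurn_ne_zero (i := i)
  have e : η * P.startTurn (P.next i) * (P.endTurn i) ^ 2 = η * P.endTurn i := by
    linear_combination (η * P.endTurn i) * h
  rw [← e]
  have : 0 < P.endTurn i ^ 2 := by positivity
  constructor
  · intro h; nlinarith
  · intro h; nlinarith

end IsOrientation

/-- Every boundary point is a limit of outer points. -/
lemma trace_subset_closure_compl : P.trace ⊆ closure P.regionᶜ := by
  intro z hz
  obtain ⟨η, hη⟩ := P.exists_isOrientation
  obtain ⟨i, hi⟩ := P.mem_trace.1 hz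
  obtain ⟨s, h0, h1, rfl⟩ := mem_edge_iff.1 hi
  have hm := margin_pos (i := i)
  have hc : Continuous fun θ : ℝ => P.frame i ((1 - θ) * s + θ * (1 / 2)) (-η * θ) := by
    unfold frame; fun_prop
  have ht := (hc.tendsto 0).mono_left (nhdsWithin_le_nhds (s := Ioi 0))
  simp only [sub_zero, one_mul, zero_mul, add_zero, mul_zero] at ht
  refine mem_closure_of_tendsto ht ?_
  filter_upwards [Ioo_mem_nhdsGT (show (0 : ℝ) < min 1 (P.margin i) by positivity)] with θ hθ
  have hθ1 : θ < 1 := hθ.2.trans_le (min_le_left _ _)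
  have hθm : θ < P.margin i := hθ.2.trans_le (min_le_right _ _)
  exact (hη.2 i _ θ (by nlinarith [hθ.1]) (by nlinarith [hθ.1]) hθ.1 hθm).2

variable (P) in
lemma frontier_region : frontier P.region = P.trace := by
  rw [P.isClosed_region.frontier_eq]
  ext z
  constructor
  · rintro ⟨h1, h2⟩
    by_contra h
    exact h2 (P.mem_interior_region h h1)
  · intro h
    refine ⟨P.trace_subset_region h, fun h' => ?_⟩
    have := trace_subset_closure_compl h
    rw [closure_compl] at this
    exact this h'

end RectilinearPolygon

/-- The axis-parallel rectangle with opposite corners `b` and `x`. -/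
def coordBox (b x : Plane) : Set Plane := {z | ∀ k, z k ∈ uIcc (b k) (x k)}

lemma convex_coordBox (b x : Plane) : Convex ℝ (coordBox b x) := by
  intro y hy z hz s t hs ht hst k
  have := (convex_uIcc (b k) (x k)) (hy k) (hz k) hs ht hst
  simpa using this

lemma left_mem_coordBox (b x : Plane) : b ∈ coordBox b x := fun _ => left_mem_uIcc
lemma right_mem_coordBox (b x : Plane) : x ∈ coordBox b x := fun _ => right_mem_uIcc

lemma coordBox_subset {b x y : Plane} (h : y ∈ coordBox b x) : coordBox b y ⊆ coordBox b x :=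
  fun _ hz k => uIcc_subset_uIcc left_mem_uIcc (h k) (hz k)

lemma dist_sq_plane (x y : Plane) : dist x y ^ 2 = (x 0 - y 0) ^ 2 + (x 1 - y 1) ^ 2 := by
  rw [EuclideanSpace.dist_eq, Real.sq_sqrt (by positivity)]
  simp [Fin.sum_univ_two, Real.dist_eq, sq_abs]

/-- The point `y` of a segment nearest to `b` sees no point of the segment at an acute angle
with `b`. -/
lemma inner_nonneg_of_nearest {u v y b z : Plane} (hy : y ∈ segment ℝ u v)
    (h : ∀ z ∈ segment ℝ u v, dist y b ≤ dist z b) (hz : z ∈ segment ℝ u v) :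
    0 ≤ (y 0 - b 0) * (z 0 - y 0) + (y 1 - b 1) * (z 1 - y 1) := by
  by_contra hneg
  set I := (y 0 - b 0) * (z 0 - y 0) + (y 1 - b 1) * (z 1 - y 1) with hI
  have hneg : I < 0 := not_le.1 hneg
  set L := (z 0 - y 0) ^ 2 + (z 1 - y 1) ^ 2 with hL
  have hL0 : 0 ≤ L := by positivity
  obtain ⟨θ, h0, hθ⟩ : ∃ θ : ℝ, 0 < θ ∧ θ < min 1 (-I / (L + 1)) :=
    exists_between (lt_min one_pos (div_pos (by linarith) (by linarith)))
  have h1 : θ < 1 := hθ.trans_le (min_le_left _ _)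
  have h2 : θ * (L + 1) < -I := by
    rw [← lt_div_iff₀ (by linarith)]; exact hθ.trans_le (min_le_right _ _)
  have hw := h ((1 - θ) • y + θ • z)
    ((convex_segment u v) hy hz (by linarith) h0.le (by ring))
  have hw2 := pow_le_pow_left₀ dist_nonneg hw 2
  rw [dist_sq_plane, dist_sq_plane] at hw2
  simp at hw2
  have e : ((1 - θ) * y 0 + θ * z 0 - b 0) ^ 2 + ((1 - θ) * y 1 + θ * z 1 - b 1) ^ 2 =
      (y 0 - b 0) ^ 2 + (y 1 - b 1) ^ 2 + θ * (2 * I + θ * L) := by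
    rw [hI, hL]; ring
  rw [e] at hw2
  nlinarith

namespace RectilinearPolygon

variable {P : RectilinearPolygon} {i : Fin P.n}

/-! ### Attraction paths are monotone -/

lemma edge_coord_eq {k : Fin 2} (h : P.dir i k = 0) {x : Plane} (hx : x ∈ P.edge i) :
    x k = P.vertex i k := by
  obtain ⟨s, -, -, rfl⟩ := mem_edge_iff.1 hx
  have : ∀ k, P.frame i s 0 k = P.vertex i k + s * P.dir i k := fun k => by simp [frame]
  rw [this, h]; ring

/-- Every move stays in the rectangle spanned by its start and the beacon. -/
lemma segment_subset_of_move {b x y : Plane} (h : P.StraightMove b x y ∨ P.SlideMove b x y) :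
    segment ℝ x y ⊆ P.region ∩ coordBox b x := by
  have key : y ∈ coordBox b x → segment ℝ x y ⊆ coordBox b x := fun hy =>
    (convex_coordBox b x).segment_subset (right_mem_coordBox b x) hy
  rcases h with ⟨hy, -, hP, -⟩ | ⟨-, j, hx, hy, -, hmin⟩
  · exact subset_inter hP (key ((convex_coordBox b x).segment_subset (right_mem_coordBox b x)
      (left_mem_coordBox b x) hy))
  · refine subset_inter (((convex_segment _ _).segment_subset hx hy).trans
      ((P.edge_subset_trace j).trans P.trace_subset_region)) (key ?_)
    have hin := inner_nonneg_of_nearest hy hmin hx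
    rcases dir_axis j with h | h
    · have e : y 1 = x 1 := by rw [edge_coord_eq h hy, edge_coord_eq h hx]
      rw [e, sub_self, mul_zero, add_zero] at hin
      intro k
      fin_cases k
      · simp only [Fin.zero_eta, mem_uIcc]
        rcases le_total (b 0) (y 0) with h' | h' <;> rcases le_total (y 0) (x 0) with h'' | h''
        · tauto
        · rcases h'.eq_or_lt with h3 | h3
          · right; constructor <;> linarith
          · left; constructor <;> nlinarith
        · rcases h'.eq_or_lt with h3 | h3
          · left; constructor <;> linarith
          · right; constructor <;> nlinarith
        · tauto
      · simp [e]
    · have e : y 0 = x 0 := by rw [edge_coord_eq h hy, edge_coord_eq h hx]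
      rw [e, sub_self, mul_zero, zero_add] at hin
      intro k
      fin_cases k
      · simp [e]
      · simp only [Fin.mk_one, mem_uIcc]
        rcases le_total (b 1) (y 1) with h' | h' <;> rcases le_total (y 1) (x 1) with h'' | h''
        · tauto
        · rcases h'.eq_or_lt with h3 | h3
          · right; constructor <;> linarith
          · left; constructor <;> nlinarith
        · rcases h'.eq_or_lt with h3 | h3
          · left; constructor <;> linarith
          · right; constructor <;> nlinarith
        · tauto

/-- The attraction path stays in the rectangle spanned by the object and the beacon. -/
lemma Attracts.polyJoined {b p : Plane} (h : P.Attracts b p) :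
    PolyJoined (P.region ∩ coordBox b p) p b := by
  induction h using Relation.ReflTransGen.head_induction_on with
  | refl => exact Relation.ReflTransGen.refl
  | @head x y hxy _ ih =>
    have hs := segment_subset_of_move hxy
    have hy := (hs (right_mem_segment ℝ x y)).2
    exact (PolyJoined.of_segment hs).trans
      (ih.mono (inter_subset_inter_right _ (coordBox_subset hy)))

/-! ### Beacons in the kernel respect all reflex edges -/

lemma frameSnd_combo {s t : ℝ} (h : s + t = 1) (x y : Plane) :
    P.frameSnd i (s • x + t • y) = s * P.frameSnd i x + t * P.frameSnd i y := by
  obtain rfl : s = 1 - t := by linarith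
  simp only [frameSnd, PiLp.add_apply, PiLp.smul_apply, smul_eq_mul]
  ring

lemma frameSnd_le_of_mem_coordBox {η c : ℝ} {b x z : Plane} (hb : η * P.frameSnd i b ≤ c)
    (hx : η * P.frameSnd i x ≤ c) (hz : z ∈ coordBox b x) : η * P.frameSnd i z ≤ c := by
  have key : ∀ k l : Fin 2, (∀ w w' : Plane, w k = w' k → P.frameSnd i w = P.frameSnd i w') →
      η * P.frameSnd i z ≤ c := by
    intro k l hk
    have := hz k
    rw [← segment_eq_uIcc] at this
    obtain ⟨s, t, hs, ht, hst, e⟩ := this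
    rw [hk z (s • b + t • x) (by simpa using e.symm), frameSnd_combo hst]
    obtain rfl : s = 1 - t := by linarith
    nlinarith
  rcases dir_axis i with h | h
  · exact key 1 0 fun w w' e => by simp only [frameSnd, h, e]; ring
  · exact key 0 1 fun w w' e => by simp only [frameSnd, h, e]; ring

lemma segment_frame (s t t' : ℝ) {z : Plane} (hz : z ∈ segment ℝ (P.frame i s t) (P.frame i s t')) :
    ∃ θ, 0 ≤ θ ∧ θ ≤ 1 ∧ z = P.frame i s ((1 - θ) * t + θ * t') := by
  rw [segment_eq_image] at hz
  obtain ⟨θ, ⟨h0, h1⟩, rfl⟩ := hz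
  refine ⟨θ, h0, h1, ?_⟩
  simp only [frame_segment]
  congr 1; ring

lemma exists_frame_mem_farRegion (η M : ℝ) : ∃ s, P.frame i s η ∈ farRegion M := by
  rcases dir_axis i with h | h
  · have h0 : P.dir i 0 ≠ 0 := fun h0 => dir_ne_zero (plane_ext h0 h)
    refine ⟨(M + 1 - P.vertex i 0) / P.dir i 0, Or.inl ?_⟩
    rw [frame_zero_coord, h, div_mul_cancel₀ _ h0]
    exact lt_of_lt_of_le (by linarith) (le_abs_self _)
  · have h0 : P.dir i 1 ≠ 0 := fun h0 => dir_ne_zero (plane_ext h h0)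
    refine ⟨(M + 1 - P.vertex i 1) / P.dir i 1, Or.inr ?_⟩
    rw [frame_one_coord, h, div_mul_cancel₀ _ h0]
    exact lt_of_lt_of_le (by linarith) (le_abs_self _)

/-- If a beacon `b` lies on the outer side of a reflex edge, the polygon continues on both ends of
the edge to its outer side, and a beacon attracting points there from both ends would close up a
curve in the polygon around exterior points. -/
lemma mem_halfPlane_of_mem_kernel {b : Plane} (hb : b ∈ P.kernel) (hi : P.IsReflexEdge i) :
    b ∈ P.halfPlane i := by
  obtain ⟨η, hη⟩ := P.exists_isOrientation
  rw [hη.mem_halfPlane_iff]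
  by_contra hneg
  have hneg : η * P.frameSnd i b < 0 := not_le.1 hneg
  have ha := hη.isReflexVertex_iff.1 hi.1
  have hc := hη.isReflexVertex_next_iff.1 hi.2
  have hηη := hη.mul_self
  obtain ⟨ε, hε0, hε⟩ : ∃ ε, 0 < ε ∧ ε < min (-(η * P.frameSnd i b))
      (min (-(η * P.startTurn i)) (-(η * P.endTurn i))) := exists_between (by
    refine lt_min ?_ (lt_min ?_ ?_) <;> linarith)
  have hεb : ε < -(η * P.frameSnd i b) := hε.trans_le (min_le_left _ _)
  have hεa : ε < -(η * P.startTurn i) :=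
    hε.trans_le ((min_le_right _ _).trans (min_le_left _ _))
  have hεc : ε < -(η * P.endTurn i) :=
    hε.trans_le ((min_le_right _ _).trans (min_le_right _ _))
  -- points on the two adjacent edges at distance `ε` from the edge
  have frac : ∀ c, η * c < 0 → ε < -(η * c) → ∃ x, 0 ≤ x ∧ x ≤ 1 ∧ -η * ε = c * x := by
    intro c hc1 hc2
    refine ⟨ε / -(η * c), by apply div_nonneg <;> linarith, by rw [div_le_one] <;> linarith, ?_⟩
    have : c ≠ 0 := by rintro rfl; simp at hc1
    have hη0 : η ≠ 0 := by rintro rfl; simp at hc1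
    field_simp
    linear_combination -hηη
  have hz₁e : P.frame i 0 (-η * ε) ∈ P.edge (P.prev i) := by
    obtain ⟨x, h0, h1, e⟩ := frac _ ha hεa
    exact mem_edge_prev_iff.2 ⟨x, h0, h1, by rw [e]⟩
  have hz₂e : P.frame i 1 (-η * ε) ∈ P.edge (P.next i) := by
    obtain ⟨x, h0, h1, e⟩ := frac _ hc hεc
    exact mem_edge_next_iff.2 ⟨x, h0, h1, by rw [e]⟩
  set S : Set Plane := (P.region ∩ {z | η * P.frameSnd i z ≤ -ε}) ∪
    (segment ℝ (P.frame i 0 0) (P.frame i 0 (-η * ε)) ∪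
      segment ℝ (P.frame i 1 0) (P.frame i 1 (-η * ε))) with hSdef
  have htr : ∀ j, P.edge j ⊆ P.region := fun j =>
    (P.edge_subset_trace j).trans P.trace_subset_region
  have hSP : S ⊆ P.region := by
    refine union_subset inter_subset_left (union_subset ?_ ?_)
    · rw [frame_zero_zero]
      refine ((convex_segment _ _).segment_subset ?_ hz₁e).trans (htr (P.prev i))
      have := P.vertex_next_mem_edge (P.prev i)
      rwa [next_prev] at this
    · rw [frame_one_zero]
      exact ((convex_segment _ _).segment_subset (P.vertex_mem_edge _) hz₂e).trans (htr (P.next i))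
  have hpath : ∀ s, P.frame i s (-η * ε) ∈ P.region →
      PolyJoined S (P.frame i s (-η * ε)) b := by
    intro s hs
    refine (hb.2 _ hs).polyJoined.mono (Subset.trans ?_ subset_union_left)
    refine inter_subset_inter_right _ fun z hz => ?_
    refine frameSnd_le_of_mem_coordBox (by linarith) ?_ hz
    rw [frameSnd_frame]; nlinarith
  have hjoin : PolyJoined S (P.vertex (P.next i)) (P.vertex i) := by
    rw [← frame_one_zero, ← frame_zero_zero]
    refine (((PolyJoined.of_segment ?_).trans (hpath 1 (htr _ hz₂e))).trans
      (hpath 0 (htr _ hz₁e)).symm).trans (PolyJoined.of_segment ?_)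
    · exact subset_union_right.trans' subset_union_right
    · rw [segment_symm]; exact subset_union_right.trans' subset_union_left
  have hSle : ∀ z ∈ S, η * P.frameSnd i z ≤ 0 := by
    rintro z (⟨-, hz⟩ | hz | hz)
    · have hz : η * P.frameSnd i z ≤ -ε := hz
      linarith
    all_goals
      obtain ⟨θ, h0, h1, rfl⟩ := segment_frame _ _ _ hz
      rw [frameSnd_frame]
      have : η * ((1 - θ) * 0 + θ * (-η * ε)) = -(θ * ε) := by linear_combination -(θ * ε) * hηη
      rw [this]
      have := mul_nonneg h0 hε0.le
      linarith
  have hmS : P.frame i (1 / 2) 0 ∉ S := by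
    rintro (⟨-, hz⟩ | hz | hz)
    · have hz : η * P.frameSnd i (P.frame i (1 / 2) 0) ≤ -ε := hz
      rw [frameSnd_frame] at hz; linarith
    · obtain ⟨θ, h0, h1, e⟩ := segment_frame _ _ _ hz
      linarith [(frame_inj e).1]
    · obtain ⟨θ, h0, h1, e⟩ := segment_frame _ _ _ hz
      linarith [(frame_inj e).1]
  obtain ⟨ε', hε'0, hε'm, hsep⟩ := edge_separation hmS hjoin
  -- the outer side of the edge is connected with its inner side via infinity
  set q := P.frame i (1 / 2) (-η * ε') with hq
  have hqP : q ∉ P.region := (hη.2 i _ ε' (by norm_num) (by norm_num) hε'0 hε'm).2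
  have hqt : q ∉ P.trace := fun h => hqP (P.trace_subset_region h)
  obtain ⟨M, hM, hMd⟩ := P.exists_farRegion_disjoint
  have hfar := farRegion_subset_component hM (hMd.mono_right P.trace_subset_region)
    (mt (P.mem_region_iff hqt).2 hqP)
  have hCd := P.component_disjoint_region hqP
  set C := connectedComponentIn P.traceᶜ q with hC
  have hconv : Convex ℝ {z | 0 < η * P.frameSnd i z} := by
    intro x hx y hy s t hs ht hst
    have hx : 0 < η * P.frameSnd i x := hx
    have hy : 0 < η * P.frameSnd i y := hy
    show 0 < η * P.frameSnd i (s • x + t • y)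
    rw [frameSnd_combo hst]
    rcases hs.eq_or_lt with rfl | hs
    · obtain rfl : t = 1 := by linarith
      simpa using hy
    · nlinarith [mul_pos hs hx, mul_nonneg ht hy.le]
  obtain ⟨s, hs⟩ := exists_frame_mem_farRegion (i := i) η M
  have hD : IsPreconnected (C ∪ {z | 0 < η * P.frameSnd i z}) := by
    refine IsPreconnected.union _ (hfar hs) ?_ isPreconnected_connectedComponentIn
      hconv.isPreconnected
    show 0 < η * P.frameSnd i (P.frame i s η)
    rw [frameSnd_frame, hηη]; exact one_pos
  have hDS : Disjoint (C ∪ {z | 0 < η * P.frameSnd i z}) S :=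
    disjoint_union_left.2 ⟨hCd.mono_right hSP, disjoint_left.2 fun z hz hzS =>
      absurd (hSle z hzS) (not_le.2 hz)⟩
  have hDe : Disjoint (C ∪ {z | 0 < η * P.frameSnd i z}) (P.edge i) := by
    refine disjoint_union_left.2 ⟨hCd.mono_right (htr i), disjoint_left.2 fun z hz hze => ?_⟩
    obtain ⟨s, -, -, rfl⟩ := mem_edge_iff.1 hze
    have hz : 0 < η * P.frameSnd i (P.frame i s 0) := hz
    rw [frameSnd_frame, mul_zero] at hz
    exact lt_irrefl _ hz
  have h1 : q ∈ C ∪ {z | 0 < η * P.frameSnd i z} := Or.inl (mem_connectedComponentIn hqt)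
  have h2 : P.frame i (1 / 2) (η * ε') ∈ C ∪ {z | 0 < η * P.frameSnd i z} := by
    right
    show 0 < η * P.frameSnd i (P.frame i (1 / 2) (η * ε'))
    rw [frameSnd_frame, ← mul_assoc, hηη, one_mul]; exact hε'0
  have := hsep _ hD hDS hDe
  rcases hη.1 with rfl | rfl
  · exact this (by simpa using h2) (by simpa [hq] using h1)
  · exact this (by simpa [hq] using h1) (by simpa using h2)

end RectilinearPolygon

namespace RectilinearPolygon

variable {P : RectilinearPolygon} {i : Fin P.n}

/-! ### Pockets -/

/-- The linear functional with gradient `w`. -/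
def height (w z : Plane) : ℝ := w 0 * z 0 + w 1 * z 1

lemma continuous_height (w : Plane) : Continuous (height w) := by
  unfold height; fun_prop

lemma height_frame (w : Plane) (s t : ℝ) : height w (P.frame i s t) =
    height w (P.vertex i) + s * height w (P.dir i) + t * height w (rot (P.dir i)) := by
  simp [height]; ring

lemma frameRect_mono {η s₁ s₂ t₁ t₂ s₁' s₂' t₁' t₂' : ℝ} (h1 : s₁' ≤ s₁) (h2 : s₂ ≤ s₂')
    (h3 : t₁' ≤ t₁) (h4 : t₂ ≤ t₂') :
    P.frameRect i η s₁ s₂ t₁ t₂ ⊆ P.frameRect i η s₁' s₂' t₁' t₂' :=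
  image_mono (prod_mono (Ioo_subset_Ioo h1 h2) (Ioo_subset_Ioo h3 h4))

lemma exists_frame_subset {U : Set Plane} {s t : ℝ} (hU : U ∈ 𝓝 (P.frame i s t)) :
    ∃ r > 0, ∀ s' t', |s' - s| < r → |t' - t| < r → P.frame i s' t' ∈ U := by
  have h := (continuous_frame (P := P) (i := i)).tendsto (s, t) hU
  obtain ⟨r, hr, hr'⟩ := Metric.mem_nhds_iff.1 (mem_map.1 h)
  refine ⟨r, hr, fun s' t' hs ht => ?_⟩
  have : ((s', t') : ℝ × ℝ) ∈ Metric.ball (s, t) r := by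
    rw [Metric.mem_ball, Prod.dist_eq, max_lt_iff]
    exact ⟨hs, ht⟩
  exact hr' this

/-- A bounded component of the exterior, cut off by a set `S` below the level `c`, that reaches
above the level `c` has a reflex edge at its top: the edge faces upwards, and both of its ends turn
down. -/
lemma exists_reflexEdge_of_pocket {w : Plane} (hw : w 0 = 0 ∨ w 1 = 0) (hw0 : w ≠ 0)
    {S : Set Plane} (hS : IsClosed S) {c : ℝ} (hSc : ∀ z ∈ S, height w z ≤ c) {x : Plane}
    (hxP : x ∉ P.region) (hxS : x ∉ S) (hxc : c < height w x)
    (hb : Bornology.IsBounded (connectedComponentIn (P.trace ∪ S)ᶜ x)) :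
    ∃ j, P.IsReflexEdge j ∧ ∀ p ∈ P.halfPlane j, c < height w p := by
  have hxT : x ∈ (P.trace ∪ S)ᶜ := fun h => h.elim (fun h => hxP (P.trace_subset_region h)) hxS
  have hTo : IsOpen (P.trace ∪ S)ᶜ := (P.isCompact_trace.isClosed.union hS).isOpen_compl
  set C := connectedComponentIn (P.trace ∪ S)ᶜ x with hC
  have hCo : IsOpen C := hTo.connectedComponentIn
  have hCT : C ⊆ (P.trace ∪ S)ᶜ := connectedComponentIn_subset _ _
  have hxC : x ∈ C := mem_connectedComponentIn hxT
  have hsub : ∀ D : Set Plane, IsPreconnected D → Disjoint D P.trace →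
      (∀ z ∈ D, z ∉ S) → ∀ z ∈ D, z ∈ C → D ⊆ C := by
    intro D hD hDt hDS z hz hzC
    rw [hC, connectedComponentIn_eq hzC]
    exact hD.subset_connectedComponentIn hz fun y hy h =>
      h.elim (disjoint_left.1 hDt hy) (hDS y hy)
  have hCP : ∀ z ∈ C, z ∉ P.region := fun z hz hzP => hxP
    (P.mem_region_of_preconnected isPreconnected_connectedComponentIn
      (disjoint_left.2 fun y hy h => hCT hy (Or.inl h)) hz hxC hzP)
  -- the highest point of the closure
  obtain ⟨t, htC, htmax⟩ := (Metric.isCompact_of_isClosed_isBounded isClosed_closure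
    hb.closure).exists_isMaxOn ⟨x, subset_closure hxC⟩ (continuous_height w).continuousOn
  have htmax : ∀ z ∈ C, height w z ≤ height w t := fun z hz => htmax (subset_closure hz)
  have hww : 0 < height w w := by
    have : height w w = w 0 ^ 2 + w 1 ^ 2 := by simp [height]; ring
    rw [this]
    by_contra h
    exact hw0 (plane_ext (by simp; nlinarith [sq_nonneg (w 0), sq_nonneg (w 1)])
      (by simp; nlinarith [sq_nonneg (w 0), sq_nonneg (w 1)]))
  have hlt : ∀ z ∈ C, height w z < height w t := by
    intro z hz
    have hc : Continuous fun ε : ℝ => z + ε • w := by fun_prop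
    have ht := (hc.tendsto 0).mono_left (nhdsWithin_le_nhds (s := Ioi 0))
    rw [zero_smul, add_zero] at ht
    obtain ⟨ε, hε, hε0⟩ := ((ht.eventually (hCo.mem_nhds hz)).and self_mem_nhdsWithin).exists
    have hε0 : 0 < ε := hε0
    have h1 := htmax _ hε
    have h2 : height w (z + ε • w) = height w z + ε * height w w := by simp [height]; ring
    nlinarith
  have hct : c < height w t := hxc.trans_le (htmax x hxC)
  have htS : t ∉ S := fun h => absurd (hSc t h) (not_le.2 hct)
  have htt : t ∈ P.trace := by
    by_contra htt
    have htT : t ∈ (P.trace ∪ S)ᶜ := fun h => h.elim htt htS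
    have ho : IsOpen (connectedComponentIn (P.trace ∪ S)ᶜ t) := hTo.connectedComponentIn
    obtain ⟨z, hz1, hz2⟩ := mem_closure_iff.1 htC _ ho (mem_connectedComponentIn htT)
    have e : C = connectedComponentIn (P.trace ∪ S)ᶜ t :=
      (connectedComponentIn_eq hz2).trans (connectedComponentIn_eq hz1).symm
    exact lt_irrefl _ (hlt t (e ▸ mem_connectedComponentIn htT))
  have hcases : ∀ j, height w (P.dir j) = 0 ∨ height w (rot (P.dir j)) = 0 := by
    intro j
    rcases dir_axis j with h | h <;> rcases hw with h' | h' <;> simp [height, h, h']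
  have hnext : ∀ j, height w (P.dir (P.next j)) = P.endTurn j * height w (rot (P.dir j)) := by
    intro j; rw [dir_next]; simp [height]; ring
  -- the highest point is on an edge that is perpendicular to `w`
  obtain ⟨j, htj, hj⟩ : ∃ j, t ∈ P.edge j ∧ height w (P.dir j) = 0 := by
    obtain ⟨i, hi⟩ := P.mem_trace.1 htt
    by_cases h0 : height w (P.dir i) = 0
    · exact ⟨i, hi, h0⟩
    have hr0 : height w (rot (P.dir i)) = 0 := (hcases i).resolve_left h0
    obtain ⟨s, hs0, hs1, rfl⟩ := mem_edge_iff.1 hi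
    rcases hs0.eq_or_lt with rfl | hs0
    · refine ⟨P.prev i, ?_, ?_⟩
      · rw [frame_zero_zero]
        have := P.vertex_next_mem_edge (P.prev i)
        rwa [next_prev] at this
      · have := hnext (P.prev i)
        rw [next_prev] at this
        exact (hcases _).resolve_right fun h => h0 (by rw [this, h, mul_zero])
    rcases hs1.eq_or_lt with rfl | hs1
    · exact ⟨P.next i, by rw [frame_one_zero]; exact P.vertex_mem_edge _,
        by rw [hnext, hr0, mul_zero]⟩
    -- in the interior of a vertical edge, the component would reach above `t`
    exfalso
    obtain ⟨r, hr, hrS⟩ := exists_frame_subset (hS.isOpen_compl.mem_nhds htS)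
    have hm := margin_pos (i := i)
    obtain ⟨ρ, hρ0, hρ⟩ : ∃ ρ, 0 < ρ ∧ ρ < min (min r (P.margin i)) (min s (1 - s)) :=
      exists_between (lt_min (lt_min hr hm) (lt_min hs0 (by linarith)))
    have hρr : ρ < r := hρ.trans_le ((min_le_left _ _).trans (min_le_left _ _))
    have hρm : ρ < P.margin i := hρ.trans_le ((min_le_left _ _).trans (min_le_right _ _))
    have hρs : ρ < s := hρ.trans_le ((min_le_right _ _).trans (min_le_left _ _))
    have hρs' : ρ < 1 - s := hρ.trans_le ((min_le_right _ _).trans (min_le_right _ _))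
    obtain ⟨z, ⟨s', t', rfl, hs', ht'⟩, hzC⟩ := mem_closure_iff_nhds.1 htC _
      (eventually_frame (i := i) s 0 hρ0)
    rw [sub_zero] at ht'
    rw [abs_lt] at hs'
    have ht0 : t' ≠ 0 := by
      rintro rfl
      exact hCT hzC (Or.inl (P.edge_subset_trace i (frame_mem_edge (by linarith) (by linarith))))
    obtain ⟨ζ, hζ, hζt⟩ : ∃ ζ : ℝ, (ζ = 1 ∨ ζ = -1) ∧ t' = ζ * |t'| := by
      rcases lt_or_gt_of_ne ht0 with h | h
      · exact ⟨-1, Or.inr rfl, by rw [abs_of_neg h]; ring⟩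
      · exact ⟨1, Or.inl rfl, by rw [abs_of_pos h]; ring⟩
    have hDC : P.frameRect i ζ (s - ρ) (s + ρ) 0 ρ ⊆ C := by
      refine hsub _ (isPreconnected_frameRect _ _ _ _ _) ((collar_disjoint_trace hζ).mono_left
        (frameRect_mono (by linarith) (by linarith) le_rfl hρm.le)) ?_ (P.frame i s' t') ?_ hzC
      · rintro _ ⟨⟨s'', t''⟩, ⟨⟨h1, h2⟩, h3, h4⟩, rfl⟩
        simp only at h1 h2 h3 h4
        refine hrS _ _ (by rw [abs_lt]; constructor <;> linarith) ?_
        rw [sub_zero, abs_lt]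
        rcases hζ with rfl | rfl <;> constructor <;> linarith
      · rw [hζt]
        exact mem_frameRect (by linarith [hs'.1]) (by linarith [hs'.2]) (abs_pos.2 ht0) ht'
    have hup : ∀ e : ℝ, |e| < ρ → e * height w (P.dir i) < 0 := by
      intro e he
      rw [abs_lt] at he
      have := hlt _ (hDC (mem_frameRect (s := s + e) (t := ρ / 2) (by linarith [he.1])
        (by linarith [he.2]) (by linarith) (by linarith)))
      rw [height_frame, height_frame, hr0] at this
      linarith
    have h1 := hup 0 (by simpa using hρ0)
    linarith
  -- local coordinates along this edge
  obtain ⟨s₀, hs0, hs1, rfl⟩ := mem_edge_iff.1 htj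
  have hk0 : height w (rot (P.dir j)) ≠ 0 := by
    intro hk
    have hd := sqLen_pos (i := j)
    have e : height w w * P.sqLen j = height w (P.dir j) ^ 2 + height w (rot (P.dir j)) ^ 2 := by
      simp [height, sqLen]; ring
    rw [hj, hk] at e
    have := mul_pos hww hd
    norm_num at e
    rcases e with e | e <;> linarith
  set k := height w (rot (P.dir j)) with hk
  set Λ := height w (P.vertex j) with hΛ
  have hℓ : ∀ s t, height w (P.frame j s t) = Λ + t * k := by
    intro s t; rw [height_frame, hj]; ring
  rw [hℓ, zero_mul, add_zero] at hct
  obtain ⟨ζ, hζ, hζk⟩ : ∃ ζ : ℝ, (ζ = 1 ∨ ζ = -1) ∧ ζ * k < 0 := by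
    rcases lt_or_gt_of_ne hk0 with h | h
    · exact ⟨1, Or.inl rfl, by linarith⟩
    · exact ⟨-1, Or.inr rfl, by linarith⟩
  have hζζ : ζ * ζ = 1 := by rcases hζ with rfl | rfl <;> norm_num
  have hm := margin_pos (i := j)
  have hka := abs_pos.2 hk0
  obtain ⟨δ, hδ0, hδ⟩ : ∃ δ, 0 < δ ∧ δ < min (P.margin j) ((Λ - c) / |k|) :=
    exists_between (lt_min hm (div_pos (by linarith) hka))
  have hδm : δ < P.margin j := hδ.trans_le (min_le_left _ _)
  have hδk : δ * |k| < Λ - c := by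
    rw [← lt_div_iff₀ hka]; exact hδ.trans_le (min_le_right _ _)
  have habove : ∀ (s₁ s₂ t₁ t₂ : ℝ), -δ ≤ t₁ → t₂ ≤ δ →
      ∀ z ∈ P.frameRect j ζ s₁ s₂ t₁ t₂, z ∉ S := by
    rintro s₁ s₂ t₁ t₂ ht₁ ht₂ _ ⟨⟨s, t⟩, ⟨-, h3, h4⟩, rfl⟩ hzS
    simp only at h3 h4 hzS
    have h5 := hSc _ hzS
    rw [hℓ] at h5
    have h6 : |ζ * t * k| < δ * |k| := by
      rw [abs_mul, abs_mul, show |ζ| = 1 by rcases hζ with rfl | rfl <;> norm_num, one_mul]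
      exact mul_lt_mul_of_pos_right (abs_lt.2 ⟨by linarith, by linarith⟩) hka
    linarith [neg_abs_le (ζ * t * k)]
  -- the component does not extend beyond the ends of the edge
  have hbefore : ∀ s τ, -δ < s → s < 0 → |τ| < δ → P.frame j s τ ∉ C := by
    intro s τ h1 h2 h3 hz
    rw [abs_lt] at h3
    have hτ : τ = ζ * (ζ * τ) := by linear_combination -τ * hζζ
    have hzr : P.frame j s τ ∈ P.frameRect j ζ (-δ) 0 (-δ) δ := by
      rw [hτ]
      exact mem_frameRect h1 h2 (by rcases hζ with rfl | rfl <;> linarith)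
        (by rcases hζ with rfl | rfl <;> linarith)
    have hDC := hsub _ (isPreconnected_frameRect _ _ _ _ _)
      ((before_disjoint_trace hζ).mono_left (frameRect_mono (by linarith) le_rfl (by linarith)
        hδm.le)) (habove _ _ _ _ le_rfl le_rfl) _ hzr hz
    have := hlt _ (hDC (mem_frameRect (s := -(δ / 2)) (t := 0) (by linarith) (by linarith)
      (by linarith) (by linarith)))
    rw [hℓ, hℓ] at this
    simp at this
  have hafter : ∀ s τ, 1 < s → s < 1 + δ → |τ| < δ → P.frame j s τ ∉ C := by
    intro s τ h1 h2 h3 hz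
    rw [abs_lt] at h3
    have hτ : τ = ζ * (ζ * τ) := by linear_combination -τ * hζζ
    have hzr : P.frame j s τ ∈ P.frameRect j ζ 1 (1 + δ) (-δ) δ := by
      rw [hτ]
      exact mem_frameRect h1 h2 (by rcases hζ with rfl | rfl <;> linarith)
        (by rcases hζ with rfl | rfl <;> linarith)
    have hDC := hsub _ (isPreconnected_frameRect _ _ _ _ _)
      ((after_disjoint_trace hζ).mono_left (frameRect_mono le_rfl (by linarith) (by linarith)
        hδm.le)) (habove _ _ _ _ le_rfl le_rfl) _ hzr hz
    have := hlt _ (hDC (mem_frameRect (s := 1 + δ / 2) (t := 0) (by linarith) (by linarith)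
      (by linarith) (by linarith)))
    rw [hℓ, hℓ] at this
    simp at this
  -- hence it contains the lower side of the edge
  have hQ : P.frameRect j ζ 0 1 0 δ ⊆ C := by
    obtain ⟨z, ⟨s, τ, rfl, hs', hτ'⟩, hzC⟩ := mem_closure_iff_nhds.1 htC _
      (eventually_frame (i := j) s₀ 0 hδ0)
    rw [sub_zero] at hτ'
    have hτk := hlt _ hzC
    rw [hℓ, hℓ, zero_mul, add_zero] at hτk
    obtain ⟨r, hr, hrC⟩ := exists_frame_subset (hCo.mem_nhds hzC)
    rw [abs_lt] at hs'
    obtain ⟨ρ, hρ0, hρ⟩ : ∃ ρ, 0 < ρ ∧ ρ < min r δ := exists_between (lt_min hr hδ0)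
    have hρr := hρ.trans_le (min_le_left _ _)
    have hρδ := hρ.trans_le (min_le_right _ _)
    have h0 : 0 < s := by
      by_contra h
      rcases (not_lt.1 h).eq_or_lt with rfl | h
      · exact hbefore (0 - ρ) τ (by linarith) (by linarith) hτ'
          (hrC _ _ (by rw [zero_sub, sub_zero, abs_neg, abs_of_pos hρ0]; exact hρr)
            (by simpa using hr))
      · exact hbefore s τ (by linarith [hs'.1]) h hτ' hzC
    have h1 : s < 1 := by
      by_contra h
      rcases (not_lt.1 h).eq_or_lt with rfl | h
      · exact hafter (1 + ρ) τ (by linarith) (by linarith) hτ'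
          (hrC _ _ (by rw [add_sub_cancel_left, abs_of_pos hρ0]; exact hρr) (by simpa using hr))
      · exact hafter s τ h (by linarith [hs'.2]) hτ' hzC
    have hτ : τ = ζ * (ζ * τ) := by linear_combination -τ * hζζ
    rw [abs_lt] at hτ'
    refine hsub _ (isPreconnected_frameRect _ _ _ _ _) ((collar_disjoint_trace hζ).mono_left
      (frameRect_mono le_rfl le_rfl le_rfl hδm.le)) (habove _ _ _ _ (by linarith) le_rfl)
      (P.frame j s τ) ?_ hzC
    rw [hτ]
    refine mem_frameRect h0 h1 ?_ (by rcases hζ with rfl | rfl <;> linarith)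
    rcases hζ with rfl | rfl <;> nlinarith
  have hQmem : P.frame j (1 / 2) (ζ * (δ / 2)) ∈ P.frameRect j ζ 0 1 0 δ :=
    mem_frameRect (by norm_num) (by norm_num) (by linarith) (by linarith)
  -- the neighbouring edges turn down: otherwise the lower side would extend beyond an end
  have hend : 0 < ζ * P.endTurn j := by
    by_contra h
    have h : P.endTurn j * ζ < 0 := lt_of_le_of_ne (by linarith) (by
      have := endTurn_ne_zero (i := j)
      rcases hζ with rfl | rfl <;> simpa using this)
    have hDC := hsub _ (isPreconnected_frameRect _ _ _ _ _)
      ((collar_after_disjoint_trace hζ h).mono_left (frameRect_mono le_rfl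
        (show 1 + δ ≤ _ by linarith) le_rfl hδm.le)) (habove _ _ _ _ (by linarith) le_rfl) _
      (frameRect_mono le_rfl (by linarith) le_rfl le_rfl hQmem) (hQ hQmem)
    refine hafter (1 + δ / 2) (ζ * (δ / 2)) (by linarith) (by linarith) ?_
      (hDC (mem_frameRect (by linarith) (by linarith) (by linarith) (by linarith)))
    rw [abs_lt]; rcases hζ with rfl | rfl <;> constructor <;> linarith
  have hstart : 0 < ζ * P.startTurn j := by
    by_contra h
    have h : P.startTurn j * ζ < 0 := lt_of_le_of_ne (by linarith) (by
      have := startTurn_ne_zero (i := j)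
      rcases hζ with rfl | rfl <;> simpa using this)
    have hDC := hsub _ (isPreconnected_frameRect _ _ _ _ _)
      ((collar_before_disjoint_trace hζ h).mono_left (frameRect_mono (show _ ≤ -δ by linarith)
        le_rfl le_rfl hδm.le)) (habove _ _ _ _ (by linarith) le_rfl) _
      (frameRect_mono (by linarith) le_rfl le_rfl le_rfl hQmem) (hQ hQmem)
    refine hbefore (-(δ / 2)) (ζ * (δ / 2)) (by linarith) (by linarith) ?_
      (hDC (mem_frameRect (by linarith) (by linarith) (by linarith) (by linarith)))
    rw [abs_lt]; rcases hζ with rfl | rfl <;> constructor <;> linarith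
  obtain ⟨η, hη⟩ := P.exists_isOrientation
  have hηζ : η = -ζ := by
    have hne : η ≠ ζ := by
      rintro rfl
      exact hCP _ (hQ hQmem) (hη.2 j _ _ (by norm_num) (by norm_num) (by linarith)
        (by linarith)).1
    rcases hη.1 with rfl | rfl <;> rcases hζ with rfl | rfl <;> simp at hne ⊢
  refine ⟨j, ⟨hη.isReflexVertex_iff.2 (by rw [hηζ]; linarith),
    hη.isReflexVertex_next_iff.2 (by rw [hηζ]; linarith)⟩, fun p hp => ?_⟩
  rw [hη.mem_halfPlane_iff, hηζ] at hp
  rw [← frame_frameFst_frameSnd (P := P) (i := j) p, hℓ]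
  have : 0 ≤ P.frameSnd j p * k := by
    have h := mul_nonneg hp (by linarith : 0 ≤ -(ζ * k))
    have e : -ζ * P.frameSnd j p * -(ζ * k) = P.frameSnd j p * k := by
      linear_combination (P.frameSnd j p * k) * hζζ
    rwa [e] at h
  linarith

end RectilinearPolygon

namespace RectilinearPolygon

variable {P : RectilinearPolygon} {i : Fin P.n}

/-! ### Objects do not get stuck if the beacon respects all reflex edges -/

lemma segment_disjoint_farRegion {M : ℝ} (hM : Disjoint (farRegion M) P.region) {x y : Plane}
    (hx : x ∈ P.region) (hy : y ∈ P.region) : Disjoint (farRegion M) (segment ℝ x y) := by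
  have hb : ∀ z ∈ P.region, ∀ k, |z k| ≤ M := fun z hz k => by
    have h := disjoint_right.1 hM hz
    simp only [farRegion, mem_ofPred_eq, not_or, not_lt] at h
    fin_cases k
    exacts [h.1, h.2]
  refine disjoint_right.2 fun z hz => ?_
  have h : ∀ k, |z k| ≤ M := fun k => abs_le.2
    ⟨le_segment_coord (abs_le.1 (hb x hx k)).1 (abs_le.1 (hb y hy k)).1 hz,
      segment_coord_le (abs_le.1 (hb x hx k)).2 (abs_le.1 (hb y hy k)).2 hz⟩
  simp only [farRegion, mem_ofPred_eq, not_or, not_lt]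
  exact ⟨h 0, h 1⟩

/-- A boundary point `x` from which the ray towards `p` leaves the polygon lies between `p` and a
pocket of the exterior: the ray meets the boundary again, and one of the two parts into which it
then cuts the exterior is bounded. If both parts reach, next to `x`, beyond the ray in some axis
direction, then the top of the bounded part is a reflex edge that has `p` on its outer side. -/
lemma notMem_reflexRectangle_of_leaving {x p : Plane} (hx : x ∈ P.trace) (hp : p ∈ P.region)
    (hout : ∀ᶠ τ : ℝ in 𝓝[>] 0, x + τ • (p - x) ∉ P.region)
    (h : ∀ ζ : ℝ, ζ = 1 ∨ ζ = -1 → ∃ w : Plane, (w 0 = 0 ∨ w 1 = 0) ∧ w ≠ 0 ∧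
      height w p ≤ height w x ∧ ∀ᶠ τ : ℝ in 𝓝[>] 0, ∀ᶠ ε : ℝ in 𝓝[>] 0, ∃ D : Set Plane,
        IsPreconnected D ∧ Disjoint D P.trace ∧ Disjoint D (segment ℝ x p) ∧
        x + τ • (p - x) + (ζ * ε) • rot (p - x) ∈ D ∧ ∃ c ∈ D, height w x < height w c) :
    p ∉ P.reflexRectangle := by
  intro hpR
  obtain ⟨w₁, hw₁, hw₁0, hpw₁, h₁⟩ := h 1 (Or.inl rfl)
  obtain ⟨w₂, hw₂, hw₂0, hpw₂, h₂⟩ := h (-1) (Or.inr rfl)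
  obtain ⟨τ, hτP, h₁, h₂, hτ0, hτ1⟩ := (hout.and (h₁.and (h₂.and (Ioo_mem_nhdsGT one_pos)))).exists
  set m := x + τ • (p - x) with hm
  -- the ray meets the boundary again
  obtain ⟨r, hrseg, hr⟩ : ∃ r ∈ segment ℝ m p, r ∈ P.trace := by
    rw [← P.frontier_region]
    by_contra hcon
    push Not at hcon
    have hpre := (convex_segment (𝕜 := ℝ) m p).isPreconnected
    rw [isPreconnected_iff_subset_of_disjoint] at hpre
    have hcov : segment ℝ m p ⊆ interior P.region ∪ P.regionᶜ := by
      intro z hz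
      by_cases hzP : z ∈ P.region
      · left
        by_contra hzi
        exact hcon z hz ⟨subset_closure hzP, hzi⟩
      · exact Or.inr hzP
    rcases hpre _ _ isOpen_interior P.isClosed_region.isOpen_compl hcov (by
      ext z
      simp only [mem_inter_iff, mem_empty_iff_false, iff_false, not_and]
      exact fun _ h1 h2 => h2 (interior_subset h1)) with h | h
    · exact hτP (interior_subset (h (left_mem_segment ℝ m p)))
    · exact h (right_mem_segment ℝ m p) hp
  rw [segment_eq_image] at hrseg
  obtain ⟨θ, ⟨hθ0, hθ1⟩, hrθ⟩ := hrseg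
  set σ := (1 - θ) * τ + θ with hσ
  have hrσ : r = x + σ • (p - x) := by
    rw [← hrθ, hm]
    apply plane_ext
    · simp [hσ]; ring
    · simp [hσ]; ring
  have hθne : θ ≠ 0 := by
    rintro rfl
    apply hτP
    have : r = m := by simpa using hrθ.symm
    exact this ▸ P.trace_subset_region hr
  have hθpos : 0 < θ := lt_of_le_of_ne hθ0 (Ne.symm hθne)
  have hσ1 : σ ≤ 1 := by rw [hσ]; nlinarith
  have hτσ : τ < σ := by rw [hσ]; nlinarith
  have hσ0 : 0 < σ := hτ0.trans hτσ
  have hmt : m ∉ P.trace := fun h => hτP (P.trace_subset_region h)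
  have hxp : p - x ≠ 0 := by
    intro h0
    apply hmt
    rw [hm, h0, smul_zero, add_zero]
    exact hx
  have hxr : x ≠ r := by
    intro h
    rw [hrσ] at h
    have : σ • (p - x) = 0 := by simpa using h.symm
    exact (smul_ne_zero hσ0.ne' hxp) this
  have hmseg : m ∈ openSegment ℝ x r := by
    refine ⟨1 - τ / σ, τ / σ, sub_pos.2 ((div_lt_one hσ0).2 hτσ), by positivity, by ring, ?_⟩
    rw [hrσ, hm]
    apply plane_ext
    · simp; field_simp; ring
    · simp; field_simp; ring
  have hsub : segment ℝ x r ⊆ segment ℝ x p := by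
    refine (convex_segment x p).segment_subset (left_mem_segment ℝ x p) ?_
    exact ⟨1 - σ, σ, by linarith, hσ0.le, by ring, by
      rw [hrσ]; apply plane_ext <;> simp <;> ring⟩
  have hsep := separation hxr hmseg hmt (P.polyJoined_trace hr hx)
  have hrot : rot (r - x) = σ • rot (p - x) := by
    rw [hrσ]; apply plane_ext <;> simp <;> ring
  -- choose a common small distance from the ray
  have hscale : Tendsto (fun ε : ℝ => ε * σ) (𝓝[>] 0) (𝓝[>] 0) := by
    refine tendsto_nhdsWithin_iff.2 ⟨?_, ?_⟩
    · have : Continuous fun ε : ℝ => ε * σ := by fun_prop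
      simpa using (this.tendsto 0).mono_left (nhdsWithin_le_nhds (s := Ioi 0))
    · filter_upwards [self_mem_nhdsWithin] with ε hε
      exact mul_pos hε hσ0
  have hnear : ∀ ζ : ℝ, ∀ᶠ ε : ℝ in 𝓝[>] 0, m + (ζ * ε) • rot (p - x) ∉ P.region := by
    intro ζ
    have hc : Continuous fun ε : ℝ => m + (ζ * ε) • rot (p - x) := by fun_prop
    have ht := (hc.tendsto 0).mono_left (nhdsWithin_le_nhds (s := Ioi 0))
    rw [mul_zero, zero_smul, add_zero] at ht
    exact ht.eventually (P.isClosed_region.isOpen_compl.mem_nhds hτP)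
  obtain ⟨ε, hε, h₁, h₂, hn₁, hn₂⟩ := (hsep.and ((hscale.eventually h₁).and
    ((hscale.eventually h₂).and ((hscale.eventually (hnear 1)).and
      (hscale.eventually (hnear (-1))))))).exists
  rw [hrot, smul_smul] at hε
  set e := ε * σ with he
  have hεsep : ∀ D : Set Plane, IsPreconnected D → Disjoint D P.trace →
      Disjoint D (segment ℝ x r) → m + (1 * e) • rot (p - x) ∈ D →
        m + (-1 * e) • rot (p - x) ∉ D := by
    intro D hD hDt hDs hp hn
    refine hε D hD hDt hDs (by simpa using hp) ?_
    rw [sub_eq_add_neg, ← neg_smul]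
    simpa using hn
  obtain ⟨M, hM, hMd⟩ := P.exists_farRegion_disjoint
  have hMT : Disjoint (farRegion M) (P.trace ∪ segment ℝ x r) :=
    disjoint_union_right.2 ⟨hMd.mono_right P.trace_subset_region,
      segment_disjoint_farRegion hMd (P.trace_subset_region hx) (P.trace_subset_region hr)⟩
  -- a bounded part yields a reflex edge that `p` violates
  have hbdd : ∀ ζ : ℝ, ∀ w : Plane, (w 0 = 0 ∨ w 1 = 0) → w ≠ 0 → height w p ≤ height w x →
      m + (ζ * e) • rot (p - x) ∉ P.region →
      (∃ D : Set Plane, IsPreconnected D ∧ Disjoint D P.trace ∧ Disjoint D (segment ℝ x p) ∧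
        m + (ζ * e) • rot (p - x) ∈ D ∧ ∃ c ∈ D, height w x < height w c) →
      m + (ζ * e) • rot (p - x) ∉ P.trace ∪ segment ℝ x r ∧
      ¬ Bornology.IsBounded (connectedComponentIn (P.trace ∪ segment ℝ x r)ᶜ
        (m + (ζ * e) • rot (p - x))) := by
    rintro ζ w hw hw0 hpw hqP ⟨D, hD, hDt, hDs, hqD, c, hcD, hc⟩
    have hDT : ∀ z ∈ D, z ∉ P.trace ∪ segment ℝ x r := fun z hz h =>
      h.elim (disjoint_left.1 hDt hz) fun h => disjoint_left.1 hDs hz (hsub h)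
    refine ⟨hDT _ hqD, fun hb => ?_⟩
    have hcq : c ∈ connectedComponentIn (P.trace ∪ segment ℝ x r)ᶜ
        (m + (ζ * e) • rot (p - x)) := hD.subset_connectedComponentIn hqD hDT hcD
    rw [connectedComponentIn_eq hcq] at hb
    have hle : ∀ z ∈ segment ℝ x r, height w z ≤ height w x := by
      intro z hz
      obtain ⟨s, t, hs, ht, hst, rfl⟩ := hsub hz
      obtain rfl : s = 1 - t := by linarith
      have e : height w ((1 - t) • x + t • p) = (1 - t) * height w x + t * height w p := by
        simp [height]; ring
      rw [e]
      nlinarith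
    obtain ⟨j, hj, hjp⟩ := exists_reflexEdge_of_pocket hw hw0
      (isCompact_segment x r).isClosed hle
      (fun hcP => hqP (P.mem_region_of_preconnected hD hDt hcD hqD hcP))
      (fun h => disjoint_left.1 hDs hcD (hsub h)) hc hb
    exact absurd (hjp p (hpR j hj)) (not_lt.2 hpw)
  obtain ⟨hq₁, hu₁⟩ := hbdd 1 w₁ hw₁ hw₁0 hpw₁ hn₁ h₁
  obtain ⟨hq₂, hu₂⟩ := hbdd (-1) w₂ hw₂ hw₂0 hpw₂ hn₂ h₂
  obtain ⟨D, hD, hDT, hD₁, hD₂⟩ := exists_preconnected_of_unbounded hM hMT hq₁ hq₂ hu₁ hu₂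
  rw [disjoint_union_right] at hDT
  exact hεsep D hD hDT.1 hDT.2 hD₁ hD₂

lemma not_blocked {b x : Plane} (hx : x ∈ P.region) (hxb : x ≠ b)
    (h : ∀ᶠ τ : ℝ in 𝓝[>] 0, x + τ • (b - x) ∈ P.region) : ¬ P.Blocked b x := by
  intro hbl
  obtain ⟨u, hu, hu'⟩ := mem_nhdsGT_iff_exists_Ioo_subset.1 h
  have hu : 0 < u := hu
  obtain ⟨τ, hτ0, hτ⟩ : ∃ τ : ℝ, 0 < τ ∧ τ < min u 1 := exists_between (lt_min hu one_pos)
  have hτu := hτ.trans_le (min_le_left _ _)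
  have hτ1 := hτ.trans_le (min_le_right _ _)
  have := hbl (x + τ • (b - x)) ?_ ?_
  · have h0 : τ • (b - x) = 0 := by simpa using this
    rcases smul_eq_zero.1 h0 with h | h
    · linarith
    · exact hxb (sub_eq_zero.1 h).symm
  · exact ⟨1 - τ, τ, by linarith, hτ0.le, by ring, by apply plane_ext <;> simp <;> ring⟩
  · intro z hz
    rw [segment_eq_image] at hz
    obtain ⟨θ, ⟨h0, h1⟩, rfl⟩ := hz
    have e : (1 - θ) • x + θ • (x + τ • (b - x)) = x + (θ * τ) • (b - x) := by
      apply plane_ext <;> simp <;> ring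
    simp only [e]
    rcases h0.eq_or_lt with rfl | h0
    · simpa using hx
    · exact hu' ⟨by positivity, by nlinarith⟩

/-- If the previous edge arrives from the other side, points just beyond the start of an edge
are on the same side as those next to the edge. -/
lemma region_beyond_start {ζ : ℝ} (hζ : ζ = 1 ∨ ζ = -1) (ha : P.startTurn i * ζ < 0) {s t : ℝ}
    (hs : -P.margin i < s) (hs0 : s ≤ 0) (ht0 : 0 ≤ ζ * t) (ht : ζ * t < P.margin i)
    (hne : s ≠ 0 ∨ t ≠ 0) : P.frame i s t ∈ P.region ↔ P.SideInside i ζ := by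
  have hm := margin_pos (i := i)
  have hζζ : ζ * ζ = 1 := by rcases hζ with rfl | rfl <;> norm_num
  have hτ : t = ζ * (ζ * t) := by linear_combination -t * hζζ
  have h1 : ∀ s' t', -P.margin i < s' → s' < 1 → 0 < t' → t' < P.margin i →
      (P.frame i s' (ζ * t') ∈ P.region ↔ P.SideInside i ζ) := fun s' t' h1 h2 h3 h4 =>
    frameRect_region (collar_before_disjoint_trace hζ ha) h1 h2 h3 h4 (by linarith) (by norm_num)
      (by linarith) (by linarith)
  rcases ht0.eq_or_lt with h0 | h0
  · have ht0 : t = 0 := by rw [hτ, ← h0, mul_zero]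
    have hs0 : s < 0 := lt_of_le_of_ne hs0 (hne.resolve_right (not_not.2 ht0))
    rw [hτ, ← h1 s (P.margin i / 2) hs (by linarith) (by linarith) (by linarith)]
    exact frameRect_region (before_disjoint_trace hζ) hs hs0 (by linarith) (by linarith) hs hs0
      (by linarith) (by linarith)
  · rw [hτ]
    exact h1 s _ hs (by linarith) h0 ht

lemma ray_eq (s₀ α β τ e : ℝ) {x u : Plane} (hx : x = P.frame i s₀ 0)
    (hu : u = α • P.dir i + β • rot (P.dir i)) :
    x + τ • u + e • rot u = P.frame i (s₀ + τ * α - e * β) (τ * β + e * α) := by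
  rw [hx, hu]
  apply plane_ext <;> simp <;> ring

lemma eventually_abs_mul_lt (c : ℝ) {δ : ℝ} (hδ : 0 < δ) : ∀ᶠ τ : ℝ in 𝓝[>] 0, |τ * c| < δ := by
  have h : Continuous fun τ : ℝ => |τ * c| := by fun_prop
  have := (h.tendsto 0).mono_left (nhdsWithin_le_nhds (s := Ioi 0))
  rw [zero_mul, abs_zero] at this
  exact this.eventually_lt_const hδ

lemma height_rot_self (v : Plane) : height v (rot v) = 0 := by simp [height]; ring

lemma height_smul (c : ℝ) (v z : Plane) : height (c • v) z = c * height v z := by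
  simp [height]; ring

lemma height_dir_self : height (P.dir i) (P.dir i) = P.sqLen i := by simp [height, sqLen]; ring

lemma height_rot_rot : height (rot (P.dir i)) (rot (P.dir i)) = P.sqLen i := by
  simp [height, sqLen]; ring

lemma height_rot_dir : height (rot (P.dir i)) (P.dir i) = 0 := by simp [height]; ring

lemma axis_dir : (P.dir i) 0 = 0 ∨ (P.dir i) 1 = 0 := (dir_axis i).symm

lemma axis_rot_dir : (rot (P.dir i)) 0 = 0 ∨ (rot (P.dir i)) 1 = 0 := by
  rcases dir_axis i with h | h <;> simp [h]

lemma rot_dir_ne_zero : rot (P.dir i) ≠ 0 := by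
  rw [← norm_ne_zero_iff, norm_rot, norm_ne_zero_iff]
  exact dir_ne_zero

/-- An object inside an edge on which it cannot slide is not stuck. -/
lemma not_stuck_in_edge {s₀ β : ℝ} (h0 : 0 < s₀) (h1 : s₀ < 1) {b x : Plane}
    (hb : b ∈ P.region) (hbR : b ∈ P.reflexRectangle) (hx : x = P.frame i s₀ 0)
    (hu : b - x = β • rot (P.dir i)) (hβ : β ≠ 0) : ¬ P.Blocked b x := by
  obtain ⟨η, hη⟩ := P.exists_isOrientation
  have hm := margin_pos (i := i)
  have hL := sqLen_pos (i := i)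
  have hu' : b - x = (0 : ℝ) • P.dir i + β • rot (P.dir i) := by rw [hu, zero_smul, zero_add]
  have hxt : x ∈ P.trace := hx ▸ P.edge_subset_trace i (frame_mem_edge h0.le h1.le)
  have hray : ∀ τ : ℝ, x + τ • (b - x) = P.frame i s₀ (τ * β) := fun τ => by
    have := ray_eq s₀ 0 β τ 0 hx hu'
    simpa using this
  have hxb : x ≠ b := by
    rintro rfl
    rw [sub_self] at hu
    exact smul_ne_zero hβ rot_dir_ne_zero hu.symm
  have hη0 : η ≠ 0 := by rcases hη.1 with rfl | rfl <;> norm_num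
  rcases lt_or_gt_of_ne (mul_ne_zero hη0 hβ) with hneg | hpos
  · -- the beacon pulls outwards, perpendicularly to the edge; along the edge, the points next to
    -- the ray lie beyond `x` in opposite directions
    exfalso
    refine notMem_reflexRectangle_of_leaving hxt hb ?_ ?_ hbR
    · filter_upwards [eventually_abs_mul_lt β hm, self_mem_nhdsWithin] with τ hτ hτ0
      have hτ0 : 0 < τ := hτ0
      rw [hray]
      exact hη.outside h0 h1 (by nlinarith) hτ
    · intro ζ hζ
      have hζζ : ζ * ζ = 1 := by rcases hζ with rfl | rfl <;> norm_num
      have hζ0 : ζ ≠ 0 := by rcases hζ with rfl | rfl <;> norm_num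
      refine ⟨(-(ζ * β)) • P.dir i, ?_, smul_ne_zero (by simp [hζ0, hβ]) dir_ne_zero, ?_, ?_⟩
      · rcases axis_dir (i := i) with h | h <;> simp [h]
      · have e : b = P.frame i s₀ β := by
          have := hray 1
          rw [one_smul, one_mul] at this
          rw [← this]; abel
        rw [e, hx, height_smul, height_smul, height_frame, height_frame, height_rot_self]
        linarith
      · filter_upwards [eventually_abs_mul_lt β hm, self_mem_nhdsWithin] with τ hτ hτ0
        have hτ0 : 0 < τ := hτ0
        filter_upwards [eventually_abs_mul_lt β (lt_min h0 (sub_pos.2 h1)), self_mem_nhdsWithin]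
          with ε hε hε0
        have hε0 : 0 < ε := hε0
        have e := ray_eq s₀ 0 β τ (ζ * ε) hx hu'
        have hε1 : |ε * β| < s₀ := hε.trans_le (min_le_left _ _)
        have hε2 : |ε * β| < 1 - s₀ := hε.trans_le (min_le_right _ _)
        rw [abs_lt] at hε1 hε2
        refine ⟨{x + τ • (b - x) + (ζ * ε) • rot (b - x)}, isPreconnected_singleton, ?_, ?_, rfl,
          _, rfl, ?_⟩
        · rw [disjoint_singleton_left, e, mul_zero, add_zero, mul_zero, add_zero]
          refine collar_notMem_trace ?_ ?_ (by positivity) hτ <;>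
            rcases hζ with rfl | rfl <;> linarith [hε1.1, hε1.2, hε2.1, hε2.2]
        · rw [disjoint_singleton_left, e]
          rintro ⟨s, t, hs, ht, hst, e'⟩
          have e2 := congrArg (P.frameFst i) e'
          have : s • x + t • b = x + t • (b - x) := by
            obtain rfl : s = 1 - t := by linarith
            apply plane_ext <;> simp <;> ring
          rw [this, hray, frameFst_frame, frameFst_frame] at e2
          have : ζ * (ε * β) = 0 := by linarith
          exact mul_ne_zero hζ0 (mul_ne_zero hε0.ne' hβ) this
        · rw [e, hx, height_smul, height_smul, height_frame, height_frame, height_rot_self,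
            height_dir_self]
          have : 0 < ε * β ^ 2 * P.sqLen i := by positivity
          have e3 : -(ζ * β) * (-(ζ * ε * β) * P.sqLen i) = ε * β ^ 2 * P.sqLen i := by
            linear_combination (ε * β ^ 2 * P.sqLen i) * hζζ
          linarith
  · refine not_blocked (P.trace_subset_region hxt) hxb ?_
    filter_upwards [eventually_abs_mul_lt β hm, self_mem_nhdsWithin] with τ hτ hτ0
    have hτ0 : 0 < τ := hτ0
    rw [hray]
    exact hη.inside h0 h1 (by nlinarith) hτ

set_option maxHeartbeats 1000000 in
/-- An object at a vertex that cannot slide along the two incident edges is not stuck. -/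
lemma not_stuck_at_vertex {α β : ℝ} {b x : Plane}
    (hb : b ∈ P.region) (hbR : b ∈ P.reflexRectangle) (hx : x = P.frame i 0 0)
    (hu : b - x = α • P.dir i + β • rot (P.dir i)) (hα : α ≤ 0) (hβ : P.startTurn i * β ≤ 0)
    (hxb : x ≠ b) : ¬ P.Blocked b x := by
  obtain ⟨η, hη⟩ := P.exists_isOrientation
  have hηη := hη.mul_self
  have hη0 : η ≠ 0 := by rcases hη.1 with rfl | rfl <;> norm_num
  have hm := margin_pos (i := i)
  have hL := sqLen_pos (i := i)
  have ha0 := startTurn_ne_zero (i := i)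
  have hxt : x ∈ P.trace := hx ▸ P.edge_subset_trace i (frame_mem_edge le_rfl zero_le_one)
  have hray : ∀ τ : ℝ, x + τ • (b - x) = P.frame i (τ * α) (τ * β) := fun τ => by
    have := ray_eq 0 α β τ 0 hx hu
    simpa using this
  have hne : α ≠ 0 ∨ β ≠ 0 := by
    by_contra h
    push Not at h
    rw [h.1, h.2, zero_smul, zero_smul, add_zero] at hu
    exact hxb (sub_eq_zero.1 hu).symm
  -- on the side `ζ` of the edge away from the previous edge, the ray starts within this side
  have hside : ∀ ζ : ℝ, (ζ = 1 ∨ ζ = -1) → P.startTurn i * ζ < 0 → ∀ᶠ τ : ℝ in 𝓝[>] 0,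
      (x + τ • (b - x) ∈ P.region ↔ P.SideInside i ζ) := by
    intro ζ hζ haζ
    have hζβ : 0 ≤ ζ * β := by
      have h : 0 ≤ P.startTurn i ^ 2 * (ζ * β) := by nlinarith
      exact nonneg_of_mul_nonneg_right h (by positivity)
    filter_upwards [eventually_abs_mul_lt α hm, eventually_abs_mul_lt β hm, self_mem_nhdsWithin]
      with τ h1 h2 hτ0
    have hτ0 : 0 < τ := hτ0
    rw [abs_lt] at h1 h2
    rw [hray]
    refine region_beyond_start hζ haζ h1.1 (by nlinarith) (by nlinarith) ?_ ?_
    · rcases hζ with rfl | rfl <;> linarith [h2.1, h2.2]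
    · exact hne.imp (mul_ne_zero hτ0.ne') (mul_ne_zero hτ0.ne')
  rcases lt_or_gt_of_ne (mul_ne_zero ha0 hη0) with hneg | hpos
  · -- a reflex vertex
    refine not_blocked (P.trace_subset_region hxt) hxb ?_
    filter_upwards [hside η hη.1 hneg] with τ hτ
    rw [hτ]
    exact (hη.2 i _ _ (by norm_num) (by norm_num) (by linarith) (by linarith)).1
  · -- a convex vertex
    exfalso
    have hη' : -η = 1 ∨ -η = -1 := by rcases hη.1 with rfl | rfl <;> simp
    refine notMem_reflexRectangle_of_leaving hxt hb ?_ ?_ hbR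
    · filter_upwards [hside (-η) hη' (by linarith)] with τ hτ
      rw [hτ]
      exact (hη.2 i _ _ (by norm_num) (by norm_num) (by linarith) (by linarith)).2
    set β' := η * β with hβ'
    have hββ' : β = η * β' := by rw [hβ', ← mul_assoc, hηη, one_mul]
    have hβ'0 : β' ≤ 0 := by
      have h : P.startTurn i ^ 2 * β' ≤ 0 := by nlinarith
      exact nonpos_of_mul_nonpos_right h (by positivity)
    have hne' : α + β' < 0 := by
      rcases hne with h | h
      · have := lt_of_le_of_ne hα h; linarith
      · have : β' ≠ 0 := mul_ne_zero hη0 h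
        have := lt_of_le_of_ne hβ'0 this; linarith
    have hsq : 0 < α ^ 2 + β' ^ 2 := by
      nlinarith [mul_pos_of_neg_of_neg hne' hne', sq_nonneg (α - β')]
    set ρ := min (P.margin i) 1 with hρdef
    have hρ : 0 < ρ := lt_min hm one_pos
    have hρm : ρ ≤ P.margin i := min_le_left _ _
    have hρ1 : ρ ≤ 1 := min_le_right _ _
    have hbe : b = P.frame i α β := by
      have := hray 1
      rw [one_smul, one_mul, one_mul] at this
      rw [← this]; abel
    -- sectors between the ray and an edge, in local coordinates
    have hsector : ∀ A : Set (ℝ × ℝ), Convex ℝ A →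
        (∀ s t, (s, t) ∈ A → s < 0 ∨ t < 0) → (∀ s t, (s, t) ∈ A → α * t - β' * s ≠ 0) →
        (∀ s t, (s, t) ∈ A → |s| < ρ ∧ |t| < ρ) →
        ∀ D, D = (fun q : ℝ × ℝ => P.frame i q.1 (η * q.2)) '' A →
        IsPreconnected D ∧ Disjoint D P.trace ∧ Disjoint D (segment ℝ x b) := by
      rintro A hA h1 h2 h3 D rfl
      refine ⟨hA.isPreconnected.image _ ?_, ?_, ?_⟩
      · have : Continuous fun q : ℝ × ℝ => P.frame i q.1 (η * q.2) := by unfold frame; fun_prop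
        exact this.continuousOn
      · rw [disjoint_left]
        rintro _ ⟨⟨s, t⟩, hst, rfl⟩ hz
        simp only at hz
        obtain ⟨hs, ht⟩ := h3 s t hst
        rw [abs_lt] at hs ht
        rw [frame_mem_trace_iff (by linarith) (by linarith) (by
          rw [abs_lt]; rcases hη.1 with h | h <;> rw [h] <;> constructor <;> linarith)] at hz
        rcases hz with ⟨h, h', -⟩ | ⟨h, h'⟩ | ⟨h, -⟩
        · have ht0 : t = 0 := (mul_eq_zero.1 h).resolve_left hη0
          rcases h1 s t hst with h | h <;> linarith
        · rcases h1 s t hst with h'' | h''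
          · linarith
          · nlinarith
        · linarith
      · rw [disjoint_left]
        rintro _ ⟨⟨s, t⟩, hst, rfl⟩ ⟨y, θ, -, -, hyθ, e⟩
        have e' : y • x + θ • b = x + θ • (b - x) := by
          obtain rfl : y = 1 - θ := by linarith
          apply plane_ext <;> simp <;> ring
        rw [e', hray] at e
        have e : P.frame i (θ * α) (θ * β) = P.frame i s (η * t) := e
        obtain ⟨e1, e2⟩ := frame_inj e
        apply h2 s t hst
        have : t = θ * β' := by
          apply mul_left_cancel₀ hη0
          rw [← e2, hββ']; ring
        rw [← e1, this]; ring
    intro ζ hζ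
    have hζζ : ζ * ζ = 1 := by rcases hζ with rfl | rfl <;> norm_num
    -- the second local coordinate, counted towards the interior, of a point next to the ray
    have hpt : ∀ τ ε : ℝ, x + τ • (b - x) + (ζ * ε) • rot (b - x) =
        P.frame i (τ * α - ε * ((ζ * η) * β')) (η * (τ * β' + ε * ((ζ * η) * α))) := by
      intro τ ε
      rw [ray_eq 0 α β τ (ζ * ε) hx hu, hββ']
      congr 1
      · ring
      · linear_combination (-(ζ * ε * α)) * hηη
    have hev : ∀ᶠ τ : ℝ in 𝓝[>] 0, ∀ᶠ ε : ℝ in 𝓝[>] 0, 0 < τ ∧ 0 < ε ∧ |τ * α| < ρ / 2 ∧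
        |τ * β'| < ρ / 2 ∧ |ε * α| < ρ / 2 ∧ |ε * β'| < ρ / 2 := by
      filter_upwards [eventually_abs_mul_lt α (half_pos hρ), eventually_abs_mul_lt β' (half_pos hρ),
        self_mem_nhdsWithin] with τ h1 h2 h3
      filter_upwards [eventually_abs_mul_lt α (half_pos hρ), eventually_abs_mul_lt β' (half_pos hρ),
        self_mem_nhdsWithin] with ε h4 h5 h6
      exact ⟨h3, h6, h1, h2, h4, h5⟩
    have hbox : Convex ℝ {q : ℝ × ℝ | |q.1| < ρ ∧ |q.2| < ρ} := by
      have : {q : ℝ × ℝ | |q.1| < ρ ∧ |q.2| < ρ} = Ioo (-ρ) ρ ×ˢ Ioo (-ρ) ρ := by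
        ext q; simp [abs_lt]
      rw [this]
      exact (convex_Ioo _ _).prod (convex_Ioo _ _)
    have hlin : ∀ c d : ℝ, Convex ℝ {q : ℝ × ℝ | c * q.1 + d * q.2 < 0} := fun c d =>
      convex_halfSpace_lt (f := fun q : ℝ × ℝ => c * q.1 + d * q.2)
        ⟨fun _ _ => by simp; ring, fun _ _ => by simp; ring⟩ 0
    have hζη : ζ * η = -1 ∨ ζ * η = 1 := by
      rcases hζ with rfl | rfl <;> rcases hη.1 with h | h <;> rw [h] <;> simp
    rcases hζη with hζη | hζη
    · -- the sector between the ray and the previous edge reaches beyond `x` in the direction of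
      -- this edge
      refine ⟨η • rot (P.dir i), ?_, smul_ne_zero hη0 rot_dir_ne_zero, ?_, ?_⟩
      · rcases axis_rot_dir (i := i) with h | h <;>
          simp only [PiLp.smul_apply, h, smul_zero] <;> simp
      · rw [hbe, hx, height_smul, height_smul, height_frame, height_frame, height_rot_dir,
          height_rot_rot]
        have : β' * P.sqLen i ≤ 0 := mul_nonpos_of_nonpos_of_nonneg hβ'0 hL.le
        rw [hβ'] at this
        linarith
      · filter_upwards [hev] with τ hτ
        filter_upwards [hτ] with ε hε
        obtain ⟨hτ0, hε0, h1, h2, h3, h4⟩ := hε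
        rw [abs_lt] at h1 h2 h3 h4
        obtain ⟨hD1, hD2, hD3⟩ := hsector ({q | 1 * q.1 + 0 * q.2 < 0} ∩
          ({q | -β' * q.1 + α * q.2 < 0} ∩ {q | |q.1| < ρ ∧ |q.2| < ρ}))
          ((hlin _ _).inter ((hlin _ _).inter hbox))
          (fun s t h => Or.inl (by have : 1 * s + 0 * t < 0 := h.1; linarith))
          (fun s t h => by have : -β' * s + α * t < 0 := h.2.1; exact ne_of_lt (by linarith))
          (fun s t h => h.2.2) _ rfl
        refine ⟨_, hD1, hD2, hD3, ?_, P.frame i (-(ρ / 2)) (η * (ρ / 2)), ?_, ?_⟩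
        · rw [hpt, hζη]
          refine ⟨(τ * α - ε * (-1 * β'), τ * β' + ε * (-1 * α)), ⟨?_, ?_, ?_, ?_⟩, rfl⟩
          · show 1 * (τ * α - ε * (-1 * β')) + 0 * (τ * β' + ε * (-1 * α)) < 0
            rcases hα.eq_or_lt with h | h
            · have : β' < 0 := by linarith
              rw [h]; nlinarith
            · nlinarith
          · show -β' * (τ * α - ε * (-1 * β')) + α * (τ * β' + ε * (-1 * α)) < 0
            nlinarith
          · show |τ * α - ε * (-1 * β')| < ρ
            rw [abs_lt]; constructor <;> linarith
          · show |τ * β' + ε * (-1 * α)| < ρ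
            rw [abs_lt]; constructor <;> linarith
        · refine ⟨(-(ρ / 2), ρ / 2), ⟨?_, ?_, ?_, ?_⟩, rfl⟩
          · show 1 * -(ρ / 2) + 0 * (ρ / 2) < 0
            linarith
          · show -β' * -(ρ / 2) + α * (ρ / 2) < 0
            nlinarith
          · show |-(ρ / 2)| < ρ
            rw [abs_lt]; constructor <;> linarith
          · show |ρ / 2| < ρ
            rw [abs_lt]; constructor <;> linarith
        · rw [hx, height_smul, height_smul, height_frame, height_frame, height_rot_dir,
            height_rot_rot]
          have : 0 < ρ / 2 * P.sqLen i := by positivity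
          have e : η * (η * (ρ / 2) * P.sqLen i) = ρ / 2 * P.sqLen i := by
            linear_combination (ρ / 2 * P.sqLen i) * hηη
          linarith
    · -- the sector between the ray and edge `i` reaches beyond `x` in the direction of edge `i`
      refine ⟨P.dir i, axis_dir, dir_ne_zero, ?_, ?_⟩
      · rw [hbe, hx, height_frame, height_frame, height_rot_self, height_dir_self]
        have : α * P.sqLen i ≤ 0 := mul_nonpos_of_nonpos_of_nonneg hα hL.le
        linarith
      · filter_upwards [hev] with τ hτ
        filter_upwards [hτ] with ε hε
        obtain ⟨hτ0, hε0, h1, h2, h3, h4⟩ := hε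
        rw [abs_lt] at h1 h2 h3 h4
        obtain ⟨hD1, hD2, hD3⟩ := hsector ({q | 0 * q.1 + 1 * q.2 < 0} ∩
          ({q | β' * q.1 + -α * q.2 < 0} ∩ {q | |q.1| < ρ ∧ |q.2| < ρ}))
          ((hlin _ _).inter ((hlin _ _).inter hbox))
          (fun s t h => Or.inr (by have : 0 * s + 1 * t < 0 := h.1; linarith))
          (fun s t h => by have : β' * s + -α * t < 0 := h.2.1; exact ne_of_gt (by linarith))
          (fun s t h => h.2.2) _ rfl
        refine ⟨_, hD1, hD2, hD3, ?_, P.frame i (ρ / 2) (η * -(ρ / 2)), ?_, ?_⟩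
        · rw [hpt, hζη]
          refine ⟨(τ * α - ε * (1 * β'), τ * β' + ε * (1 * α)), ⟨?_, ?_, ?_, ?_⟩, rfl⟩
          · show 0 * (τ * α - ε * (1 * β')) + 1 * (τ * β' + ε * (1 * α)) < 0
            rcases hα.eq_or_lt with h | h
            · have : β' < 0 := by linarith
              rw [h]; nlinarith
            · nlinarith
          · show β' * (τ * α - ε * (1 * β')) + -α * (τ * β' + ε * (1 * α)) < 0
            nlinarith
          · show |τ * α - ε * (1 * β')| < ρ
            rw [abs_lt]; constructor <;> linarith
          · show |τ * β' + ε * (1 * α)| < ρ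
            rw [abs_lt]; constructor <;> linarith
        · refine ⟨(ρ / 2, -(ρ / 2)), ⟨?_, ?_, ?_, ?_⟩, rfl⟩
          · show 0 * (ρ / 2) + 1 * -(ρ / 2) < 0
            linarith
          · show β' * (ρ / 2) + -α * -(ρ / 2) < 0
            nlinarith
          · show |ρ / 2| < ρ
            rw [abs_lt]; constructor <;> linarith
          · show |-(ρ / 2)| < ρ
            rw [abs_lt]; constructor <;> linarith
        · rw [hx, height_frame, height_frame, height_rot_self, height_dir_self]
          have : 0 < ρ / 2 * P.sqLen i := by positivity
          linarith

end RectilinearPolygon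

namespace RectilinearPolygon

variable {P : RectilinearPolygon} {i : Fin P.n}

/-! ### Attraction paths reach the beacon -/

lemma sub_frame (s : ℝ) (b : Plane) : b - P.frame i s 0 =
    (P.frameFst i b - s) • P.dir i + P.frameSnd i b • rot (P.dir i) := by
  conv_lhs => rw [← P.frame_frameFst_frameSnd (i := i) b]
  apply plane_ext <;> simp [frame] <;> ring

/-- If a point of an edge is the point of the edge nearest to `b`, then `b` does not pull it
towards any other point of the edge. -/
lemma frame_nearest {s s' : ℝ} {b : Plane} (h0 : 0 ≤ s) (h1 : s ≤ 1) (h0' : 0 ≤ s') (h1' : s' ≤ 1)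
    (h : ∀ z ∈ P.edge i, dist (P.frame i s 0) b ≤ dist z b) :
    (P.frameFst i b - s) * (s' - s) ≤ 0 := by
  have := inner_nonneg_of_nearest (frame_mem_edge h0 h1) h (frame_mem_edge h0' h1')
  have e := sub_frame (i := i) s b
  have e0 := congrFun (congrArg WithLp.ofLp e) 0
  have e1 := congrFun (congrArg WithLp.ofLp e) 1
  have hL := sqLen_pos (i := i)
  simp [frame, rot, sqLen] at this e0 e1 hL
  have h2 : (P.frameFst i b - s) * (s' - s) * ((P.dir i 0) ^ 2 + (P.dir i 1) ^ 2) ≤ 0 := by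
    linear_combination this - (s' - s) * (P.dir i 0 * e0 + P.dir i 1 * e1)
  exact nonpos_of_mul_nonpos_left h2 hL

lemma frame_nearest_prev {b : Plane}
    (h : ∀ z ∈ P.edge (P.prev i), dist (P.frame i 0 0) b ≤ dist z b) :
    P.startTurn i * P.frameSnd i b ≤ 0 := by
  have h1 : P.frame i 0 0 ∈ P.edge (P.prev i) := mem_edge_prev_iff.2 ⟨0, by simp⟩
  have h2 : P.frame i 0 (P.startTurn i) ∈ P.edge (P.prev i) := mem_edge_prev_iff.2 ⟨1, by simp⟩
  have := inner_nonneg_of_nearest h1 h h2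
  have e := sub_frame (i := i) 0 b
  have e0 := congrFun (congrArg WithLp.ofLp e) 0
  have e1 := congrFun (congrArg WithLp.ofLp e) 1
  have hL := sqLen_pos (i := i)
  simp [frame, rot, sqLen] at this e0 e1 hL
  have h2 : (P.startTurn i * P.frameSnd i b) * ((P.dir i 0) ^ 2 + (P.dir i 1) ^ 2) ≤ 0 := by
    linear_combination this - P.startTurn i * (P.dir i 0 * e1 - P.dir i 1 * e0)
  exact nonpos_of_mul_nonpos_left h2 hL

/-- The pull of a beacon in the reflex rectangle never leaves an object stuck. -/
lemma exists_slideMove {b x : Plane} (hb : b ∈ P.region) (hbR : b ∈ P.reflexRectangle)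
    (hx : x ∈ P.region) (hxb : x ≠ b) (hB : P.Blocked b x) : ∃ y, P.SlideMove b x y := by
  by_contra hno
  have hnear : ∀ i, x ∈ P.edge i → ∀ z ∈ P.edge i, dist x b ≤ dist z b := by
    intro i hi
    obtain ⟨y, hy, hmin⟩ := (P.isCompact_edge i).exists_isMinOn ⟨x, hi⟩
      (f := fun z => dist z b) (by fun_prop)
    have hyx : y = x := by
      by_contra hyx
      exact hno ⟨y, hB, i, hi, hy, hyx, fun z hz => hmin hz⟩
    exact fun z hz => hyx ▸ hmin hz
  have hxt : x ∈ P.trace := by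
    by_contra hxt
    refine not_blocked hx hxb ?_ hB
    have hc : Tendsto (fun τ : ℝ => x + τ • (b - x)) (𝓝[>] 0) (𝓝 x) := by
      have : Continuous fun τ : ℝ => x + τ • (b - x) := by fun_prop
      simpa using (this.tendsto 0).mono_left nhdsWithin_le_nhds
    exact hc (mem_interior_iff_mem_nhds.1 (P.mem_interior_region hxt hx))
  have hvertex : ∀ i, x ≠ P.frame i 0 0 := by
    rintro i rfl
    have hi : P.frame i 0 0 ∈ P.edge i := frame_mem_edge le_rfl zero_le_one
    have hi' : P.frame i 0 0 ∈ P.edge (P.prev i) := mem_edge_prev_iff.2 ⟨0, by simp⟩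
    refine not_stuck_at_vertex hb hbR rfl (sub_frame 0 b) ?_ (frame_nearest_prev (hnear _ hi'))
      hxb hB
    have := frame_nearest le_rfl zero_le_one zero_le_one le_rfl (hnear i hi)
    linarith
  obtain ⟨i, hi⟩ := P.mem_trace.1 hxt
  obtain ⟨s, h0, h1, rfl⟩ := mem_edge_iff.1 hi
  rcases h0.eq_or_lt with rfl | h0
  · exact hvertex i rfl
  rcases h1.eq_or_lt with rfl | h1
  · exact hvertex (P.next i) (by rw [frame_next]; simp)
  have e1 := frame_nearest h0.le h1.le le_rfl zero_le_one (hnear i hi)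
  have e2 := frame_nearest h0.le h1.le zero_le_one le_rfl (hnear i hi)
  have e : P.frameFst i b - s = 0 := by nlinarith
  have hu := sub_frame (i := i) s b
  rw [e, zero_smul, zero_add] at hu
  refine not_stuck_in_edge h0 h1 hb hbR rfl hu ?_ hB
  intro h
  rw [h, zero_smul] at hu
  exact hxb (sub_eq_zero.1 hu).symm

lemma mem_segment_iff_lineMap {x b z : Plane} :
    z ∈ segment ℝ x b ↔ ∃ τ : ℝ, 0 ≤ τ ∧ τ ≤ 1 ∧ z = x + τ • (b - x) := by
  rw [segment_eq_image']
  constructor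
  · rintro ⟨τ, ⟨h0, h1⟩, rfl⟩; exact ⟨τ, h0, h1, rfl⟩
  · rintro ⟨τ, h0, h1, rfl⟩; exact ⟨τ, ⟨h0, h1⟩, rfl⟩

lemma exists_straightMove {b x : Plane} (hB : ¬ P.Blocked b x) :
    ∃ y, P.StraightMove b x y ∧ P.Blocked b y := by
  have hseg : ∀ τ : ℝ, segment ℝ x (x + τ • (b - x)) ⊆ P.region ↔
      ∀ σ ∈ Icc (0 : ℝ) 1, x + (σ * τ) • (b - x) ∈ P.region := by
    intro τ
    rw [segment_eq_image', image_subset_iff]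
    refine forall₂_congr fun σ _ => ?_
    rw [mem_preimage, add_sub_cancel_left, smul_smul]
  set T : Set ℝ := {τ | τ ∈ Icc (0 : ℝ) 1 ∧ ∀ σ ∈ Icc (0 : ℝ) 1, x + (σ * τ) • (b - x) ∈ P.region}
    with hT
  have hTc : IsCompact T := by
    refine isCompact_Icc.of_isClosed_subset (isClosed_Icc.inter ?_) (fun τ h => h.1)
    have : {τ : ℝ | ∀ σ ∈ Icc (0 : ℝ) 1, x + (σ * τ) • (b - x) ∈ P.region} =
        ⋂ σ ∈ Icc (0 : ℝ) 1, (fun τ : ℝ => x + (σ * τ) • (b - x)) ⁻¹' P.region := by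
      ext; simp
    show IsClosed {τ : ℝ | ∀ σ ∈ Icc (0 : ℝ) 1, x + (σ * τ) • (b - x) ∈ P.region}
    rw [this]
    exact isClosed_biInter fun σ _ => P.isClosed_region.preimage (by fun_prop)
  unfold Blocked at hB
  push Not at hB
  obtain ⟨z, hz, hzP, hzx⟩ := hB
  obtain ⟨τ₀, h0, h1, rfl⟩ := mem_segment_iff_lineMap.1 hz
  have hτ₀ : τ₀ ∈ T := ⟨⟨h0, h1⟩, (hseg τ₀).1 hzP⟩
  obtain ⟨τ, hτ, hmax⟩ := hTc.exists_isMaxOn ⟨τ₀, hτ₀⟩ continuousOn_id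
  have hmax : ∀ τ' ∈ T, τ' ≤ τ := fun τ' h => hmax h
  have hτ0 : 0 < τ := by
    refine lt_of_lt_of_le (lt_of_le_of_ne h0 ?_) (hmax τ₀ hτ₀)
    rintro rfl
    simp at hzx
  have hbx : b - x ≠ 0 := by
    intro h
    simp [h] at hzx
  refine ⟨x + τ • (b - x), ⟨mem_segment_iff_lineMap.2 ⟨τ, hτ0.le, hτ.1.2, rfl⟩, ?_,
    (hseg τ).2 hτ.2, ?_⟩, ?_⟩
  · simpa using ⟨hτ0.ne', hbx⟩
  · intro z hz hzP
    obtain ⟨τ', h0', h1', rfl⟩ := mem_segment_iff_lineMap.1 hz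
    have := hmax τ' ⟨⟨h0', h1'⟩, (hseg τ').1 hzP⟩
    refine mem_segment_iff_lineMap.2 ⟨τ' / τ, by positivity, (div_le_one hτ0).2 this, ?_⟩
    rw [add_sub_cancel_left, smul_smul, div_mul_cancel₀ _ hτ0.ne']
  · intro z hz hzP
    obtain ⟨σ, h0', h1', rfl⟩ := mem_segment_iff_lineMap.1 hz
    have hcoef : ∀ σ : ℝ, x + τ • (b - x) + σ • (b - (x + τ • (b - x))) =
        x + (τ + σ * (1 - τ)) • (b - x) := fun σ => by
      apply plane_ext <;> simp <;> ring
    have h2 : σ * (1 - τ) ≤ 1 - τ := mul_le_of_le_one_left (by linarith [hτ.1.2]) h1'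
    have h3 : 0 ≤ σ * (1 - τ) := mul_nonneg h0' (by linarith [hτ.1.2])
    have hmem : τ + σ * (1 - τ) ∈ T := by
      refine ⟨⟨by linarith, by linarith⟩, fun ρ hρ => ?_⟩
      rcases le_total (ρ * (τ + σ * (1 - τ))) τ with h | h
      · have := hτ.2 (ρ * (τ + σ * (1 - τ)) / τ)
          ⟨div_nonneg (mul_nonneg hρ.1 (by linarith)) hτ0.le, (div_le_one hτ0).2 h⟩
        rwa [div_mul_cancel₀ _ hτ0.ne'] at this
      · apply hzP
        rw [hcoef]
        have hle : ρ * (τ + σ * (1 - τ)) ≤ τ + σ * (1 - τ) :=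
          mul_le_of_le_one_left (by linarith) hρ.2
        have hs : 0 < σ * (1 - τ) ∨ σ * (1 - τ) = 0 := h3.lt_or_eq.imp id Eq.symm
        rcases hs with hs | hs
        · refine mem_segment_iff_lineMap.2 ⟨(ρ * (τ + σ * (1 - τ)) - τ) / (σ * (1 - τ)),
            div_nonneg (by linarith) hs.le, (div_le_one hs).2 (by linarith), ?_⟩
          have : (ρ * (τ + σ * (1 - τ)) - τ) / (σ * (1 - τ)) * (σ * (1 - τ)) =
            ρ * (τ + σ * (1 - τ)) - τ := div_mul_cancel₀ _ hs.ne'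
          set k := (ρ * (τ + σ * (1 - τ)) - τ) / (σ * (1 - τ))
          set m := ρ * (τ + σ * (1 - τ))
          have hm : m = τ + k * (σ * (1 - τ)) := by linarith
          rw [hm]
          apply plane_ext <;> simp <;> ring
        · rw [hs, add_zero] at h hle ⊢
          rw [le_antisymm hle h]
          exact left_mem_segment _ _ _
    have h4 := hmax _ hmem
    have h5 : σ * (1 - τ) = 0 := by linarith
    rw [hcoef, h5, add_zero]

/-- The number of edges that come closer to `b` than `x` is: every slide decreases it. -/
noncomputable def closerEdges (P : RectilinearPolygon) (b x : Plane) : ℕ := by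
  classical exact (Finset.univ.filter fun j => Metric.infDist b (P.edge j) < dist x b).card

lemma closerEdges_mono {b x y : Plane} (h : dist y b ≤ dist x b) :
    P.closerEdges b y ≤ P.closerEdges b x := by
  classical
  exact Finset.card_le_card fun j hj => by
    simp only [Finset.mem_filter, Finset.mem_univ, true_and] at hj ⊢
    exact hj.trans_le h

lemma SlideMove.closerEdges_lt {b x y : Plane} (h : P.SlideMove b x y) :
    P.closerEdges b y < P.closerEdges b x := by
  classical
  obtain ⟨-, i, hx, hy, hyx, hmin⟩ := h
  have hlt : dist y b < dist x b := by
    have h1 := inner_nonneg_of_nearest hy hmin hx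
    have h2 := dist_sq_plane y b
    have h3 := dist_sq_plane x b
    have h4 : 0 < dist x y ^ 2 := by
      have := dist_pos.2 hyx.symm
      positivity
    rw [dist_sq_plane] at h4
    refine lt_of_pow_lt_pow_left₀ 2 dist_nonneg ?_
    nlinarith
  have hinf : Metric.infDist b (P.edge i) = dist y b := by
    refine le_antisymm (dist_comm y b ▸ Metric.infDist_le_dist_of_mem hy) ?_
    exact (Metric.le_infDist ⟨y, hy⟩).2 fun {z} hz => dist_comm z b ▸ hmin z hz
  refine Finset.card_lt_card ⟨fun j hj => ?_, fun hsub => ?_⟩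
  · simp only [Finset.mem_filter, Finset.mem_univ, true_and] at hj ⊢
    exact hj.trans hlt
  · have : i ∈ Finset.univ.filter fun j => Metric.infDist b (P.edge j) < dist x b := by
      simp [hinf, hlt]
    have := hsub this
    simp [hinf] at this

/-- The points of the polygon in the reflex rectangle attract every object. -/
lemma mem_kernel_of_mem_reflexRectangle {b : Plane} (hb : b ∈ P.region)
    (hbR : b ∈ P.reflexRectangle) : b ∈ P.kernel := by
  -- a slide and the straight move that may follow it
  have main : ∀ n x, x ∈ P.region → P.Blocked b x → P.closerEdges b x ≤ n → P.Attracts b x := by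
    intro n
    induction n with
    | zero =>
      intro x hx hB hn
      rcases eq_or_ne x b with rfl | hxb
      · exact .refl
      obtain ⟨y, hy⟩ := exists_slideMove hb hbR hx hxb hB
      exact absurd (hy.closerEdges_lt.trans_le hn) (Nat.not_lt_zero _)
    | succ n ih =>
      intro x hx hB hn
      rcases eq_or_ne x b with rfl | hxb
      · exact .refl
      obtain ⟨y, hy⟩ := exists_slideMove hb hbR hx hxb hB
      have hlt := hy.closerEdges_lt
      have hyP : y ∈ P.region := by
        obtain ⟨-, i, -, h, -⟩ := hy
        exact P.trace_subset_region (P.edge_subset_trace i h)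
      by_cases hB' : P.Blocked b y
      · exact .head (Or.inr hy) (ih y hyP hB' (by omega))
      · obtain ⟨z, hz, hzB⟩ := exists_straightMove hB'
        have hzy : dist z b ≤ dist y b := by
          obtain ⟨τ, h0, h1, e⟩ := mem_segment_iff_lineMap.1 hz.1
          have : z - b = (1 - τ) • (y - b) := by rw [e]; apply plane_ext <;> simp <;> ring
          rw [dist_eq_norm, dist_eq_norm, this, norm_smul, Real.norm_of_nonneg (by linarith)]
          exact mul_le_of_le_one_left (norm_nonneg _) (by linarith)
        have := closerEdges_mono (P := P) hzy
        exact .head (Or.inr hy) (.head (Or.inl hz)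
          (ih z (hz.2.2.1 (right_mem_segment _ _ _)) hzB (by omega)))
  refine ⟨hb, fun x hx => ?_⟩
  by_cases hB : P.Blocked b x
  · exact main _ x hx hB le_rfl
  · obtain ⟨z, hz, hzB⟩ := exists_straightMove hB
    exact .head (Or.inl hz) (main _ z (hz.2.2.1 (right_mem_segment _ _ _)) hzB le_rfl)

variable (P) in
lemma kernel_eq : P.kernel = P.reflexRectangle ∩ P.region := by
  ext b
  exact ⟨fun h => ⟨fun i hi => mem_halfPlane_of_mem_kernel h hi, h.1⟩,
    fun h => mem_kernel_of_mem_reflexRectangle h.2 h.1⟩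

/-! ### The reflex rectangle -/

/-- The half-plane of an edge is given by one inequality for one coordinate. -/
lemma isAxisParallelRectangle_halfPlane : IsAxisParallelRectangle (P.halfPlane i) := by
  obtain ⟨η, hη⟩ := P.exists_isOrientation
  have key : ∀ p : Plane, P.frameSnd i p =
      (P.dir i 0 * (p 1 - P.vertex i 1) - P.dir i 1 * (p 0 - P.vertex i 0)) / P.sqLen i := by
    intro p
    have hL := (sqLen_pos (i := i)).ne'
    rw [eq_div_iff hL]
    have e := sub_frame (i := i) 0 p
    rw [frame_zero_zero] at e
    have e0 := congrFun (congrArg WithLp.ofLp e) 0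
    have e1 := congrFun (congrArg WithLp.ofLp e) 1
    simp [rot] at e0 e1
    rw [e0, e1]
    simp [sqLen]
    ring
  have hcont : ∀ a c : ℝ, IsClosed {t : ℝ | 0 ≤ a * (t - c)} := fun a c =>
    isClosed_le continuous_const (by fun_prop)
  have hconn : ∀ a c : ℝ, OrdConnected {t : ℝ | 0 ≤ a * (t - c)} := fun a c => by
    refine ⟨fun x hx y hy z hz => ?_⟩
    have hx : 0 ≤ a * (x - c) := hx
    have hy : 0 ≤ a * (y - c) := hy
    show 0 ≤ a * (z - c)
    rcases le_total 0 a with h | h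
    · nlinarith [mul_le_mul_of_nonneg_left hz.1 h]
    · nlinarith [mul_le_mul_of_nonpos_left hz.2 h]
  rcases P.dir_axis i with h | h
  · refine ⟨univ, {t | 0 ≤ η * P.dir i 0 / P.sqLen i * (t - P.vertex i 1)}, isClosed_univ,
      ordConnected_univ, hcont _ _, hconn _ _, ?_⟩
    ext p
    rw [hη.mem_halfPlane_iff, key, h]
    simp only [mem_univ, true_and, mem_ofPred_eq]
    rw [show η * P.dir i 0 / P.sqLen i * (p 1 - P.vertex i 1) = η * ((P.dir i 0 *
      (p 1 - P.vertex i 1) - 0 * (p 0 - P.vertex i 0)) / P.sqLen i) by ring]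
  · refine ⟨{t | 0 ≤ -η * P.dir i 1 / P.sqLen i * (t - P.vertex i 0)}, univ, hcont _ _, hconn _ _,
      isClosed_univ, ordConnected_univ, ?_⟩
    ext p
    rw [hη.mem_halfPlane_iff, key, h]
    simp only [mem_univ, and_true, mem_ofPred_eq]
    rw [show -η * P.dir i 1 / P.sqLen i * (p 0 - P.vertex i 0) = η * ((0 *
      (p 1 - P.vertex i 1) - P.dir i 1 * (p 0 - P.vertex i 0)) / P.sqLen i) by ring]

variable (P) in
lemma isAxisParallelRectangle_reflexRectangle : IsAxisParallelRectangle P.reflexRectangle := by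
  choose I J hI hI' hJ hJ' hIJ using fun i => isAxisParallelRectangle_halfPlane (P := P) (i := i)
  refine ⟨⋂ i, ⋂ (_ : P.IsReflexEdge i), I i, ⋂ i, ⋂ (_ : P.IsReflexEdge i), J i,
    isClosed_iInter fun i => isClosed_iInter fun _ => hI i,
    ordConnected_iInter fun i => ordConnected_iInter fun _ => hI' i,
    isClosed_iInter fun i => isClosed_iInter fun _ => hJ i,
    ordConnected_iInter fun i => ordConnected_iInter fun _ => hJ' i, ?_⟩
  ext p
  simp only [reflexRectangle, hIJ, mem_ofPred_eq, mem_iInter]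
  exact ⟨fun h => ⟨fun i hi => (h i hi).1, fun i hi => (h i hi).2⟩,
    fun h i hi => ⟨h.1 i hi, h.2 i hi⟩⟩

end RectilinearPolygon

/-! ### Clamping to a box -/

/-- The point of the box `∏ [lo k, hi k]` nearest to `z`. -/
noncomputable def clamp (lo hi z : Plane) : Plane :=
  WithLp.toLp 2 fun k => max (lo k) (min (hi k) (z k))

lemma clamp_apply (lo hi z : Plane) (k : Fin 2) :
    clamp lo hi z k = max (lo k) (min (hi k) (z k)) := rfl

lemma clamp_mem_uIcc {l h t a : ℝ} (h1 : l ≤ a) (h2 : a ≤ h) :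
    max l (min h t) ∈ uIcc t a := by
  rw [mem_uIcc]
  rcases le_total t a with ht | ht
  · left
    exact ⟨le_max_of_le_right (le_min (ht.trans h2) le_rfl),
      max_le h1 ((min_le_right _ _).trans ht)⟩
  · right
    exact ⟨le_max_of_le_right (le_min h2 ht), max_le (h1.trans ht) (min_le_right _ _)⟩

lemma clamp_eq_of_mem_uIcc {l h t q : ℝ} (hlh : l ≤ h) (hq : q ∈ uIcc t (max l (min h t))) :
    max l (min h q) = max l (min h t) := by
  rw [mem_uIcc] at hq
  rcases le_total t l with h1 | h1
  · rw [min_eq_right (h1.trans hlh), max_eq_left h1] at hq ⊢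
    have : q ≤ l := by rcases hq with h | h <;> linarith [h.1, h.2]
    exact max_eq_left ((min_le_right _ _).trans this)
  · rcases le_total t h with h2 | h2
    · rw [min_eq_right h2, max_eq_right h1] at hq ⊢
      have : q = t := by
        rcases hq with h | h <;> exact le_antisymm (by linarith [h.1, h.2]) (by linarith [h.1, h.2])
      rw [this, min_eq_right h2, max_eq_right h1]
    · rw [min_eq_left h2, max_eq_right hlh] at hq ⊢
      have : h ≤ q := by rcases hq with h | h <;> linarith [h.1, h.2]
      rw [min_eq_left this, max_eq_right hlh]

lemma clamp_of_mem {lo hi z : Plane} (h : ∀ k, lo k ≤ z k ∧ z k ≤ hi k) : clamp lo hi z = z := by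
  apply plane_ext <;> rw [clamp_apply, min_eq_right (h _).2, max_eq_right (h _).1]

lemma segment_subset_coordBox (x y : Plane) : segment ℝ x y ⊆ coordBox x y :=
  (convex_coordBox x y).segment_subset (left_mem_coordBox x y) (right_mem_coordBox x y)

lemma fin_two_cases (k : Fin 2) {Q : Fin 2 → Prop} (h : Q k) (h' : Q (1 - k)) (j : Fin 2) :
    Q j := by
  fin_cases k <;> fin_cases j <;> simp_all

lemma segment_eq_coordBox {x y : Plane} {k : Fin 2} (h : x k = y k) :
    segment ℝ x y = coordBox x y := by
  refine (segment_subset_coordBox x y).antisymm fun z hz => ?_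
  have hk : z k = x k := by
    have := hz k
    rw [← h, uIcc_self, mem_singleton_iff] at this
    exact this
  have hj := hz (1 - k)
  rw [← segment_eq_uIcc, segment_eq_image'] at hj
  obtain ⟨θ, ⟨h0, h1⟩, e⟩ := hj
  rw [segment_eq_image']
  refine ⟨θ, ⟨h0, h1⟩, ?_⟩
  refine PiLp.ext (fin_two_cases k ?_ ?_)
  · simp [hk, h]
  · simpa using e

lemma image_clamp_segment {lo hi x y : Plane} {k : Fin 2} (h : x k = y k) :
    clamp lo hi '' segment ℝ x y = segment ℝ (clamp lo hi x) (clamp lo hi y) := by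
  rw [segment_eq_coordBox h, segment_eq_coordBox (k := k) (by rw [clamp_apply, clamp_apply, h])]
  have hm : ∀ k, Monotone fun t : ℝ => max (lo k) (min (hi k) t) := fun k _ _ h =>
    max_le_max le_rfl (min_le_min le_rfl h)
  apply Subset.antisymm
  · rintro _ ⟨z, hz, rfl⟩ k
    exact (hm k).mapsTo_uIcc (hz k)
  · intro z hz
    have : ∀ k, ∃ t ∈ uIcc (x k) (y k), max (lo k) (min (hi k) t) = z k := fun k =>
      intermediate_value_uIcc (f := fun t : ℝ => max (lo k) (min (hi k) t)) (by fun_prop) (hz k)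
    choose f hf hfz using this
    refine ⟨WithLp.toLp 2 f, hf, ?_⟩
    apply plane_ext <;> exact hfz _

/-! ### Regions with horizontally convex complement -/

/-- A chain that traces the frontier of a horizontally convex compact set bounds this set: every
other point escapes along one of its two horizontal rays. -/
lemma chainRegion_eq_of_frontier {k : ℕ} {w : Fin k → Plane} {K : Set Plane} (hK : IsCompact K)
    (hc : ∀ p ∈ K, ∀ q ∈ K, p 1 = q 1 → segment ℝ p q ⊆ K) (hw : chainTrace w = frontier K) :
    chainRegion w = K := by
  unfold chainRegion
  rw [hw]
  ext x
  constructor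
  · rintro (h | ⟨hxF, hb⟩)
    · exact hK.isClosed.frontier_subset h
    · by_contra hxK
      have hray : ∃ σ : ℝ, (σ = 1 ∨ σ = -1) ∧
          ∀ s : ℝ, 0 ≤ s → x + (σ * s) • (!₂[1, 0] : Plane) ∉ K := by
        by_contra hno
        push Not at hno
        obtain ⟨s, hs, h1⟩ := hno 1 (Or.inl rfl)
        obtain ⟨t, ht, h2⟩ := hno (-1) (Or.inr rfl)
        apply hxK
        refine hc _ h1 _ h2 (by simp) ?_
        rw [segment_eq_coordBox (k := 1) (by simp)]
        rw [coordBox, mem_ofPred_eq, Fin.forall_fin_two]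
        constructor
        · rw [mem_uIcc]; right; constructor <;> simp <;> linarith
        · simp
      obtain ⟨σ, hσ, h⟩ := hray
      have hD : IsPreconnected ((fun s : ℝ => x + (σ * s) • (!₂[1, 0] : Plane)) '' Ici 0) :=
        isPreconnected_Ici.image _ (by fun_prop)
      have hsub : (fun s : ℝ => x + (σ * s) • (!₂[1, 0] : Plane)) '' Ici 0 ⊆
          connectedComponentIn (frontier K)ᶜ x := by
        refine hD.subset_connectedComponentIn ⟨0, self_mem_Ici, by simp⟩ ?_
        rintro _ ⟨s, hs, rfl⟩ hf
        exact h s hs (hK.isClosed.frontier_subset hf)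
      obtain ⟨M, hM⟩ := (Metric.isBounded_iff_subset_closedBall x).1 (hb.subset hsub)
      have := hM ⟨|M| + 1, mem_Ici.2 (by positivity), rfl⟩
      rw [mem_closedBall_iff_norm, add_sub_cancel_left, norm_smul] at this
      have hn : ‖(!₂[1, 0] : Plane)‖ = 1 := by simp [EuclideanSpace.norm_eq]
      rw [hn, mul_one, norm_mul, Real.norm_eq_abs, Real.norm_eq_abs,
        abs_of_nonneg (by positivity : 0 ≤ |M| + 1)] at this
      have hσ1 : |σ| = 1 := by rcases hσ with rfl | rfl <;> simp
      rw [hσ1, one_mul] at this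
      linarith [le_abs_self M]
  · intro hx
    by_cases hxF : x ∈ frontier K
    · exact Or.inl hxF
    · refine Or.inr ⟨hxF, hK.isBounded.subset ?_⟩
      have hxi : x ∈ interior K := by
        by_contra h
        exact hxF ⟨subset_closure hx, h⟩
      have := isPreconnected_connectedComponentIn (F := (frontier K)ᶜ) (x := x)
      have hsub := connectedComponentIn_subset (frontier K)ᶜ x
      have h2 : connectedComponentIn (frontier K)ᶜ x ⊆ interior K := by
        refine this.subset_left_of_subset_union isOpen_interior
          (hK.isClosed.isOpen_compl) (disjoint_compl_right.mono_left interior_subset) ?_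
          ⟨x, mem_connectedComponentIn hxF, hxi⟩
        intro z hz
        by_cases hzK : z ∈ K
        · left
          by_contra h
          exact hsub hz ⟨subset_closure hzK, h⟩
        · exact Or.inr hzK
      exact h2.trans interior_subset

lemma chainRegion_of_isEmpty {w : Fin 0 → Plane} : chainTrace w = ∅ ∧ chainRegion w = ∅ := by
  have h : chainTrace w = ∅ := by simp [chainTrace]
  refine ⟨h, chainRegion_eq_of_frontier isCompact_empty (by simp) (by simp [h])⟩

/-! ### The structure of the kernel -/

/-- The closed axis-parallel rectangle `∏ [lo k, hi k]`. -/
def box (lo hi : Plane) : Set Plane := {z | ∀ k, lo k ≤ z k ∧ z k ≤ hi k}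

lemma coordBox_subset_box {lo hi x y : Plane} (hx : x ∈ box lo hi) (hy : y ∈ box lo hi) :
    coordBox x y ⊆ box lo hi := fun _ hz k =>
  ordConnected_Icc.uIcc_subset (s := Icc (lo k) (hi k)) (hx k) (hy k) (hz k)

/-- The box `∏ [lo k, hi k]` is the bounding box of the nonempty set `K`. -/
def IsBoundingBox (K : Set Plane) (lo hi : Plane) : Prop :=
  ∀ k, (∃ a ∈ K, a k = lo k) ∧ (∃ a ∈ K, a k = hi k) ∧ ∀ z ∈ K, lo k ≤ z k ∧ z k ≤ hi k

namespace RectilinearPolygon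

variable {P : RectilinearPolygon}

/-- The kernel as the part of the polygon in a rectangle. -/
def KernelIsBox (P : RectilinearPolygon) (a b : Plane) : Prop := P.kernel = box a b ∩ P.region

lemma isCompact_kernel {a b : Plane} (h : P.KernelIsBox a b) : IsCompact P.kernel := by
  rw [KernelIsBox] at h
  rw [h, inter_comm]
  refine P.isCompact_region.inter_right ?_
  have : box a b = ⋂ k, {z : Plane | a k ≤ z k ∧ z k ≤ b k} := by ext; simp [box]
  rw [this]
  refine isClosed_iInter fun k => ?_
  have hk : Continuous fun z : Plane => z k := by fun_prop
  exact (isClosed_le continuous_const hk).inter (isClosed_le hk continuous_const)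

/-- Attraction paths are monotone in both coordinates. -/
lemma exists_monotone_path {b x : Plane} (hb : b ∈ P.kernel) (hx : x ∈ P.region) :
    ∃ T ⊆ P.region ∩ coordBox b x, IsPreconnected T ∧ x ∈ T ∧ b ∈ T :=
  (hb.2 x hx).polyJoined.exists_preconnected ⟨hx, right_mem_coordBox b x⟩

lemma exists_coord_eq {T : Set Plane} (hT : IsPreconnected T) {x y : Plane} (hx : x ∈ T)
    (hy : y ∈ T) {k : Fin 2} {t : ℝ} (ht : t ∈ uIcc (x k) (y k)) : ∃ z ∈ T, z k = t := by
  have := (hT.image (fun z : Plane => z k) (by fun_prop)).ordConnected.uIcc_subset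
    (mem_image_of_mem _ hx) (mem_image_of_mem _ hy) ht
  exact this

section Structure

variable {a b lo hi : Plane}

lemma exists_kernel_path (hK : P.KernelIsBox a b) {x y : Plane} (hx : x ∈ P.kernel)
    (hy : y ∈ P.kernel) :
    ∃ T ⊆ P.kernel ∩ coordBox x y, IsPreconnected T ∧ y ∈ T ∧ x ∈ T := by
  obtain ⟨T, hT, h⟩ := exists_monotone_path hx hy.1
  refine ⟨T, fun z hz => ⟨?_, (hT hz).2⟩, h⟩
  rw [KernelIsBox] at hK
  rw [hK] at hx hy ⊢
  exact ⟨coordBox_subset_box hx.1 hy.1 (hT hz).2, (hT hz).1⟩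

/-- The kernel is convex in the horizontal and in the vertical direction. -/
lemma kernel_segment_subset (hK : P.KernelIsBox a b) {x y : Plane}
    (hx : x ∈ P.kernel) (hy : y ∈ P.kernel) {k : Fin 2} (h : x k = y k) :
    segment ℝ x y ⊆ P.kernel := by
  obtain ⟨T, hT, hc, hyT, hxT⟩ := exists_kernel_path hK hx hy
  intro z hz
  have hz := segment_subset_coordBox x y hz
  obtain ⟨w, hw, hwz⟩ := exists_coord_eq hc hxT hyT (hz (1 - k))
  have : w = z := by
    refine PiLp.ext (fin_two_cases k ?_ hwz)
    have h1 := (hT hw).2 k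
    have h2 := hz k
    rw [h, uIcc_self, mem_singleton_iff] at h1 h2
    rw [h1, h2]
  exact this ▸ (hT hw).1

lemma lo_le_hi (hB : IsBoundingBox P.kernel lo hi) (k : Fin 2) : lo k ≤ hi k := by
  obtain ⟨-, ⟨p, hp, h⟩, h'⟩ := hB k
  exact h ▸ (h' p hp).1

lemma box_subset (hK : P.KernelIsBox a b) (hB : IsBoundingBox P.kernel lo hi) :
    box lo hi ⊆ box a b := by
  intro z hz k
  obtain ⟨⟨p, hp, h⟩, ⟨q, hq, h'⟩, -⟩ := hB k
  rw [KernelIsBox] at hK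
  rw [hK] at hp hq
  exact ⟨(hp.1 k).1.trans (h ▸ (hz k).1), (hz k).2.trans (h' ▸ (hq.1 k).2)⟩

lemma exists_kernel_coord (hK : P.KernelIsBox a b)
    (hB : IsBoundingBox P.kernel lo hi) {k : Fin 2} {t : ℝ} (h1 : lo k ≤ t) (h2 : t ≤ hi k) :
    ∃ p ∈ P.kernel, p k = t := by
  obtain ⟨⟨p, hp, h⟩, ⟨q, hq, h'⟩, -⟩ := hB k
  obtain ⟨T, hT, hc, hqT, hpT⟩ := exists_kernel_path hK hp hq
  obtain ⟨z, hz, e⟩ := exists_coord_eq hc hpT hqT (k := k) (t := t)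
    (by rw [h, h', mem_uIcc]; exact Or.inl ⟨h1, h2⟩)
  exact ⟨z, (hT hz).1, e⟩

lemma clamp_mem_box (hB : IsBoundingBox P.kernel lo hi) (z : Plane) :
    clamp lo hi z ∈ box lo hi := fun k => by
  rw [clamp_apply]
  exact ⟨le_max_left _ _, max_le (lo_le_hi hB k) (min_le_left _ _)⟩

/-- Clamping to the bounding box of the kernel maps the polygon to the kernel. -/
lemma clamp_mem_kernel (hK : P.KernelIsBox a b)
    (hB : IsBoundingBox P.kernel lo hi) {z : Plane} (hz : z ∈ P.region) :
    clamp lo hi z ∈ P.kernel := by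
  have hle := lo_le_hi hB
  -- a path to a kernel point with the clamped first coordinate crosses the clamped second one
  obtain ⟨p, hp, hp0⟩ := exists_kernel_coord hK hB (clamp_mem_box hB z 0).1
    (clamp_mem_box hB z 0).2
  obtain ⟨T, hT, hc, hzT, hpT⟩ := exists_monotone_path hp hz
  have hpb := (hB 1).2.2 p hp
  obtain ⟨q, hq, hq1⟩ := exists_coord_eq hc hzT hpT (k := 1) (t := clamp lo hi z 1)
    (clamp_mem_uIcc hpb.1 hpb.2)
  have hq0 : clamp lo hi q 0 = clamp lo hi z 0 := by
    refine clamp_eq_of_mem_uIcc (hle 0) ?_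
    have := (hT hq).2 0
    rw [hp0, uIcc_comm] at this
    exact this
  -- from there, a kernel point at the same height is reached horizontally
  obtain ⟨w, hw, hw1⟩ := exists_kernel_coord hK hB (clamp_mem_box hB z 1).1
    (clamp_mem_box hB z 1).2
  obtain ⟨U, hU, hUc, hqU, hwU⟩ := exists_monotone_path hw (hT hq).1
  have hwb := (hB 0).2.2 w hw
  obtain ⟨m, hm, hm0⟩ := exists_coord_eq hUc hqU hwU (k := 0) (t := clamp lo hi q 0)
    (clamp_mem_uIcc hwb.1 hwb.2)
  have hm1 : m 1 = clamp lo hi z 1 := by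
    have := (hU hm).2 1
    rw [hw1, hq1, uIcc_self, mem_singleton_iff] at this
    exact this
  have : m = clamp lo hi z := plane_ext (hm0.trans hq0) hm1
  have hbox := box_subset hK hB (clamp_mem_box hB z)
  rw [KernelIsBox] at hK
  rw [hK]
  exact ⟨hbox, this ▸ (hU hm).1⟩

/-- From a point of the polygon, the boundary is hit in every coordinate direction. -/
lemma exists_trace_beyond {x : Plane} (hx : x ∈ P.region) (k : Fin 2) {σ : ℝ}
    (hσ : σ = 1 ∨ σ = -1) : ∃ y ∈ P.trace, 0 ≤ σ * (y k - x k) ∧ y (1 - k) = x (1 - k) := by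
  obtain ⟨M, hM, hd⟩ := P.exists_farRegion_disjoint
  set g : ℝ → Plane := fun s => x + (σ * s) • EuclideanSpace.single k 1 with hg
  have hgc : Continuous g := by fun_prop
  have hgk : ∀ s, g s k = x k + σ * s := fun s => by simp [hg]
  have hgj : ∀ s, g s (1 - k) = x (1 - k) := fun s => by
    have : (1 - k : Fin 2) ≠ k := by fin_cases k <;> simp
    simp [hg, this]
  have hσσ : σ * σ = 1 := by rcases hσ with rfl | rfl <;> norm_num
  have hfar : g (M + |x k| + 1) ∉ P.region := by
    refine disjoint_left.1 hd ?_
    have : M < |g (M + |x k| + 1) k| := by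
      rw [hgk]
      rcases hσ with rfl | rfl
      · have := le_abs_self (x k + 1 * (M + |x k| + 1)); linarith [neg_abs_le (x k)]
      · have := neg_abs_le (x k + -1 * (M + |x k| + 1)); linarith [le_abs_self (x k)]
    fin_cases k
    · exact Or.inl this
    · exact Or.inr this
  have hpc : IsPreconnected (g '' Ici 0) := isPreconnected_Ici.image _ hgc.continuousOn
  by_contra hno
  push Not at hno
  have hdis : Disjoint (g '' Ici 0) P.trace := by
    rw [disjoint_left]
    rintro _ ⟨s, hs, rfl⟩ ht
    refine hno _ ht ?_ (hgj s)
    rw [hgk]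
    have hs : 0 ≤ s := hs
    have e : σ * (x k + σ * s - x k) = s := by linear_combination s * hσσ
    rwa [e]
  exact hfar (P.mem_region_of_preconnected hpc hdis (x := x)
    ⟨0, self_mem_Ici, by simp [hg]⟩ ⟨_, mem_Ici.2 (by positivity), rfl⟩ hx)

lemma notMem_interior_kernel (hB : IsBoundingBox P.kernel lo hi) {x : Plane} {k : Fin 2}
    (h : x k = lo k ∨ x k = hi k) :
    x ∉ interior P.kernel := by
  intro hx
  rw [mem_interior_iff_mem_nhds] at hx
  have hcont : ∀ σ : ℝ, ∀ᶠ s : ℝ in 𝓝[>] 0, x + (σ * s) • EuclideanSpace.single k 1 ∈ P.kernel := by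
    intro σ
    have : Continuous fun s : ℝ => x + (σ * s) • (EuclideanSpace.single k 1 : Plane) := by fun_prop
    have := (this.tendsto 0).mono_left (nhdsWithin_le_nhds (s := Ioi 0))
    simp only [mul_zero, zero_smul, add_zero] at this
    exact this hx
  rcases h with h | h
  · obtain ⟨s, hs, hs0⟩ := ((hcont (-1)).and self_mem_nhdsWithin).exists
    have := ((hB k).2.2 _ hs).1
    have hs0 : 0 < s := hs0
    simp at this
    linarith
  · obtain ⟨s, hs, hs0⟩ := ((hcont 1).and self_mem_nhdsWithin).exists
    have := ((hB k).2.2 _ hs).2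
    have hs0 : 0 < s := hs0
    simp at this
    linarith

/-- A boundary point of the kernel lies on the boundary of the polygon or on a side of the bounding
box; in the second case it is a clamped boundary point of the polygon from beyond this side. -/
lemma frontier_kernel (hK : P.KernelIsBox a b) (hB : IsBoundingBox P.kernel lo hi) :
    frontier P.kernel = clamp lo hi '' P.trace := by
  have hcl : IsClosed P.kernel := (isCompact_kernel hK).isClosed
  have hle := lo_le_hi hB
  apply Subset.antisymm
  · intro x hx
    have hxK := hcl.frontier_subset hx
    have hxb : ∀ k, lo k ≤ x k ∧ x k ≤ hi k := fun k => (hB k).2.2 x hxK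
    by_cases hxt : x ∈ P.trace
    · exact ⟨x, hxt, clamp_of_mem hxb⟩
    have hside : ∃ k, x k = lo k ∨ x k = hi k := by
      by_contra hno
      push Not at hno
      have hlt : ∀ k, lo k < x k ∧ x k < hi k := fun k =>
        ⟨lt_of_le_of_ne (hxb k).1 (hno k).1.symm, lt_of_le_of_ne (hxb k).2 (hno k).2⟩
      have hin : x ∈ interior P.kernel := by
        rw [mem_interior_iff_mem_nhds]
        have hP := mem_interior_iff_mem_nhds.1 (P.mem_interior_region hxt hxK.1)
        have hQ : ∀ k, ∀ᶠ z : Plane in 𝓝 x, lo k < z k ∧ z k < hi k := fun k => by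
          have : Continuous fun z : Plane => z k := by fun_prop
          exact (this.tendsto x).eventually (Ioo_mem_nhds (hlt k).1 (hlt k).2)
        filter_upwards [hP, hQ 0, hQ 1] with z hz h0 h1
        have hzb : z ∈ box lo hi := fun k => by
          fin_cases k
          · exact ⟨h0.1.le, h0.2.le⟩
          · exact ⟨h1.1.le, h1.2.le⟩
        have := box_subset hK hB hzb
        rw [KernelIsBox] at hK
        rw [hK]
        exact ⟨this, hz⟩
      exact hx.2 hin
    obtain ⟨k, hk⟩ := hside
    have hother : ∀ y : Plane, y (1 - k) = x (1 - k) → clamp lo hi y k = x k →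
        clamp lo hi y = x := by
      intro y h1 h2
      refine PiLp.ext (fin_two_cases k h2 ?_)
      rw [clamp_apply, h1, ← clamp_apply, clamp_of_mem hxb]
    rcases hk with hk | hk
    · obtain ⟨y, hy, h1, h2⟩ := exists_trace_beyond hxK.1 k (Or.inr rfl)
      refine ⟨y, hy, hother y h2 ?_⟩
      rw [clamp_apply, hk, max_eq_left ((min_le_right _ _).trans (by linarith))]
    · obtain ⟨y, hy, h1, h2⟩ := exists_trace_beyond hxK.1 k (Or.inl rfl)
      refine ⟨y, hy, hother y h2 ?_⟩
      rw [clamp_apply, hk, min_eq_left (by linarith), max_eq_right (hle k)]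
  · rintro _ ⟨x, hx, rfl⟩
    have hmem := clamp_mem_kernel hK hB (P.trace_subset_region hx)
    refine ⟨subset_closure hmem, ?_⟩
    by_cases hxb : ∀ k, lo k ≤ x k ∧ x k ≤ hi k
    · rw [clamp_of_mem hxb]
      intro h
      have := interior_mono (fun z hz => hz.1 : P.kernel ⊆ P.region) h
      rw [← P.frontier_region] at hx
      exact hx.2 this
    · push Not at hxb
      obtain ⟨k, hk⟩ := hxb
      refine notMem_interior_kernel hB (k := k) ?_
      rw [clamp_apply]
      rcases lt_or_ge (x k) (lo k) with h | h
      · exact Or.inl (max_eq_left ((min_le_right _ _).trans h.le))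
      · right
        rw [min_eq_left (hk h).le, max_eq_right (hle k)]

/-- The vertices of the polygon, clamped to the bounding box of the kernel, form a chain that
traces the boundary of the kernel and bounds the kernel. -/
theorem chain_clamp (hK : P.KernelIsBox a b) (hB : IsBoundingBox P.kernel lo hi) :
    chainTrace (fun i => clamp lo hi (P.vertex i)) = frontier P.kernel ∧
    chainRegion (fun i => clamp lo hi (P.vertex i)) = P.kernel := by
  have h : chainTrace (fun i => clamp lo hi (P.vertex i)) = frontier P.kernel := by
    rw [frontier_kernel hK hB, RectilinearPolygon.trace, chainTrace, chainTrace, image_iUnion]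
    refine iUnion_congr fun i => ?_
    have h : P.vertex i 1 = P.vertex (finRotate P.n i) 1 ∨
        P.vertex i 0 = P.vertex (finRotate P.n i) 0 :=
      (P.alternating i).imp (fun h => h.1) fun h => h.1
    rcases h with h | h
    · exact (image_clamp_segment h).symm
    · exact (image_clamp_segment h).symm
  exact ⟨h, chainRegion_eq_of_frontier (isCompact_kernel hK)
    (fun p hp q hq hpq => kernel_segment_subset hK hp hq hpq) h⟩

end Structure

/-- The bounding box of the kernel is already that of its points on the boundary of the polygon,
together with those of two opposite corners of the rectangle that lie in the polygon: a side of the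
rectangle that meets the polygon but not its boundary lies in the polygon. -/
lemma exists_coord_le_of_mem_kernel {a b : Plane} (hK : P.KernelIsBox a b) {S : Set Plane}
    (hS : P.trace ∩ box a b ⊆ S) (ha : a ∈ P.kernel → a ∈ S) (hb : b ∈ P.kernel → b ∈ S)
    {p : Plane} (hp : p ∈ P.kernel) (k : Fin 2) : (∃ s ∈ S, s k ≤ p k) ∧ ∃ s ∈ S, p k ≤ s k := by
  have hc := isCompact_kernel hK
  rw [KernelIsBox] at hK
  -- a side of the rectangle through a corner `c` that contains a kernel point
  have side : ∀ c ∈ box a b, (c ∈ P.kernel → c ∈ S) → ∀ q ∈ P.kernel, q k = c k →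
      ∃ s ∈ S, s k = c k := by
    intro c hcb hcS q hq hqk
    rw [hK] at hq
    have hL : segment ℝ q c ⊆ box a b :=
      (segment_subset_coordBox q c).trans (coordBox_subset_box hq.1 hcb)
    by_cases hd : Disjoint (segment ℝ q c) P.trace
    · refine ⟨c, hcS ?_, rfl⟩
      rw [hK]
      exact ⟨hcb, P.mem_region_of_preconnected (convex_segment q c).isPreconnected hd
        (left_mem_segment _ _ _) (right_mem_segment _ _ _) hq.2⟩
    · obtain ⟨z, hz, hzt⟩ := not_disjoint_iff.1 hd
      refine ⟨z, hS ⟨hzt, hL hz⟩, ?_⟩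
      have := segment_subset_coordBox q c hz k
      rwa [hqk, uIcc_self, mem_singleton_iff] at this
  have hcont : ContinuousOn (fun z : Plane => z k) P.kernel := by fun_prop
  have hpb : p ∈ box a b := by rw [hK] at hp; exact hp.1
  have hab : ∀ j, a j ≤ b j := fun j => (hpb j).1.trans (hpb j).2
  have move : ∀ q ∈ P.kernel, q ∉ P.trace → ∀ σ : ℝ,
      ∀ᶠ s : ℝ in 𝓝[>] 0, q + (σ * s) • EuclideanSpace.single k 1 ∈ P.region := by
    intro q hq hqt σ
    have : Continuous fun s : ℝ => q + (σ * s) • (EuclideanSpace.single k 1 : Plane) := by fun_prop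
    have := (this.tendsto 0).mono_left (nhdsWithin_le_nhds (s := Ioi 0))
    simp only [mul_zero, zero_smul, add_zero] at this
    exact this (mem_interior_iff_mem_nhds.1 (P.mem_interior_region hqt hq.1))
  have inBox : ∀ q ∈ box a b, ∀ t : ℝ, a k ≤ q k + t → q k + t ≤ b k →
      q + t • EuclideanSpace.single k 1 ∈ box a b := by
    intro q hq t h1 h2
    refine fin_two_cases k ?_ ?_
    · simpa using ⟨h1, h2⟩
    · have : (1 - k : Fin 2) ≠ k := by fin_cases k <;> simp
      simpa [this] using hq (1 - k)
  -- an extreme point of the kernel is on the boundary of the polygon or on a side of the rectangle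
  constructor
  · obtain ⟨q, hq, hmin⟩ := hc.exists_isMinOn ⟨p, hp⟩ hcont
    have hmin : ∀ z ∈ P.kernel, q k ≤ z k := fun z hz => hmin hz
    by_cases hqt : q ∈ P.trace
    · exact ⟨q, hS ⟨hqt, by rw [hK] at hq; exact hq.1⟩, hmin p hp⟩
    have hqb : q ∈ box a b := by rw [hK] at hq; exact hq.1
    have e : q k = a k := by
      by_contra hne
      have hlt := lt_of_le_of_ne (hqb k).1 (Ne.symm hne)
      have hsmall : ∀ᶠ s : ℝ in 𝓝[>] 0, s < q k - a k :=
        nhdsWithin_le_nhds (Iio_mem_nhds (by linarith))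
      obtain ⟨s, ⟨hs, hs1⟩, hs0⟩ :=
        (((move q hq hqt (-1)).and hsmall).and self_mem_nhdsWithin).exists
      have hs0 : 0 < s := hs0
      have := hmin _ (by
        rw [hK]
        exact ⟨inBox q hqb (-1 * s) (by linarith) (by linarith [(hqb k).2]), hs⟩)
      simp at this
      linarith
    obtain ⟨s, hs, hse⟩ := side a (fun j => ⟨le_rfl, hab j⟩) ha q hq e
    exact ⟨s, hs, by rw [hse, ← e]; exact hmin p hp⟩
  · obtain ⟨q, hq, hmax⟩ := hc.exists_isMaxOn ⟨p, hp⟩ hcont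
    have hmax : ∀ z ∈ P.kernel, z k ≤ q k := fun z hz => hmax hz
    by_cases hqt : q ∈ P.trace
    · exact ⟨q, hS ⟨hqt, by rw [hK] at hq; exact hq.1⟩, hmax p hp⟩
    have hqb : q ∈ box a b := by rw [hK] at hq; exact hq.1
    have e : q k = b k := by
      by_contra hne
      have hlt := lt_of_le_of_ne (hqb k).2 hne
      have hsmall : ∀ᶠ s : ℝ in 𝓝[>] 0, s < b k - q k :=
        nhdsWithin_le_nhds (Iio_mem_nhds (by linarith))
      obtain ⟨s, ⟨hs, hs1⟩, hs0⟩ :=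
        (((move q hq hqt 1).and hsmall).and self_mem_nhdsWithin).exists
      have hs0 : 0 < s := hs0
      have := hmax _ (by
        rw [hK]
        exact ⟨inBox q hqb (1 * s) (by linarith [(hqb k).1]) (by linarith), hs⟩)
      simp at this
      linarith
    obtain ⟨s, hs, hse⟩ := side b (fun j => ⟨hab j, le_rfl⟩) hb q hq e
    exact ⟨s, hs, by rw [hse, ← e]; exact hmax p hp⟩

end RectilinearPolygon

/-- The cross product of plane vectors. -/
def cross (u v : Plane) : ℝ := u 0 * v 1 - u 1 * v 0

namespace RectilinearPolygon

variable {P : RectilinearPolygon} {i j : Fin P.n} {η : ℝ}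

/-! ### Deciding membership and reflexivity by coordinates -/

/-- Next to an edge, also next to its endpoints, points off the boundary lie in the polygon if and
only if they are on the inner side. -/
lemma region_beside {ζ s t : ℝ} (hζ : ζ = 1 ∨ ζ = -1) (h0 : 0 ≤ s) (h1 : s ≤ 1) (ht : 0 < t)
    (htm : t < P.margin j) (hn : P.frame j s (ζ * t) ∉ P.trace) :
    P.frame j s (ζ * t) ∈ P.region ↔ P.SideInside j ζ := by
  have hm := margin_pos (i := j)
  have habs : |ζ * t| < P.margin j := by
    rcases hζ with rfl | rfl <;> rw [abs_lt] <;> constructor <;> linarith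
  rw [frame_mem_trace_iff (by linarith) (by linarith) habs] at hn
  push Not at hn
  rw [sideInside_iff hζ (s := 1 / 2) (t := t) (by norm_num) (by norm_num) ht htm]
  rcases h0.eq_or_lt with rfl | h0
  · have ha : P.startTurn j * ζ < 0 := by
      have := hn.2.1 rfl
      rw [← mul_assoc] at this
      exact neg_of_mul_neg_left this ht.le
    exact frameRect_region (collar_before_disjoint_trace hζ ha) (by linarith) (by norm_num) ht htm
      (by linarith) (by norm_num) ht htm
  rcases h1.eq_or_lt with rfl | h1
  · have ha : P.endTurn j * ζ < 0 := by
      have := hn.2.2 rfl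
      rw [← mul_assoc] at this
      exact neg_of_mul_neg_left this ht.le
    exact frameRect_region (collar_after_disjoint_trace hζ ha) (by linarith) (by linarith) ht htm
      (by norm_num) (by linarith) ht htm
  · exact frameRect_region (collar_disjoint_trace hζ) h0 h1 ht htm (by norm_num) (by norm_num) ht
      htm

/-- A vertical edge that the horizontal ray from `q` to the left meets. -/
def MeetsLeftRay (P : RectilinearPolygon) (q : Plane) (j : Fin P.n) : Prop :=
  P.vertex j 0 = P.vertex (P.next j) 0 ∧ P.vertex j 0 < q 0 ∧
    q 1 ∈ uIcc (P.vertex j 1) (P.vertex (P.next j) 1)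

lemma exists_meetsLeftRay {q z : Plane} (hq : q ∉ P.trace) (hz : z ∈ P.trace) (h1 : z 1 = q 1)
    (h0 : z 0 < q 0) : ∃ j, P.MeetsLeftRay q j ∧ z 0 ≤ P.vertex j 0 := by
  obtain ⟨i, hi⟩ := P.mem_trace.1 hz
  have hqi : q ∉ P.edge i := fun h => hq (P.edge_subset_trace i h)
  rw [edge_eq] at hi hqi
  rcases P.dir_axis i with h | h
  · have e : P.vertex i 1 = P.vertex (P.next i) 1 := by rw [dir_coord] at h; linarith
    rw [segment_eq_coordBox e] at hi hqi
    have hi0 := hi 0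
    have hi1 := hi 1
    rw [← e, uIcc_self, mem_singleton_iff, h1] at hi1
    have hqi0 : q 0 ∉ uIcc (P.vertex i 0) (P.vertex (P.next i) 0) := by
      intro h
      apply hqi
      rw [coordBox, mem_ofPred_eq, Fin.forall_fin_two]
      exact ⟨h, by rw [← e, uIcc_self, hi1]; rfl⟩
    rw [mem_uIcc] at hi0 hqi0
    push Not at hqi0
    rcases hi0 with ⟨h2, h3⟩ | ⟨h2, h3⟩
    · refine ⟨P.next i, ⟨?_, hqi0.1 (by linarith), ?_⟩, h3⟩
      · rcases P.dir_alternating i with h' | h'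
        · have := h'.2
          rw [dir_coord] at this
          linarith
        · exact absurd (plane_ext h'.1 h) dir_ne_zero
      · rw [hi1, e]
        exact left_mem_uIcc
    · refine ⟨P.prev i, ⟨?_, ?_, ?_⟩, ?_⟩
      · rcases P.dir_alternating (P.prev i) with h' | h'
        · rw [P.next_prev] at h'
          exact absurd (plane_ext h'.2 h) dir_ne_zero
        · have := h'.1
          rw [dir_coord] at this
          linarith
      all_goals
        have e0 : P.vertex (P.prev i) 0 = P.vertex i 0 := by
          rcases P.dir_alternating (P.prev i) with h' | h'
          · rw [P.next_prev] at h'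
            exact absurd (plane_ext h'.2 h) dir_ne_zero
          · have := h'.1
            rw [dir_coord, P.next_prev] at this
            linarith
      · rw [e0]
        exact hqi0.2 (by linarith)
      · rw [P.next_prev, hi1]
        exact right_mem_uIcc
      · rw [e0]
        exact h3
  · have e : P.vertex i 0 = P.vertex (P.next i) 0 := by rw [dir_coord] at h; linarith
    have hi := segment_subset_coordBox _ _ hi
    have hi0 := hi 0
    have hi1 := hi 1
    rw [← e, uIcc_self, mem_singleton_iff] at hi0
    exact ⟨i, ⟨e, by linarith, h1 ▸ hi1⟩, hi0.le⟩

lemma convex_horizontal (c : ℝ) : Convex ℝ {z : Plane | z 1 = c} :=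
  convex_hyperplane (f := fun z : Plane => z 1) ⟨fun _ _ => rfl, fun _ _ => rfl⟩ c

lemma convex_le (c : ℝ) : Convex ℝ {z : Plane | z 0 ≤ c} :=
  convex_halfSpace_le (f := fun z : Plane => z 0) ⟨fun _ _ => rfl, fun _ _ => rfl⟩ c

lemma notMem_region_of_leftRay {q : Plane} (hq : q ∉ P.trace) (h : ∀ j, ¬ P.MeetsLeftRay q j) :
    q ∉ P.region := by
  intro hqP
  obtain ⟨M, hM, hd⟩ := P.exists_farRegion_disjoint
  have hD := ((convex_horizontal (q 1)).inter (convex_le (q 0))).isPreconnected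
  have hdis : Disjoint ({z : Plane | z 1 = q 1} ∩ {z | z 0 ≤ q 0}) P.trace := by
    rw [disjoint_left]
    rintro z ⟨h1, h0⟩ hz
    have h1 : z 1 = q 1 := h1
    have h0 : z 0 ≤ q 0 := h0
    rcases h0.eq_or_lt with h0 | h0
    · exact hq (plane_ext h0 h1 ▸ hz)
    · obtain ⟨j, hj, -⟩ := exists_meetsLeftRay hq hz h1 h0
      exact h j hj
  refine disjoint_left.1 hd ?_ (P.mem_region_of_preconnected hD hdis (x := q)
    (y := !₂[-(M + |q 0| + 1), q 1]) ⟨rfl, le_refl (q 0)⟩ ⟨rfl, ?_⟩ hqP)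
  · left
    have : 0 ≤ M + |q 0| + 1 := by positivity
    simp only [Matrix.cons_val_zero, abs_neg]
    rw [abs_of_nonneg this]
    linarith [abs_nonneg (q 0)]
  · show -(M + |q 0| + 1) ≤ q 0
    linarith [neg_abs_le (q 0)]

lemma mem_region_iff_of_leftRay (hη : P.IsOrientation η) {q : Plane} (hq : q ∉ P.trace)
    (hj : P.MeetsLeftRay q j) (hmax : ∀ j', P.MeetsLeftRay q j' → P.vertex j' 0 ≤ P.vertex j 0) :
    q ∈ P.region ↔ 0 < η * (P.vertex j 1 - P.vertex (P.next j) 1) := by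
  have hm := margin_pos (i := j)
  obtain ⟨hj0, hjq, hj1⟩ := hj
  have hd0 : P.dir j 0 = 0 := by rw [dir_coord]; linarith
  have hd1 : P.dir j 1 ≠ 0 := fun h => dir_ne_zero (plane_ext hd0 h)
  -- the ray meets the edge at the local coordinate `s`
  obtain ⟨s, h0, h1, hs⟩ : ∃ s : ℝ, 0 ≤ s ∧ s ≤ 1 ∧ q 1 = P.vertex j 1 + s * P.dir j 1 := by
    rw [← segment_eq_uIcc, segment_eq_image'] at hj1
    obtain ⟨s, ⟨h0, h1⟩, e⟩ := hj1
    exact ⟨s, h0, h1, by rw [dir_coord, ← e]; simp⟩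
  -- `ζ` is the right side of the edge
  obtain ⟨ζ, hζ, hζd⟩ : ∃ ζ : ℝ, (ζ = 1 ∨ ζ = -1) ∧ 0 < -(ζ * P.dir j 1) := by
    rcases lt_or_gt_of_ne hd1 with h | h
    · exact ⟨1, Or.inl rfl, by linarith⟩
    · exact ⟨-1, Or.inr rfl, by linarith⟩
  obtain ⟨t, ht0, htm, htq⟩ : ∃ t : ℝ, 0 < t ∧ t < P.margin j ∧
      t * -(ζ * P.dir j 1) < q 0 - P.vertex j 0 := by
    obtain ⟨t, ht0, ht⟩ := exists_between
      (lt_min hm (div_pos (sub_pos.2 hjq) hζd))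
    exact ⟨t, ht0, ht.trans_le (min_le_left _ _),
      (lt_div_iff₀ hζd).1 (ht.trans_le (min_le_right _ _))⟩
  have hz0 : P.frame j s (ζ * t) 0 = P.vertex j 0 + t * -(ζ * P.dir j 1) := by
    simp [frame, rot, hd0]; ring
  have hz1 : P.frame j s (ζ * t) 1 = q 1 := by simp [frame, rot, hd0, hs]
  have hD := ((convex_horizontal (q 1)).inter
    ((convex_halfplane_gt 0 (P.vertex j 0)).inter (convex_le (q 0)))).isPreconnected
  have hdis : Disjoint ({z : Plane | z 1 = q 1} ∩ ({z | P.vertex j 0 < z 0} ∩ {z | z 0 ≤ q 0}))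
      P.trace := by
    rw [disjoint_left]
    rintro z ⟨h1, h2, h3⟩ hz
    have h1 : z 1 = q 1 := h1
    have h2 : P.vertex j 0 < z 0 := h2
    have h3 : z 0 ≤ q 0 := h3
    rcases h3.eq_or_lt with h3 | h3
    · exact hq (plane_ext h3 h1 ▸ hz)
    · obtain ⟨j', hj', h⟩ := exists_meetsLeftRay hq hz h1 h3
      linarith [hmax j' hj']
  have hzD : P.frame j s (ζ * t) ∈
      ({z : Plane | z 1 = q 1} ∩ ({z | P.vertex j 0 < z 0} ∩ {z | z 0 ≤ q 0})) := by
    refine ⟨hz1, ?_, ?_⟩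
    · show P.vertex j 0 < _
      rw [hz0]
      nlinarith
    · show _ ≤ q 0
      rw [hz0]
      linarith
  have hqD : q ∈ ({z : Plane | z 1 = q 1} ∩ ({z | P.vertex j 0 < z 0} ∩ {z | z 0 ≤ q 0})) :=
    ⟨rfl, hjq, le_refl (q 0)⟩
  have hiff : q ∈ P.region ↔ P.SideInside j ζ := by
    rw [← region_beside hζ h0 h1 ht0 htm (disjoint_left.1 hdis hzD)]
    exact ⟨P.mem_region_of_preconnected hD hdis hqD hzD,
      P.mem_region_of_preconnected hD hdis hzD hqD⟩
  have hdir : P.vertex j 1 - P.vertex (P.next j) 1 = -P.dir j 1 := by rw [dir_coord]; ring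
  have habs : |ζ * t| < P.margin j := by
    rcases hζ with rfl | rfl <;> rw [abs_lt] <;> constructor <;> linarith
  rw [hiff, sideInside_iff hζ (s := 1 / 2) (t := t) (by norm_num) (by norm_num) ht0 htm, hdir]
  constructor
  · intro h
    by_contra hneg
    refine hη.outside (by norm_num) (by norm_num) ?_ habs h
    rcases hη.1 with rfl | rfl <;> rcases hζ with rfl | rfl <;> linarith
  · intro h
    refine hη.inside (by norm_num) (by norm_num) ?_ habs
    rcases hη.1 with rfl | rfl <;> rcases hζ with rfl | rfl <;> linarith

lemma cross_dir_prev : cross (P.vertex i - P.vertex (P.prev i)) (P.dir i) =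
    P.startTurn i * P.sqLen i := by
  rw [vertex_prev]
  simp [cross, frame, rot, sqLen]
  ring

lemma cross_dir_next : cross (P.dir i) (P.vertex (P.next (P.next i)) - P.vertex (P.next i)) =
    P.endTurn i * P.sqLen i := by
  have : P.vertex (P.next (P.next i)) - P.vertex (P.next i) = P.dir (P.next i) := by
    apply plane_ext <;> simp [dir_coord]
  rw [this, dir_next]
  simp [cross, rot, sqLen]
  ring

lemma frameSnd_eq (p : Plane) : P.frameSnd i p * P.sqLen i = cross (P.dir i) (p - P.vertex i) := by
  have e := sub_frame (i := i) 0 p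
  rw [frame_zero_zero] at e
  rw [e]
  simp [cross, rot, sqLen]
  ring

lemma IsOrientation.isReflexEdge_iff (hη : P.IsOrientation η) : P.IsReflexEdge i ↔
    η * cross (P.vertex i - P.vertex (P.prev i)) (P.dir i) < 0 ∧
    η * cross (P.dir i) (P.vertex (P.next (P.next i)) - P.vertex (P.next i)) < 0 := by
  have hL := sqLen_pos (i := i)
  have key : ∀ x : ℝ, x * P.sqLen i < 0 ↔ x < 0 := fun x =>
    ⟨fun h => neg_of_mul_neg_left h hL.le, fun h => mul_neg_of_neg_of_pos h hL⟩
  rw [IsReflexEdge, hη.isReflexVertex_iff, hη.isReflexVertex_next_iff, cross_dir_prev,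
    cross_dir_next, ← mul_assoc, ← mul_assoc, key, key]

lemma IsOrientation.mem_halfPlane_iff_cross (hη : P.IsOrientation η) {p : Plane} :
    p ∈ P.halfPlane i ↔ 0 ≤ η * cross (P.dir i) (p - P.vertex i) := by
  have hL := sqLen_pos (i := i)
  rw [hη.mem_halfPlane_iff, ← frameSnd_eq, ← mul_assoc, mul_nonneg_iff_of_pos_right hL]

/-- The leftmost vertical edge tells the orientation. -/
lemma exists_isOrientation_of_leftmost (hi : P.vertex i 0 = P.vertex (P.next i) 0)
    (h : ∀ j, P.vertex j 0 = P.vertex (P.next j) 0 → P.vertex i 0 ≤ P.vertex j 0) :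
    ∃ η, P.IsOrientation η ∧ 0 < η * (P.vertex i 1 - P.vertex (P.next i) 1) := by
  have hleft : P.IsLeftmost i := by
    refine ⟨hi, fun k => ?_⟩
    rcases P.dir_alternating (P.prev k) with h' | h'
    · rw [P.next_prev] at h'
      exact h k (by have := h'.2; rw [dir_coord] at this; linarith)
    · have e := h'.1
      rw [dir_coord, P.next_prev] at e
      have := h (P.prev k) (by rw [P.next_prev]; linarith)
      linarith
  have hne : P.vertex i 1 - P.vertex (P.next i) 1 ≠ 0 := fun h =>
    P.edge_ne i (plane_ext hi (sub_eq_zero.1 h))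
  rcases lt_or_gt_of_ne hne with h | h
  · exact ⟨-1, hleft.isOrientation (Or.inr rfl) (by linarith), by linarith⟩
  · exact ⟨1, hleft.isOrientation (Or.inl rfl) (by linarith), by linarith⟩

end RectilinearPolygon

/-! ### Programs for the real RAM -/

/-- `c` halts when started in `s`, after at most `T` steps, in a state with the property `Q`. -/
def RAMRuns (c : RAMProgram) (s : RAMState) (T : ℕ) (Q : RAMState → Prop) : Prop :=
  ∃ t s', RAMExec c s t s' ∧ t ≤ T ∧ Q s'

namespace RAMRuns

lemma seq {c d : RAMProgram} {s : RAMState} {T T' : ℕ} {Q R : RAMState → Prop}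
    (hc : RAMRuns c s T Q) (hd : ∀ s', Q s' → RAMRuns d s' T' R) :
    RAMRuns (.seq c d) s (T + T') R := by
  obtain ⟨t, s', h, ht, hQ⟩ := hc
  obtain ⟨t', s'', h', ht', hR⟩ := hd s' hQ
  exact ⟨_, _, .seq h h', by omega, hR⟩

lemma mono {c : RAMProgram} {s : RAMState} {T T' : ℕ} {Q R : RAMState → Prop}
    (hc : RAMRuns c s T Q) (hT : T ≤ T') (hQ : ∀ s', Q s' → R s') : RAMRuns c s T' R := by
  obtain ⟨t, s', h, ht, h'⟩ := hc
  exact ⟨t, s', h, ht.trans hT, hQ s' h'⟩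

lemma instr (i : RAMInstr) (s : RAMState) {Q : RAMState → Prop} (h : Q (i.apply s)) :
    RAMRuns (.instr i) s 1 Q := ⟨1, _, .instr i s, le_rfl, h⟩

end RAMRuns

/-- A sequence of instructions as a program. -/
def RAMProgram.ofList : List RAMInstr → RAMProgram
  | [] => .skip
  | i :: l => .seq (.instr i) (.ofList l)

/-- The effect of a sequence of instructions. -/
noncomputable def applyList (l : List RAMInstr) (s : RAMState) : RAMState :=
  l.foldl (fun s i => i.apply s) s

lemma RAMRuns.ofList (l : List RAMInstr) (s : RAMState) {Q : RAMState → Prop}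
    (h : Q (applyList l s)) : RAMRuns (.ofList l) s (l.length + 1) Q := by
  induction l generalizing s with
  | nil => exact ⟨1, s, .skip s, by simp, h⟩
  | cons i l ih =>
    refine ((RAMRuns.instr i s (Q := fun s' => s' = i.apply s) rfl).seq
      (T' := l.length + 1) ?_).mono
      (le_of_eq (by rw [List.length_cons]; omega)) fun s' h => h
    rintro _ rfl
    exact ih _ h

/-! ### Programs that use only real registers -/

/-- The effect on the real registers of a program without memory access, index registers and
loops. -/
noncomputable def evalReg : RAMProgram → (ℕ → ℝ) → ℕ → ℝ
  | .instr (.rconst a q), ρ => Function.update ρ a (q : ℝ)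
  | .instr (.radd a b c), ρ => Function.update ρ a (ρ b + ρ c)
  | .instr (.rsub a b c), ρ => Function.update ρ a (ρ b - ρ c)
  | .instr (.rmul a b c), ρ => Function.update ρ a (ρ b * ρ c)
  | .seq c d, ρ => evalReg d (evalReg c ρ)
  | .ite (.rlt a b) c d, ρ => by classical exact if ρ a < ρ b then evalReg c ρ else evalReg d ρ
  | .ite (.req a b) c d, ρ => by classical exact if ρ a = ρ b then evalReg c ρ else evalReg d ρ
  | _, ρ => ρ

/-- The programs on which `evalReg` is meant to be used. -/
def isRegProgram : RAMProgram → Bool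
  | .skip => true
  | .instr (.rconst _ _) => true
  | .instr (.radd _ _ _) => true
  | .instr (.rsub _ _ _) => true
  | .instr (.rmul _ _ _) => true
  | .seq c d => isRegProgram c && isRegProgram d
  | .ite (.rlt _ _) c d => isRegProgram c && isRegProgram d
  | .ite (.req _ _) c d => isRegProgram c && isRegProgram d
  | _ => false

/-- A bound for the number of steps of a program without loops. -/
def stepBound : RAMProgram → ℕ
  | .seq c d => stepBound c + stepBound d
  | .ite _ c d => stepBound c + stepBound d + 1
  | _ => 1

/-- Whether a program without memory access and loops writes the real register `r`. -/
def writesReg (r : ℕ) : RAMProgram → Bool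
  | .instr (.rconst a _) => r == a
  | .instr (.radd a _ _) => r == a
  | .instr (.rsub a _ _) => r == a
  | .instr (.rmul a _ _) => r == a
  | .seq c d => writesReg r c || writesReg r d
  | .ite _ c d => writesReg r c || writesReg r d
  | _ => false

lemma runs_evalReg (c : RAMProgram) (hc : isRegProgram c = true) (s : RAMState) :
    RAMRuns c s (stepBound c) fun s' => s' = { s with reg := evalReg c s.reg } := by
  classical
  induction c generalizing s with
  | skip => exact ⟨1, s, .skip s, le_rfl, rfl⟩
  | instr i =>
    refine ⟨1, _, .instr i s, le_rfl, ?_⟩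
    cases i <;> simp_all [isRegProgram, evalReg, RAMInstr.apply]
  | seq c d ihc ihd =>
    simp only [isRegProgram, Bool.and_eq_true] at hc
    refine (ihc hc.1 s).seq fun s' h => ?_
    subst h
    exact ihd hc.2 _
  | ite b c d ihc ihd =>
    cases b with
    | ilt a b => simp [isRegProgram] at hc
    | ieq a b => simp [isRegProgram] at hc
    | rlt a b =>
      simp only [isRegProgram, Bool.and_eq_true] at hc
      by_cases h : s.reg a < s.reg b
      · obtain ⟨t, s', h1, h2, h3⟩ := ihc hc.1 s
        exact ⟨_, _, .ite_true h h1, by simp only [stepBound]; omega, by simp [h3, evalReg, h]⟩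
      · obtain ⟨t, s', h1, h2, h3⟩ := ihd hc.2 s
        exact ⟨_, _, .ite_false h h1, by simp only [stepBound]; omega, by simp [h3, evalReg, h]⟩
    | req a b =>
      simp only [isRegProgram, Bool.and_eq_true] at hc
      by_cases h : s.reg a = s.reg b
      · obtain ⟨t, s', h1, h2, h3⟩ := ihc hc.1 s
        exact ⟨_, _, .ite_true h h1, by simp only [stepBound]; omega, by simp [h3, evalReg, h]⟩
      · obtain ⟨t, s', h1, h2, h3⟩ := ihd hc.2 s
        exact ⟨_, _, .ite_false h h1, by simp only [stepBound]; omega, by simp [h3, evalReg, h]⟩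
  | loop b c => simp [isRegProgram] at hc

lemma evalReg_of_not_writes (c : RAMProgram) {r : ℕ} (hr : writesReg r c = false) (ρ : ℕ → ℝ) :
    evalReg c ρ r = ρ r := by
  classical
  induction c generalizing ρ with
  | skip => rfl
  | instr i =>
    cases i <;> simp_all [evalReg, writesReg]
  | seq c d ihc ihd =>
    simp only [writesReg, Bool.or_eq_false_iff] at hr
    rw [evalReg, ihd hr.2, ihc hr.1]
  | ite b c d ihc ihd =>
    simp only [writesReg, Bool.or_eq_false_iff] at hr
    cases b with
    | ilt a b => rfl
    | ieq a b => rfl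
    | rlt a b =>
      rw [evalReg]
      split_ifs
      exacts [ihc hr.1 ρ, ihd hr.2 ρ]
    | req a b =>
      rw [evalReg]
      split_ifs
      exacts [ihc hr.1 ρ, ihd hr.2 ρ]
  | loop b c => rfl

/-! ### Passes over the cyclic sequence of vertices -/

/-- The real registers `0, …, 7` are set to `data (2 * k), …, data (2 * k + 7)`. -/
def loadRegs (data : ℕ → ℝ) (k : ℕ) (ρ : ℕ → ℝ) : ℕ → ℝ :=
  fun r => if r < 8 then data (2 * k + r) else ρ r

/-- The real registers after `k` rounds of a pass with the given body. -/
noncomputable def passRegs (data : ℕ → ℝ) (body : RAMProgram) (ρ : ℕ → ℝ) : ℕ → ℕ → ℝ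
  | 0 => ρ
  | k + 1 => evalReg body (loadRegs data k (passRegs data body ρ k))

lemma passRegs_of_not_writes (data : ℕ → ℝ) (body : RAMProgram) (ρ : ℕ → ℝ) (k : ℕ) {r : ℕ}
    (h8 : 8 ≤ r) (hr : writesReg r body = false) : passRegs data body ρ k r = ρ r := by
  induction k with
  | zero => rfl
  | succ k ih =>
    rw [passRegs, evalReg_of_not_writes body hr, loadRegs, if_neg (by omega), ih]

/-- The instructions that load the registers `0, …, 7` and advance the pointer in the index
register `2` by two. -/
def loadWindow : List RAMInstr :=
  [.rload 0 2, .iadd 2 2 3, .rload 1 2, .iadd 2 2 3, .rload 2 2, .iadd 2 2 3, .rload 3 2,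
   .iadd 2 2 3, .rload 4 2, .iadd 2 2 3, .rload 5 2, .iadd 2 2 3, .rload 6 2, .iadd 2 2 3,
   .rload 7 2, .iadd 2 2 3, .isub 2 2 6]

/-- The instructions that append the registers `20` and `21` to the output. -/
def storePoint : List RAMInstr := [.rstore 5 20, .iadd 5 5 3, .rstore 5 21, .iadd 5 5 3]

/-- A pass: for `k = 0, …, n - 1`, the coordinates of the vertices `k, …, k + 3` are loaded, the
body is executed, and the registers `20` and `21` are written to the output area. -/
def RAMProgram.pass (body : RAMProgram) : RAMProgram :=
  .seq (.ofList [.iconst 2 0, .iadd 5 1 7])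
    (.loop (.ilt 2 4) (.seq (.ofList loadWindow) (.seq body (.ofList storePoint))))

/-- The index registers and the input area are set up for passes. -/
structure IsReady (n : ℕ) (data : ℕ → ℝ) (s : RAMState) : Prop where
  idx0 : s.idx 0 = n
  idx1 : s.idx 1 = 2 * n + 6
  idx3 : s.idx 3 = 1
  idx4 : s.idx 4 = 2 * n
  idx6 : s.idx 6 = 6
  idx7 : s.idx 7 = 0
  mem : ∀ m < 2 * n + 6, s.rmem m = data m

lemma runs_round {n : ℕ} {data : ℕ → ℝ} {body : RAMProgram} (hb : isRegProgram body = true) {k : ℕ}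
    (hk : k < n) {s : RAMState} (hs : IsReady n data s) (h2 : s.idx 2 = 2 * k)
    (h5 : s.idx 5 = 2 * n + 6 + 2 * k) :
    RAMRuns (.seq (.ofList loadWindow) (.seq body (.ofList storePoint))) s (stepBound body + 23)
      fun s' => IsReady n data s' ∧ s'.idx 2 = 2 * (k + 1) ∧ s'.idx 5 = 2 * n + 6 + 2 * (k + 1) ∧
        s'.reg = evalReg body (loadRegs data k s.reg) ∧
        (∀ m < 2 * n + 6 + 2 * k, s'.rmem m = s.rmem m) ∧
        s'.rmem (2 * n + 6 + 2 * k) = s'.reg 20 ∧ s'.rmem (2 * n + 6 + 2 * k + 1) = s'.reg 21 := by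
  have hload : RAMRuns (.ofList loadWindow) s 18 fun s' => s' =
      { s with idx := Function.update s.idx 2 (2 * (k + 1)), reg := loadRegs data k s.reg } := by
    refine RAMRuns.ofList loadWindow s ?_
    have hm : ∀ r < 8, s.rmem (2 * k + r) = data (2 * k + r) := fun r hr => hs.mem _ (by omega)
    simp only [applyList, loadWindow, List.foldl_cons, List.foldl_nil, RAMInstr.apply]
    congr 1
    · funext a
      by_cases ha : a = 2
      · subst ha
        simp [Function.update, h2, hs.idx3, hs.idx6]
        omega
      · simp [Function.update, ha]
    · funext r
      simp only [Function.update, loadRegs, h2, hs.idx3]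
      by_cases hr : r < 8
      · rw [if_pos hr]
        have := hm r hr
        interval_cases r <;> simpa [add_assoc] using this
      · rw [if_neg hr]
        simp [show r ≠ 0 by omega, show r ≠ 1 by omega, show r ≠ 2 by omega, show r ≠ 3 by omega,
          show r ≠ 4 by omega, show r ≠ 5 by omega, show r ≠ 6 by omega, show r ≠ 7 by omega]
  refine (hload.seq (T' := stepBound body + 5) ?_).mono (by omega) fun _ h => h
  rintro _ rfl
  refine (runs_evalReg body hb _).seq ?_
  rintro _ rfl
  refine RAMRuns.ofList storePoint _ ?_
  have h1 := hs.idx0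
  have h11 := hs.idx1
  have h3 := hs.idx3
  have h4 := hs.idx4
  have h6 := hs.idx6
  have h7 := hs.idx7
  have hmem : ∀ m, m ≠ 2 * n + 6 + 2 * k → m ≠ 2 * n + 6 + 2 * k + 1 → ∀ (v w : ℝ),
      Function.update (Function.update s.rmem (2 * n + 6 + 2 * k) v) (2 * n + 6 + 2 * k + 1) w m =
        s.rmem m := fun m h h' v w => by
    rw [Function.update_of_ne h', Function.update_of_ne h]
  simp only [applyList, storePoint, List.foldl_cons, List.foldl_nil, RAMInstr.apply]
  have e5 : Function.update s.idx 2 (2 * (k + 1)) 5 = 2 * n + 6 + 2 * k := by simp [h5]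
  have e3 : Function.update s.idx 2 (2 * (k + 1)) 3 = 1 := by simp [h3]
  have e3' : ∀ v : ℕ, Function.update (Function.update s.idx 2 (2 * (k + 1))) 5 v 3 = 1 :=
    fun v => by simp [h3]
  simp only [e5, e3, e3', Function.update_self]
  refine ⟨⟨?_, ?_, ?_, ?_, ?_, ?_, ?_⟩, ?_, ?_, ?_, ?_, ?_, ?_⟩
  · simpa [Function.update] using h1
  · simpa [Function.update] using h11
  · simpa [Function.update] using h3
  · simpa [Function.update] using h4
  · simpa [Function.update] using h6
  · simpa [Function.update] using h7
  · intro m hm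
    exact (hmem m (by omega) (by omega) _ _).trans (hs.mem m hm)
  · simp
  · omega
  · trivial
  · intro m hm
    exact hmem m (by omega) (by omega) _ _
  · rw [Function.update_of_ne (by omega), Function.update_self]
  · trivial

/-- The effect of a pass. -/
lemma runs_pass {n : ℕ} {data : ℕ → ℝ} {body : RAMProgram} (hb : isRegProgram body = true)
    {s : RAMState} (hs : IsReady n data s) :
    RAMRuns (.pass body) s ((stepBound body + 24) * n + 4) fun s' => IsReady n data s' ∧
      s'.reg = passRegs data body s.reg n ∧ ∀ j < n,
        s'.rmem (2 * n + 6 + 2 * j) = passRegs data body s.reg (j + 1) 20 ∧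
        s'.rmem (2 * n + 6 + 2 * j + 1) = passRegs data body s.reg (j + 1) 21 := by
  -- the rounds are run from the last one backwards
  have main : ∀ m k, k + m = n → ∀ s', IsReady n data s' → s'.idx 2 = 2 * k →
      s'.idx 5 = 2 * n + 6 + 2 * k → s'.reg = passRegs data body s.reg k →
      (∀ j < k, s'.rmem (2 * n + 6 + 2 * j) = passRegs data body s.reg (j + 1) 20 ∧
        s'.rmem (2 * n + 6 + 2 * j + 1) = passRegs data body s.reg (j + 1) 21) →
      RAMRuns (.loop (.ilt 2 4) (.seq (.ofList loadWindow) (.seq body (.ofList storePoint)))) s'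
        ((stepBound body + 24) * m + 1) fun s' => IsReady n data s' ∧
        s'.reg = passRegs data body s.reg n ∧ ∀ j < n,
        s'.rmem (2 * n + 6 + 2 * j) = passRegs data body s.reg (j + 1) 20 ∧
        s'.rmem (2 * n + 6 + 2 * j + 1) = passRegs data body s.reg (j + 1) 21 := by
    intro m
    induction m with
    | zero =>
      intro k hk s' h1 h2 h5 h6 h7
      obtain rfl : k = n := by omega
      refine ⟨1, s', .loop_false ?_, by omega, h1, h6, h7⟩
      simp only [RAMTest.Holds, h2, h1.idx4]
      omega
    | succ m ih =>
      intro k hk s' h1 h2 h5 h6 h7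
      obtain ⟨t, s₁, e, ht, g1, g2, g5, g6, g7, g8, g9⟩ :=
        runs_round hb (by omega : k < n) h1 h2 h5
      have hreg : s₁.reg = passRegs data body s.reg (k + 1) := by rw [g6, h6]; rfl
      obtain ⟨t', s₂, e', ht', hQ⟩ := ih (k + 1) (by omega) s₁ g1 g2 g5 hreg (by
        intro j hj
        rcases (Nat.lt_succ_iff_lt_or_eq.1 hj) with hj | rfl
        · rw [g7 _ (by omega), g7 _ (by omega)]
          exact h7 j hj
        · rw [g8, g9, hreg]
          exact ⟨rfl, rfl⟩)
      refine ⟨_, s₂, .loop_true ?_ e e', ?_, hQ⟩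
      · simp only [RAMTest.Holds, h2, h1.idx4]
        omega
      · rw [Nat.mul_succ]
        omega
  refine ((RAMRuns.ofList [.iconst 2 0, .iadd 5 1 7] s
    (Q := fun s' => IsReady n data s' ∧ s'.idx 2 = 0 ∧ s'.idx 5 = 2 * n + 6 ∧ s'.reg = s.reg)
    ?_).seq fun s' h => main n 0 (by omega) s' h.1 h.2.1 h.2.2.1 h.2.2.2 (by simp)).mono
    (by simp only [List.length_cons, List.length_nil]; omega) fun _ h => h
  obtain ⟨h0, h1, h3, h4, h6, h7, hm⟩ := hs
  refine ⟨⟨?_, ?_, ?_, ?_, ?_, ?_, hm⟩, ?_, ?_, rfl⟩ <;>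
    simp [applyList, RAMInstr.apply, Function.update, *]

/-! ### The program for the kernel -/

namespace RAMProgram

/-- Programs in sequence. -/
def block : List RAMProgram → RAMProgram
  | [] => .skip
  | c :: l => .seq c (block l)

/-- `c := d`; the register `9` always holds `0`. -/
def assign (c d : ℕ) : RAMProgram := .instr (.radd c d 9)

/-- `c := min c d`. -/
def minInto (c d : ℕ) : RAMProgram := .ite (.rlt d c) (assign c d) .skip

/-- `c := max c d`. -/
def maxInto (c d : ℕ) : RAMProgram := .ite (.rlt c d) (assign c d) .skip

/-- Update of the bounding box of the polygon in the registers `10, …, 13` (left, right, bottom,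
top) and of the leftmost vertical edge: its first coordinate is held in the register `15`, and the
difference of the second coordinates of its endpoints in the register `14`. -/
def boundsBody : RAMProgram := block
  [minInto 10 0, maxInto 11 0, minInto 12 1, maxInto 13 1,
   .ite (.req 0 2) (.ite (.rlt 0 15) (block [assign 15 0, .instr (.rsub 14 1 3)]) .skip) .skip]

/-- If the second edge of the window is reflex, the rectangle in the registers `10, …, 13` is cut
with its half-plane. -/
def reflexBody : RAMProgram := block
  [.instr (.rsub 16 4 2), .instr (.rsub 17 5 3), .instr (.rsub 18 2 0), .instr (.rsub 19 3 1),
   .instr (.rsub 24 6 4), .instr (.rsub 25 7 5),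
   .instr (.rmul 26 18 17), .instr (.rmul 27 19 16), .instr (.rsub 26 26 27),
   .instr (.rmul 26 14 26),
   .instr (.rmul 28 16 25), .instr (.rmul 27 17 24), .instr (.rsub 28 28 27),
   .instr (.rmul 28 14 28),
   .ite (.rlt 26 9) (.ite (.rlt 28 9) (block
     [.instr (.rmul 29 14 17), .ite (.rlt 9 29) (minInto 11 2) .skip,
      .ite (.rlt 29 9) (maxInto 10 2) .skip,
      .instr (.rmul 35 14 16), .ite (.rlt 9 35) (maxInto 12 3) .skip,
      .ite (.rlt 35 9) (minInto 13 3) .skip]) .skip) .skip]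

/-- The box in the registers `16, …, 19` (left, right, bottom, top) is cut with the rectangle, and
the result, unless empty, is added to the bounding box in the registers `30, …, 33`; the register
`34` is set to `1` as soon as something has been added. -/
def clipAdd : RAMProgram := block
  [maxInto 16 10, minInto 17 11, maxInto 18 12, minInto 19 13,
   .ite (.rlt 17 16) .skip (.ite (.rlt 19 18) .skip (block
     [minInto 30 16, maxInto 31 17, minInto 32 18, maxInto 33 19, .instr (.rconst 34 1)]))]

/-- The first edge of the window is added to the bounding box. -/
def edgeBody : RAMProgram := block
  [assign 16 0, minInto 16 2, assign 17 0, maxInto 17 2,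
   assign 18 1, minInto 18 3, assign 19 1, maxInto 19 3, clipAdd]

/-- Search for the nearest vertical edge to the left of the point in the registers `40` and `41`:
its first coordinate is held in the register `22`, and the difference of the second coordinates of
its endpoints in the register `23`. -/
def leftRayBody : RAMProgram := block
  [assign 16 1, minInto 16 3, assign 17 1, maxInto 17 3,
   .ite (.req 0 2) (.ite (.rlt 0 40) (.ite (.rlt 41 16) .skip (.ite (.rlt 17 41) .skip
     (.ite (.rlt 22 0) (block [assign 22 0, .instr (.rsub 23 1 3)]) .skip))) .skip) .skip]

/-- The point in the registers `40` and `41` is added to the bounding box if the nearest vertical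
edge to its left has it on its inner side. -/
def addCorner : RAMProgram := block
  [.instr (.rmul 24 14 23), .ite (.rlt 9 24) (block
    [assign 16 40, assign 17 40, assign 18 41, assign 19 41, clipAdd]) .skip]

/-- The first vertex of the window is clamped to the bounding box. -/
def clampBody : RAMProgram := block
  [assign 20 0, minInto 20 31, maxInto 20 30, assign 21 1, minInto 21 33, maxInto 21 32]

end RAMProgram

open RAMProgram

lemma evalReg_block_nil (ρ : ℕ → ℝ) : evalReg (block []) ρ = ρ := rfl

lemma evalReg_block_cons (c : RAMProgram) (l : List RAMProgram) (ρ : ℕ → ℝ) :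
    evalReg (block (c :: l)) ρ = evalReg (block l) (evalReg c ρ) := rfl

lemma evalReg_assign {ρ : ℕ → ℝ} (h : ρ 9 = 0) (c d : ℕ) :
    evalReg (assign c d) ρ = Function.update ρ c (ρ d) := by
  simp [assign, evalReg, h]

lemma evalReg_minInto {ρ : ℕ → ℝ} (h : ρ 9 = 0) (c d : ℕ) :
    evalReg (minInto c d) ρ = Function.update ρ c (min (ρ c) (ρ d)) := by
  rw [minInto, evalReg, evalReg_assign h]
  split_ifs with hlt
  · rw [min_eq_right hlt.le]
  · rw [min_eq_left (not_lt.1 hlt), Function.update_eq_self]; rfl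

lemma evalReg_maxInto {ρ : ℕ → ℝ} (h : ρ 9 = 0) (c d : ℕ) :
    evalReg (maxInto c d) ρ = Function.update ρ c (max (ρ c) (ρ d)) := by
  rw [maxInto, evalReg, evalReg_assign h]
  split_ifs with hlt
  · rw [max_eq_right hlt.le]
  · rw [max_eq_left (not_lt.1 hlt), Function.update_eq_self]; rfl

lemma evalReg_boundsBody {ρ : ℕ → ℝ} (h : ρ 9 = 0) :
    evalReg boundsBody ρ 10 = min (ρ 10) (ρ 0) ∧ evalReg boundsBody ρ 11 = max (ρ 11) (ρ 0) ∧
    evalReg boundsBody ρ 12 = min (ρ 12) (ρ 1) ∧ evalReg boundsBody ρ 13 = max (ρ 13) (ρ 1) ∧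
    evalReg boundsBody ρ 14 = (if ρ 0 = ρ 2 ∧ ρ 0 < ρ 15 then ρ 1 - ρ 3 else ρ 14) ∧
    evalReg boundsBody ρ 15 = (if ρ 0 = ρ 2 ∧ ρ 0 < ρ 15 then ρ 0 else ρ 15) := by
  by_cases h1 : ρ 0 = ρ 2 <;> by_cases h2 : ρ 2 < ρ 15 <;>
  simp [boundsBody, evalReg_block_cons, evalReg_block_nil, evalReg_minInto, evalReg_maxInto,
    evalReg_assign, evalReg, h, h1, h2, Function.update]

lemma evalReg_clampBody {ρ : ℕ → ℝ} (h : ρ 9 = 0) :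
    evalReg clampBody ρ 20 = max (ρ 30) (min (ρ 31) (ρ 0)) ∧
    evalReg clampBody ρ 21 = max (ρ 32) (min (ρ 33) (ρ 1)) := by
  simp [clampBody, evalReg_block_cons, evalReg_block_nil, evalReg_minInto, evalReg_maxInto,
    evalReg_assign, h, Function.update, max_comm, min_comm]

lemma evalReg_leftRayBody {ρ : ℕ → ℝ} (h : ρ 9 = 0) :
    (ρ 0 = ρ 2 ∧ ρ 0 < ρ 40 ∧ ρ 41 ∈ uIcc (ρ 1) (ρ 3) ∧ ρ 22 < ρ 0 →
      evalReg leftRayBody ρ 22 = ρ 0 ∧ evalReg leftRayBody ρ 23 = ρ 1 - ρ 3) ∧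
    (¬ (ρ 0 = ρ 2 ∧ ρ 0 < ρ 40 ∧ ρ 41 ∈ uIcc (ρ 1) (ρ 3) ∧ ρ 22 < ρ 0) →
      evalReg leftRayBody ρ 22 = ρ 22 ∧ evalReg leftRayBody ρ 23 = ρ 23) := by
  have e : evalReg leftRayBody ρ = evalReg
      (.ite (.req 0 2) (.ite (.rlt 0 40) (.ite (.rlt 41 16) .skip (.ite (.rlt 17 41) .skip
        (.ite (.rlt 22 0) (block [assign 22 0, .instr (.rsub 23 1 3)]) .skip))) .skip) .skip)
      (Function.update (Function.update ρ 16 (min (ρ 1) (ρ 3))) 17 (max (ρ 1) (ρ 3))) := by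
    simp [leftRayBody, evalReg_block_cons, evalReg_block_nil, evalReg_minInto, evalReg_maxInto,
      evalReg_assign, h, Function.update]
  set σ := Function.update (Function.update ρ 16 (min (ρ 1) (ρ 3))) 17 (max (ρ 1) (ρ 3)) with hσ
  have h16 : σ 16 = min (ρ 1) (ρ 3) := by simp [hσ]
  have h17 : σ 17 = max (ρ 1) (ρ 3) := by simp [hσ]
  have hr : ∀ r, r < 16 ∨ 17 < r → σ r = ρ r := fun r hr => by
    simp [hσ, Function.update, show r ≠ 16 by omega, show r ≠ 17 by omega]
  have h9 : σ 9 = 0 := (hr 9 (by norm_num)).trans h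
  rw [e, uIcc, mem_Icc, ← h16, ← h17, ← hr 0 (by norm_num), ← hr 1 (by norm_num),
    ← hr 2 (by norm_num), ← hr 3 (by norm_num), ← hr 22 (by norm_num), ← hr 23 (by norm_num),
    ← hr 40 (by norm_num), ← hr 41 (by norm_num)]
  clear_value σ
  constructor
  · rintro ⟨h1, h2, ⟨h3, h4⟩, h5⟩
    rw [evalReg, if_pos h1, evalReg, if_pos h2, evalReg, if_neg (not_lt.2 h3), evalReg,
      if_neg (not_lt.2 h4), evalReg, if_pos h5]
    simp [evalReg_block_cons, evalReg_block_nil, evalReg_assign, h9, evalReg]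
  · intro hn
    have hσσ : evalReg (.ite (.req 0 2) (.ite (.rlt 0 40) (.ite (.rlt 41 16) .skip
        (.ite (.rlt 17 41) .skip (.ite (.rlt 22 0) (block [assign 22 0, .instr (.rsub 23 1 3)])
          .skip))) .skip) .skip) σ = σ := by
      rw [evalReg]
      split_ifs with h1
      · rw [evalReg]
        split_ifs with h2
        · rw [evalReg]
          split_ifs with h3
          · rfl
          · rw [evalReg]
            split_ifs with h4
            · rfl
            · rw [evalReg, if_neg fun h5 => hn ⟨h1, h2, ⟨not_lt.1 h3, not_lt.1 h4⟩, h5⟩]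
              rfl
        · rfl
      · rfl
    rw [hσσ]
    exact ⟨rfl, rfl⟩

lemma evalReg_clipAdd {ρ : ℕ → ℝ} (h : ρ 9 = 0) :
    (¬ (min (ρ 17) (ρ 11) < max (ρ 16) (ρ 10) ∨ min (ρ 19) (ρ 13) < max (ρ 18) (ρ 12)) →
      evalReg clipAdd ρ 30 = min (ρ 30) (max (ρ 16) (ρ 10)) ∧
      evalReg clipAdd ρ 31 = max (ρ 31) (min (ρ 17) (ρ 11)) ∧
      evalReg clipAdd ρ 32 = min (ρ 32) (max (ρ 18) (ρ 12)) ∧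
      evalReg clipAdd ρ 33 = max (ρ 33) (min (ρ 19) (ρ 13)) ∧ evalReg clipAdd ρ 34 = 1) ∧
    (min (ρ 17) (ρ 11) < max (ρ 16) (ρ 10) ∨ min (ρ 19) (ρ 13) < max (ρ 18) (ρ 12) →
      ∀ r, 30 ≤ r → evalReg clipAdd ρ r = ρ r) := by
  have e : evalReg clipAdd ρ = evalReg
      (.ite (.rlt 17 16) .skip (.ite (.rlt 19 18) .skip (block
        [minInto 30 16, maxInto 31 17, minInto 32 18, maxInto 33 19, .instr (.rconst 34 1)])))
      (Function.update (Function.update (Function.update (Function.update ρ 16 (max (ρ 16) (ρ 10)))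
        17 (min (ρ 17) (ρ 11))) 18 (max (ρ 18) (ρ 12))) 19 (min (ρ 19) (ρ 13))) := by
    simp [clipAdd, evalReg_block_cons, evalReg_block_nil, evalReg_minInto, evalReg_maxInto,
      h, Function.update]
  set σ := Function.update (Function.update (Function.update (Function.update ρ 16
    (max (ρ 16) (ρ 10))) 17 (min (ρ 17) (ρ 11))) 18 (max (ρ 18) (ρ 12))) 19 (min (ρ 19) (ρ 13))
    with hσ
  have h16 : σ 16 = max (ρ 16) (ρ 10) := by simp [hσ]
  have h17 : σ 17 = min (ρ 17) (ρ 11) := by simp [hσ]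
  have h18 : σ 18 = max (ρ 18) (ρ 12) := by simp [hσ]
  have h19 : σ 19 = min (ρ 19) (ρ 13) := by simp [hσ]
  have hr : ∀ r, r < 16 ∨ 19 < r → σ r = ρ r := fun r hr => by
    simp [hσ, Function.update, show r ≠ 16 by omega, show r ≠ 17 by omega, show r ≠ 18 by omega,
      show r ≠ 19 by omega]
  have h9 : σ 9 = 0 := (hr 9 (by norm_num)).trans h
  rw [e, ← h16, ← h17, ← h18, ← h19, ← hr 30 (by norm_num), ← hr 31 (by norm_num),
    ← hr 32 (by norm_num), ← hr 33 (by norm_num)]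
  clear_value σ
  constructor
  · intro hn
    rw [not_or] at hn
    simp only [evalReg, hn.1, hn.2, if_false]
    simp [evalReg_block_cons, evalReg_block_nil, evalReg_minInto, evalReg_maxInto, h9, evalReg,
      Function.update]
  · intro hc r hr30
    rw [← hr r (by omega), evalReg]
    split_ifs with h1
    · rfl
    · rw [evalReg, if_pos (hc.resolve_left h1)]
      rfl

lemma evalReg_reflexBody {ρ : ℕ → ℝ} (h : ρ 9 = 0) {u v w : Plane}
    (hu : u = !₂[ρ 2 - ρ 0, ρ 3 - ρ 1]) (hv : v = !₂[ρ 4 - ρ 2, ρ 5 - ρ 3])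
    (hw : w = !₂[ρ 6 - ρ 4, ρ 7 - ρ 5]) :
    (ρ 14 * cross u v < 0 ∧ ρ 14 * cross v w < 0 →
      evalReg reflexBody ρ 10 = (if ρ 14 * v 1 < 0 then max (ρ 10) (ρ 2) else ρ 10) ∧
      evalReg reflexBody ρ 11 = (if 0 < ρ 14 * v 1 then min (ρ 11) (ρ 2) else ρ 11) ∧
      evalReg reflexBody ρ 12 = (if 0 < ρ 14 * v 0 then max (ρ 12) (ρ 3) else ρ 12) ∧
      evalReg reflexBody ρ 13 = (if ρ 14 * v 0 < 0 then min (ρ 13) (ρ 3) else ρ 13)) ∧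
    (¬ (ρ 14 * cross u v < 0 ∧ ρ 14 * cross v w < 0) →
      ∀ r, 10 ≤ r → r ≤ 13 → evalReg reflexBody ρ r = ρ r) := by
  set inner : RAMProgram := block
     [.instr (.rmul 29 14 17), .ite (.rlt 9 29) (minInto 11 2) .skip,
      .ite (.rlt 29 9) (maxInto 10 2) .skip,
      .instr (.rmul 35 14 16), .ite (.rlt 9 35) (maxInto 12 3) .skip,
      .ite (.rlt 35 9) (minInto 13 3) .skip] with hinner
  obtain ⟨σ, hσ, h14, h16, h17, h26, h28, hr⟩ : ∃ σ : ℕ → ℝ, evalReg reflexBody ρ =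
      evalReg (.ite (.rlt 26 9) (.ite (.rlt 28 9) inner .skip) .skip) σ ∧ σ 14 = ρ 14 ∧
      σ 16 = v 0 ∧ σ 17 = v 1 ∧ σ 26 = ρ 14 * cross u v ∧ σ 28 = ρ 14 * cross v w ∧
      ∀ r < 16, σ r = ρ r := by
    refine ⟨evalReg (block [.instr (.rsub 16 4 2), .instr (.rsub 17 5 3), .instr (.rsub 18 2 0),
      .instr (.rsub 19 3 1), .instr (.rsub 24 6 4), .instr (.rsub 25 7 5),
      .instr (.rmul 26 18 17), .instr (.rmul 27 19 16), .instr (.rsub 26 26 27),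
      .instr (.rmul 26 14 26), .instr (.rmul 28 16 25), .instr (.rmul 27 17 24),
      .instr (.rsub 28 28 27), .instr (.rmul 28 14 28)]) ρ, rfl, ?_, ?_, ?_, ?_, ?_, ?_⟩
    · simp [evalReg_block_cons, evalReg_block_nil, evalReg, Function.update]
    · simp [evalReg_block_cons, evalReg_block_nil, evalReg, Function.update, hv]
    · simp [evalReg_block_cons, evalReg_block_nil, evalReg, Function.update, hv]
    · simp [evalReg_block_cons, evalReg_block_nil, evalReg, Function.update, hu, hv, cross]
    · simp [evalReg_block_cons, evalReg_block_nil, evalReg, Function.update, hw, hv, cross]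
    · intro r hr
      refine evalReg_of_not_writes _ ?_ ρ
      interval_cases r <;> decide
  have h9 : σ 9 = 0 := (hr 9 (by norm_num)).trans h
  rw [hσ, ← h26, ← h28, ← h16, ← h17, ← h14]
  rw [evalReg]
  constructor
  · rintro ⟨h1, h2⟩
    rw [if_pos (by rwa [h9]), evalReg, if_pos (by rwa [h9])]
    rw [← hr 10 (by norm_num), ← hr 11 (by norm_num), ← hr 12 (by norm_num),
      ← hr 13 (by norm_num), ← hr 2 (by norm_num), ← hr 3 (by norm_num)]
    clear_value inner
    subst hinner
    rcases lt_trichotomy (σ 14 * σ 17) 0 with h3 | h3 | h3 <;>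
    rcases lt_trichotomy (σ 14 * σ 16) 0 with h4 | h4 | h4 <;>
    simp [evalReg_block_cons, evalReg_block_nil, evalReg, evalReg_minInto, evalReg_maxInto,
      Function.update, h9, h3, h4, not_lt.2 h3.le, not_lt.2 h4.le]
  · intro hn r h10 h13
    rw [← hr r (by omega)]
    split_ifs with h1
    · rw [evalReg, if_neg fun h2 => hn ⟨by rwa [h9] at h1, by rwa [h9] at h2⟩]
      rfl
    · rfl

/-! ### Correctness of the passes -/

/-- The registers `10, …, 13` hold the rectangle `box a b`. -/
def HoldsBox (a b : Plane) (ρ : ℕ → ℝ) : Prop :=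
  ρ 10 = a 0 ∧ ρ 11 = b 0 ∧ ρ 12 = a 1 ∧ ρ 13 = b 1

/-- The registers `30, …, 33` hold the bounding box of the subset `S` of `box a b`, and the register
`34` tells whether `S` is nonempty. Until something has been added, the registers hold the opposite
sides of `box a b`. -/
def HoldsBounds (S : Set Plane) (a b : Plane) (ρ : ℕ → ℝ) : Prop :=
  (∀ z ∈ S, ρ 30 ≤ z 0 ∧ z 0 ≤ ρ 31 ∧ ρ 32 ≤ z 1 ∧ z 1 ≤ ρ 33) ∧
  (ρ 30 = b 0 ∨ ∃ z ∈ S, z 0 = ρ 30) ∧ (ρ 31 = a 0 ∨ ∃ z ∈ S, z 0 = ρ 31) ∧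
  (ρ 32 = b 1 ∨ ∃ z ∈ S, z 1 = ρ 32) ∧ (ρ 33 = a 1 ∨ ∃ z ∈ S, z 1 = ρ 33) ∧
  (ρ 34 = 0 ∧ S = ∅ ∨ ρ 34 = 1 ∧ S.Nonempty)

lemma mem_box_iff {lo hi z : Plane} :
    z ∈ box lo hi ↔ (lo 0 ≤ z 0 ∧ z 0 ≤ hi 0) ∧ lo 1 ≤ z 1 ∧ z 1 ≤ hi 1 := Fin.forall_fin_two

lemma HoldsBounds.isBoundingBox {S : Set Plane} {a b : Plane} {ρ : ℕ → ℝ}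
    (h : HoldsBounds S a b ρ) (hS : S ⊆ box a b) (hne : S.Nonempty) :
    IsBoundingBox S !₂[ρ 30, ρ 32] !₂[ρ 31, ρ 33] := by
  obtain ⟨h1, h2, h3, h4, h5, -⟩ := h
  obtain ⟨w, hw⟩ := hne
  have hwb := mem_box_iff.1 (hS hw)
  have hw1 := h1 w hw
  intro k
  fin_cases k
  · refine ⟨?_, ?_, fun z hz => ⟨(h1 z hz).1, (h1 z hz).2.1⟩⟩
    · exact h2.elim (fun h => ⟨w, hw, le_antisymm (by simpa [h] using hwb.1.2) hw1.1⟩) fun h => h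
    · exact h3.elim (fun h => ⟨w, hw, le_antisymm hw1.2.1 (by simpa [h] using hwb.1.1)⟩) fun h => h
  · refine ⟨?_, ?_, fun z hz => ⟨(h1 z hz).2.2.1, (h1 z hz).2.2.2⟩⟩
    · exact h4.elim (fun h => ⟨w, hw, le_antisymm (by simpa [h] using hwb.2.2) hw1.2.2.1⟩)
        fun h => h
    · exact h5.elim (fun h => ⟨w, hw, le_antisymm hw1.2.2.2 (by simpa [h] using hwb.2.1)⟩)
        fun h => h

lemma HoldsBounds.congr {S : Set Plane} {a b : Plane} {ρ σ : ℕ → ℝ} (h : HoldsBounds S a b ρ)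
    (e : ∀ r, 30 ≤ r → r ≤ 34 → σ r = ρ r) : HoldsBounds S a b σ := by
  unfold HoldsBounds
  rw [e 30 (by norm_num) (by norm_num), e 31 (by norm_num) (by norm_num),
    e 32 (by norm_num) (by norm_num), e 33 (by norm_num) (by norm_num),
    e 34 (by norm_num) (by norm_num)]
  exact h

lemma HoldsBounds.clipAdd {S : Set Plane} {a b lo hi : Plane} {ρ : ℕ → ℝ}
    (h : HoldsBounds S a b ρ) (h9 : ρ 9 = 0) (hb : HoldsBox a b ρ) (h16 : ρ 16 = lo 0)
    (h17 : ρ 17 = hi 0) (h18 : ρ 18 = lo 1) (h19 : ρ 19 = hi 1) :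
    HoldsBounds (S ∪ (box lo hi ∩ box a b)) a b (evalReg clipAdd ρ) := by
  obtain ⟨hb10, hb11, hb12, hb13⟩ := hb
  obtain ⟨e1, e2⟩ := evalReg_clipAdd h9
  rw [h16, h17, h18, h19, hb10, hb11, hb12, hb13] at e1 e2
  have hmem : ∀ z, z ∈ box lo hi ∩ box a b ↔
      (max (lo 0) (a 0) ≤ z 0 ∧ z 0 ≤ min (hi 0) (b 0)) ∧
      max (lo 1) (a 1) ≤ z 1 ∧ z 1 ≤ min (hi 1) (b 1) := by
    intro z
    rw [mem_inter_iff, mem_box_iff, mem_box_iff, max_le_iff, max_le_iff, le_min_iff, le_min_iff]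
    tauto
  by_cases hc : min (hi 0) (b 0) < max (lo 0) (a 0) ∨ min (hi 1) (b 1) < max (lo 1) (a 1)
  · have hE : box lo hi ∩ box a b = ∅ := by
      rw [eq_empty_iff_forall_notMem]
      intro z hz
      rw [hmem] at hz
      rcases hc with hc | hc
      · linarith [hz.1.1, hz.1.2]
      · linarith [hz.2.1, hz.2.2]
    rw [hE, union_empty]
    exact h.congr fun r hr _ => e2 hc r hr
  · obtain ⟨f0, f1, f2, f3, f4⟩ := e1 hc
    rw [not_or, not_lt, not_lt] at hc
    obtain ⟨h1, h2, h3, h4, h5, h6⟩ := h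
    set l := max (lo 0) (a 0)
    set r := min (hi 0) (b 0)
    set l' := max (lo 1) (a 1)
    set r' := min (hi 1) (b 1)
    have hl : (!₂[l, l'] : Plane) ∈ box lo hi ∩ box a b :=
      (hmem _).2 ⟨⟨le_rfl, hc.1⟩, le_rfl, hc.2⟩
    have hr : (!₂[r, r'] : Plane) ∈ box lo hi ∩ box a b :=
      (hmem _).2 ⟨⟨hc.1, le_rfl⟩, hc.2, le_rfl⟩
    unfold HoldsBounds
    rw [f0, f1, f2, f3, f4]
    refine ⟨?_, ?_, ?_, ?_, ?_, Or.inr ⟨rfl, _, Or.inr hl⟩⟩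
    · rintro z (hz | hz)
      · obtain ⟨g1, g2, g3, g4⟩ := h1 z hz
        exact ⟨min_le_of_left_le g1, le_max_of_le_left g2, min_le_of_left_le g3,
          le_max_of_le_left g4⟩
      · obtain ⟨⟨g1, g2⟩, g3, g4⟩ := (hmem z).1 hz
        exact ⟨min_le_of_right_le g1, le_max_of_le_right g2, min_le_of_right_le g3,
          le_max_of_le_right g4⟩
    · rcases min_choice (ρ 30) l with h | h <;> rw [h]
      · exact h2.imp id fun ⟨z, hz, e⟩ => ⟨z, Or.inl hz, e⟩
      · exact Or.inr ⟨_, Or.inr hl, rfl⟩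
    · rcases max_choice (ρ 31) r with h | h <;> rw [h]
      · exact h3.imp id fun ⟨z, hz, e⟩ => ⟨z, Or.inl hz, e⟩
      · exact Or.inr ⟨_, Or.inr hr, rfl⟩
    · rcases min_choice (ρ 32) l' with h | h <;> rw [h]
      · exact h4.imp id fun ⟨z, hz, e⟩ => ⟨z, Or.inl hz, e⟩
      · exact Or.inr ⟨_, Or.inr hl, rfl⟩
    · rcases max_choice (ρ 33) r' with h | h <;> rw [h]
      · exact h5.imp id fun ⟨z, hz, e⟩ => ⟨z, Or.inl hz, e⟩
      · exact Or.inr ⟨_, Or.inr hr, rfl⟩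

namespace RectilinearPolygon

variable (P : RectilinearPolygon)

/-- The vertices, indexed cyclically by the natural numbers. -/
def cyclicVertex (k : ℕ) : Plane :=
  P.vertex ⟨k % P.n, Nat.mod_lt _ (by have := P.four_le; omega)⟩

/-- The coordinates of the vertices in their order, repeated cyclically. -/
def data (m : ℕ) : ℝ := P.cyclicVertex (m / 2) (if m % 2 = 0 then 0 else 1)

lemma cyclicVertex_val (i : Fin P.n) : P.cyclicVertex i = P.vertex i := by
  unfold cyclicVertex
  congr 1
  exact Fin.ext (Nat.mod_eq_of_lt i.2)

lemma cyclicVertex_val_succ (i : Fin P.n) (j : ℕ) :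
    P.cyclicVertex (i + j) = P.vertex (P.next^[j] i) := by
  unfold cyclicVertex
  congr 1
  exact Fin.ext (by rw [P.val_next_iterate])

lemma data_even (k : ℕ) : P.data (2 * k) = P.cyclicVertex k 0 := by
  simp [data]

lemma data_odd (k : ℕ) : P.data (2 * k + 1) = P.cyclicVertex k 1 := by
  have h1 : (2 * k + 1) / 2 = k := by omega
  have h2 : (2 * k + 1) % 2 = 1 := by omega
  simp [data, h1, h2]

/-- The registers `0, …, 7` hold the vertex `i` and the three vertices after it. -/
structure IsWindow (i : Fin P.n) (ρ : ℕ → ℝ) : Prop where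
  r0 : ρ 0 = P.vertex i 0
  r1 : ρ 1 = P.vertex i 1
  r2 : ρ 2 = P.vertex (P.next i) 0
  r3 : ρ 3 = P.vertex (P.next i) 1
  r4 : ρ 4 = P.vertex (P.next (P.next i)) 0
  r5 : ρ 5 = P.vertex (P.next (P.next i)) 1
  r6 : ρ 6 = P.vertex (P.next (P.next (P.next i))) 0
  r7 : ρ 7 = P.vertex (P.next (P.next (P.next i))) 1

lemma isWindow_loadRegs (i : Fin P.n) (ρ : ℕ → ℝ) : P.IsWindow i (loadRegs P.data i ρ) := by
  have h0 := P.cyclicVertex_val_succ i 0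
  have h1 := P.cyclicVertex_val_succ i 1
  have h2 := P.cyclicVertex_val_succ i 2
  have h3 := P.cyclicVertex_val_succ i 3
  simp only [Function.iterate_succ, Function.iterate_zero, Function.comp, id] at h0 h1 h2 h3
  have e0 : ∀ j, P.data (2 * (i : ℕ) + 2 * j) = P.cyclicVertex (i + j) 0 := fun j => by
    rw [← mul_add, data_even]
  have e1 : ∀ j, P.data (2 * (i : ℕ) + (2 * j + 1)) = P.cyclicVertex (i + j) 1 := fun j => by
    rw [← add_assoc, ← mul_add, data_odd]
  constructor
  · exact (e0 0).trans (by rw [h0])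
  · exact (e1 0).trans (by rw [h0])
  · exact (e0 1).trans (by rw [h1])
  · exact (e1 1).trans (by rw [h1])
  · exact (e0 2).trans (by rw [h2])
  · exact (e1 2).trans (by rw [h2])
  · exact (e0 3).trans (by rw [h3])
  · exact (e1 3).trans (by rw [h3])

lemma loadRegs_of_le (data : ℕ → ℝ) (k : ℕ) (ρ : ℕ → ℝ) {r : ℕ} (h : 8 ≤ r) :
    loadRegs data k ρ r = ρ r := if_neg (by omega)

lemma pass_induction {body : RAMProgram} {ρ : ℕ → ℝ} {I : ℕ → (ℕ → ℝ) → Prop} (h0 : I 0 ρ)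
    (hI : ∀ (i : Fin P.n) (σ : ℕ → ℝ), I i σ → I (i + 1) (evalReg body (loadRegs P.data i σ))) :
    I P.n (passRegs P.data body ρ P.n) := by
  have : ∀ k, k ≤ P.n → I k (passRegs P.data body ρ k) := by
    intro k
    induction k with
    | zero => exact fun _ => h0
    | succ k ih => exact fun hk => hI ⟨k, hk⟩ _ (ih (by omega))
  exact this _ le_rfl

lemma bounds_pass {ρ : ℕ → ℝ} (h9 : ρ 9 = 0) (h15 : ρ 15 = P.cyclicVertex 0 0 + 1) :
    (∀ j, passRegs P.data boundsBody ρ P.n 10 ≤ P.vertex j 0 ∧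
      P.vertex j 0 ≤ passRegs P.data boundsBody ρ P.n 11 ∧
      passRegs P.data boundsBody ρ P.n 12 ≤ P.vertex j 1 ∧
      P.vertex j 1 ≤ passRegs P.data boundsBody ρ P.n 13) ∧
    (∀ j, P.vertex j 0 = P.vertex (P.next j) 0 →
      passRegs P.data boundsBody ρ P.n 15 ≤ P.vertex j 0) ∧
    ∃ η, P.IsOrientation η ∧ 0 < η * passRegs P.data boundsBody ρ P.n 14 := by
  have key := P.pass_induction (body := boundsBody) (ρ := ρ) (I := fun k σ => σ 9 = 0 ∧
    (∀ j : Fin P.n, (j : ℕ) < k → σ 10 ≤ P.vertex j 0 ∧ P.vertex j 0 ≤ σ 11 ∧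
      σ 12 ≤ P.vertex j 1 ∧ P.vertex j 1 ≤ σ 13) ∧
    (∀ j : Fin P.n, (j : ℕ) < k → P.vertex j 0 = P.vertex (P.next j) 0 → σ 15 ≤ P.vertex j 0) ∧
    (σ 15 = P.cyclicVertex 0 0 + 1 ∨ ∃ j, P.vertex j 0 = P.vertex (P.next j) 0 ∧
      σ 15 = P.vertex j 0 ∧ σ 14 = P.vertex j 1 - P.vertex (P.next j) 1))
    ⟨h9, fun j hj => absurd hj (by omega), fun j hj => absurd hj (by omega), Or.inl h15⟩ ?_
  · obtain ⟨-, h1, h2, h3⟩ := key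
    refine ⟨fun j => h1 j j.2, fun j => h2 j j.2, ?_⟩
    have hlt : ¬ passRegs P.data boundsBody ρ P.n 15 = P.cyclicVertex 0 0 + 1 := by
      intro e
      have h0 : 0 < P.n := by have := P.four_le; omega
      have hv := P.cyclicVertex_val ⟨0, h0⟩
      simp only at hv
      set i : Fin P.n := ⟨0, h0⟩
      rcases P.dir_alternating (P.prev i) with h | h
      · have e1 := h.2
        rw [P.next_prev, dir_coord] at e1
        have := h2 i i.2 (by linarith)
        rw [e, hv] at this
        linarith
      · have e1 := h.1
        rw [dir_coord, P.next_prev] at e1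
        have := h2 (P.prev i) (P.prev i).2 (by rw [P.next_prev]; linarith)
        rw [e, hv] at this
        linarith
    obtain ⟨j, hj, e15, e14⟩ := h3.resolve_left hlt
    rw [e14]
    exact exists_isOrientation_of_leftmost hj fun j' hj' => e15 ▸ h2 j' j'.2 hj'
  · rintro i σ ⟨g9, g1, g2, g3⟩
    have w := P.isWindow_loadRegs i σ
    have l : ∀ r, 8 ≤ r → loadRegs P.data i σ r = σ r := fun r => loadRegs_of_le _ _ _
    have l9 := (l 9 (by norm_num)).trans g9
    obtain ⟨e10, e11, e12, e13, e14, e15⟩ := evalReg_boundsBody l9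
    rw [l 10 (by norm_num)] at e10
    rw [l 11 (by norm_num)] at e11
    rw [l 12 (by norm_num)] at e12
    rw [l 13 (by norm_num)] at e13
    rw [l 14 (by norm_num), l 15 (by norm_num)] at e14
    rw [l 15 (by norm_num)] at e15
    rw [w.r0] at e10 e11
    rw [w.r1] at e12 e13
    rw [w.r0, w.r1, w.r2, w.r3] at e14
    rw [w.r0, w.r2] at e15
    rw [e10, e11, e12, e13, e14, e15]
    refine ⟨(evalReg_of_not_writes _ (by decide) _).trans l9, ?_, ?_, ?_⟩
    · intro j hj
      rcases Nat.lt_succ_iff_lt_or_eq.1 hj with hj | hj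
      · obtain ⟨k1, k2, k3, k4⟩ := g1 j hj
        exact ⟨min_le_of_left_le k1, le_max_of_le_left k2, min_le_of_left_le k3,
          le_max_of_le_left k4⟩
      · obtain rfl := Fin.ext hj
        exact ⟨min_le_right _ _, le_max_right _ _, min_le_right _ _, le_max_right _ _⟩
    · intro j hj hjv
      rcases Nat.lt_succ_iff_lt_or_eq.1 hj with hj | hj
      · have := g2 j hj hjv
        split_ifs with hc
        · linarith [hc.2]
        · exact this
      · obtain rfl := Fin.ext hj
        split_ifs with hc
        · exact le_rfl
        · by_contra hlt
          exact hc ⟨hjv, not_le.1 hlt⟩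
    · split_ifs with hc
      · exact Or.inr ⟨i, hc.1, rfl, rfl⟩
      · exact g3

variable {P}

lemma mul_neg_iff_of_orientation {η τ x : ℝ} (hη : η * η = 1) (h : 0 < η * τ) :
    η * x < 0 ↔ τ * x < 0 := by
  have e : τ * x = η * τ * (η * x) := by linear_combination (-(τ * x)) * hη
  rw [e]
  exact ⟨fun h' => mul_neg_of_pos_of_neg h h', fun h' => neg_of_mul_neg_right h' h.le⟩

lemma mem_halfPlane_iff_of_orientation {η τ : ℝ} (hη : P.IsOrientation η) (h : 0 < η * τ)
    {i : Fin P.n} {p : Plane} : p ∈ P.halfPlane i ↔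
      (τ * P.dir i 1 < 0 → P.vertex i 0 ≤ p 0) ∧ (0 < τ * P.dir i 1 → p 0 ≤ P.vertex i 0) ∧
      (0 < τ * P.dir i 0 → P.vertex i 1 ≤ p 1) ∧ (τ * P.dir i 0 < 0 → p 1 ≤ P.vertex i 1) := by
  have hτ : τ ≠ 0 := by rintro rfl; simp at h
  rw [hη.mem_halfPlane_iff_cross, ← not_lt, mul_neg_iff_of_orientation hη.mul_self h, not_lt]
  have hne : P.dir i ≠ 0 := dir_ne_zero
  simp only [cross, PiLp.sub_apply]
  rcases P.dir_axis i with h1 | h1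
  · have h0 : P.dir i 0 ≠ 0 := fun h0 => hne (plane_ext h0 h1)
    rw [h1]
    have e : τ * (P.dir i 0 * (p 1 - P.vertex i 1) - 0 * (p 0 - P.vertex i 0)) =
        (τ * P.dir i 0) * (p 1 - P.vertex i 1) := by ring
    rw [e]
    rcases lt_or_gt_of_ne (mul_ne_zero hτ h0) with hs | hs
    · simp only [mul_zero, lt_irrefl, hs, not_lt.2 hs.le, false_imp_iff, true_and, true_imp_iff]
      constructor
      · intro h'; by_contra h''; nlinarith
      · intro h'; nlinarith
    · simp only [mul_zero, lt_irrefl, hs, not_lt.2 hs.le, false_imp_iff, true_and, and_true,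
        true_imp_iff]
      rw [mul_nonneg_iff_of_pos_left hs, sub_nonneg]
  · have h0 : P.dir i 1 ≠ 0 := fun h0 => hne (plane_ext h1 h0)
    rw [h1]
    have e : τ * (0 * (p 1 - P.vertex i 1) - P.dir i 1 * (p 0 - P.vertex i 0)) =
        (τ * P.dir i 1) * (P.vertex i 0 - p 0) := by ring
    rw [e]
    rcases lt_or_gt_of_ne (mul_ne_zero hτ h0) with hs | hs
    · simp only [mul_zero, lt_irrefl, hs, not_lt.2 hs.le, false_imp_iff, and_true, true_imp_iff]
      constructor
      · intro h'; by_contra h''; nlinarith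
      · intro h'; nlinarith
    · simp only [mul_zero, lt_irrefl, hs, not_lt.2 hs.le, false_imp_iff, true_and, and_true,
        true_imp_iff]
      rw [mul_nonneg_iff_of_pos_left hs, sub_nonneg]

lemma ite_max_le_iff {c : Prop} [Decidable c] {a x t : ℝ} :
    (if c then max a x else a) ≤ t ↔ a ≤ t ∧ (c → x ≤ t) := by
  split_ifs with h <;> simp [h]

lemma le_ite_min_iff {c : Prop} [Decidable c] {a x t : ℝ} :
    t ≤ (if c then min a x else a) ↔ t ≤ a ∧ (c → t ≤ x) := by
  split_ifs with h <;> simp [h]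

lemma reflex_pass {ρ : ℕ → ℝ} (h9 : ρ 9 = 0) {η : ℝ} (hη : P.IsOrientation η)
    (h14 : 0 < η * ρ 14) (p : Plane) :
    ((passRegs P.data reflexBody ρ P.n 10 ≤ p 0 ∧ p 0 ≤ passRegs P.data reflexBody ρ P.n 11) ∧
      passRegs P.data reflexBody ρ P.n 12 ≤ p 1 ∧ p 1 ≤ passRegs P.data reflexBody ρ P.n 13) ↔
    ((ρ 10 ≤ p 0 ∧ p 0 ≤ ρ 11) ∧ ρ 12 ≤ p 1 ∧ p 1 ≤ ρ 13) ∧ p ∈ P.reflexRectangle := by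
  have key := P.pass_induction (body := reflexBody) (ρ := ρ) (I := fun k σ => σ 9 = 0 ∧
    σ 14 = ρ 14 ∧ (((σ 10 ≤ p 0 ∧ p 0 ≤ σ 11) ∧ σ 12 ≤ p 1 ∧ p 1 ≤ σ 13) ↔
      ((ρ 10 ≤ p 0 ∧ p 0 ≤ ρ 11) ∧ ρ 12 ≤ p 1 ∧ p 1 ≤ ρ 13) ∧
      ∀ j : Fin P.n, (j : ℕ) < k → P.IsReflexEdge (P.next j) → p ∈ P.halfPlane (P.next j)))
    ⟨h9, rfl, by simp⟩ ?_
  · rw [key.2.2]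
    refine and_congr_right fun _ => ⟨fun h i hi => ?_, fun h j _ hj => h _ hj⟩
    have := h (P.prev i) (P.prev i).2
    rw [P.next_prev] at this
    exact this hi
  · rintro i σ ⟨g9, g14, g⟩
    have w := P.isWindow_loadRegs i σ
    have l : ∀ r, 8 ≤ r → loadRegs P.data i σ r = σ r := fun r => loadRegs_of_le _ _ _
    have l9 := (l 9 (by norm_num)).trans g9
    refine ⟨(evalReg_of_not_writes _ (by decide) _).trans l9,
      (evalReg_of_not_writes _ (by decide) _).trans ((l 14 (by norm_num)).trans g14), ?_⟩
    have hsplit : (∀ j : Fin P.n, (j : ℕ) < i + 1 → P.IsReflexEdge (P.next j) →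
        p ∈ P.halfPlane (P.next j)) ↔ (∀ j : Fin P.n, (j : ℕ) < i → P.IsReflexEdge (P.next j) →
        p ∈ P.halfPlane (P.next j)) ∧ (P.IsReflexEdge (P.next i) → p ∈ P.halfPlane (P.next i)) := by
      constructor
      · exact fun h => ⟨fun j hj => h j (by omega), h i (by omega)⟩
      · rintro ⟨h, h'⟩ j hj
        rcases Nat.lt_succ_iff_lt_or_eq.1 hj with hj | hj
        · exact h j hj
        · obtain rfl := Fin.ext hj
          exact h'
    rw [hsplit]
    refine Iff.trans ?_ and_assoc
    rw [← g]
    obtain ⟨e1, e2⟩ := evalReg_reflexBody l9 (u := P.dir i) (v := P.dir (P.next i))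
      (w := P.dir (P.next (P.next i)))
      (by rw [w.r0, w.r1, w.r2, w.r3]; apply plane_ext <;> simp [dir_coord])
      (by rw [w.r2, w.r3, w.r4, w.r5]; apply plane_ext <;> simp [dir_coord])
      (by rw [w.r4, w.r5, w.r6, w.r7]; apply plane_ext <;> simp [dir_coord])
    rw [l 10 (by norm_num), l 11 (by norm_num), l 12 (by norm_num), l 13 (by norm_num),
      l 14 (by norm_num), g14, w.r2, w.r3] at e1
    rw [l 14 (by norm_num), g14] at e2
    have hreflex : P.IsReflexEdge (P.next i) ↔ ρ 14 * cross (P.dir i) (P.dir (P.next i)) < 0 ∧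
        ρ 14 * cross (P.dir (P.next i)) (P.dir (P.next (P.next i))) < 0 := by
      rw [hη.isReflexEdge_iff, P.prev_next, mul_neg_iff_of_orientation hη.mul_self h14,
        mul_neg_iff_of_orientation hη.mul_self h14]
      rfl
    by_cases hc : P.IsReflexEdge (P.next i)
    · obtain ⟨f0, f1, f2, f3⟩ := e1 (hreflex.1 hc)
      rw [f0, f1, f2, f3, mem_halfPlane_iff_of_orientation hη h14]
      simp only [hc, true_imp_iff, ite_max_le_iff, le_ite_min_iff]
      tauto
    · have f := e2 (fun h => hc (hreflex.2 h))
      rw [f 10 (by norm_num) (by norm_num), f 11 (by norm_num) (by norm_num),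
        f 12 (by norm_num) (by norm_num), f 13 (by norm_num) (by norm_num),
        l 10 (by norm_num), l 11 (by norm_num), l 12 (by norm_num), l 13 (by norm_num)]
      simp [hc]

end RectilinearPolygon

namespace RectilinearPolygon

variable {P : RectilinearPolygon}

/-! ### The bounding box of the kernel -/

lemma edge_pass {ρ : ℕ → ℝ} (h9 : ρ 9 = 0) {a b : Plane} (hb : HoldsBox a b ρ)
    (h : HoldsBounds ∅ a b ρ) :
    HoldsBounds (P.trace ∩ box a b) a b (passRegs P.data edgeBody ρ P.n) := by
  have key := P.pass_induction (body := edgeBody) (ρ := ρ) (I := fun k σ => σ 9 = 0 ∧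
    HoldsBox a b σ ∧ HoldsBounds ((⋃ (j : Fin P.n) (_ : (j : ℕ) < k), P.edge j) ∩ box a b) a b σ)
    ⟨h9, hb, by simpa using h⟩ ?_
  · have e : (⋃ (j : Fin P.n) (_ : (j : ℕ) < P.n), P.edge j) = P.trace := by
      ext z
      simp [mem_trace]
    rw [e] at key
    exact key.2.2
  · rintro i σ ⟨g9, ⟨g10, g11, g12, g13⟩, g⟩
    have w := P.isWindow_loadRegs i σ
    have l : ∀ r, 8 ≤ r → loadRegs P.data i σ r = σ r := fun r => loadRegs_of_le _ _ _
    have l9 := (l 9 (by norm_num)).trans g9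
    have keep : ∀ r, 8 ≤ r → writesReg r edgeBody = false →
        evalReg edgeBody (loadRegs P.data i σ) r = σ r := fun r hr h =>
      (evalReg_of_not_writes _ h _).trans (l r hr)
    refine ⟨(keep 9 (by norm_num) (by decide)).trans g9,
      ⟨(keep 10 (by norm_num) (by decide)).trans g10, (keep 11 (by norm_num) (by decide)).trans g11,
       (keep 12 (by norm_num) (by decide)).trans g12,
       (keep 13 (by norm_num) (by decide)).trans g13⟩, ?_⟩
    -- the box that is added is the edge
    set lo : Plane := WithLp.toLp 2 fun k => min (P.vertex i k) (P.vertex (P.next i) k) with hlo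
    set hi : Plane := WithLp.toLp 2 fun k => max (P.vertex i k) (P.vertex (P.next i) k) with hhi
    have hedge : P.edge i = box lo hi := by
      have hbox : box lo hi = coordBox (P.vertex i) (P.vertex (P.next i)) := rfl
      rw [hbox, edge_eq]
      rcases P.dir_axis i with h | h <;> rw [dir_coord] at h
      · exact segment_eq_coordBox (k := 1) (by linarith)
      · exact segment_eq_coordBox (k := 0) (by linarith)
    have hsplit : (⋃ (j : Fin P.n) (_ : (j : ℕ) < i + 1), P.edge j) ∩ box a b =
        (⋃ (j : Fin P.n) (_ : (j : ℕ) < i), P.edge j) ∩ box a b ∪ (box lo hi ∩ box a b) := by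
      rw [← union_inter_distrib_right, ← hedge]
      congr 1
      ext z
      simp only [mem_iUnion, mem_union, exists_prop]
      constructor
      · rintro ⟨j, hj, hz⟩
        rcases Nat.lt_succ_iff_lt_or_eq.1 hj with hj | hj
        · exact Or.inl ⟨j, hj, hz⟩
        · obtain rfl := Fin.ext hj
          exact Or.inr hz
      · rintro (⟨j, hj, hz⟩ | hz)
        · exact ⟨j, by omega, hz⟩
        · exact ⟨i, by omega, hz⟩
    rw [hsplit]
    set σ' := loadRegs P.data i σ
    obtain ⟨τ, hτ, f16, f17, f18, f19, fr⟩ : ∃ τ : ℕ → ℝ, evalReg edgeBody σ' =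
        evalReg clipAdd τ ∧ τ 16 = min (σ' 0) (σ' 2) ∧ τ 17 = max (σ' 0) (σ' 2) ∧
        τ 18 = min (σ' 1) (σ' 3) ∧ τ 19 = max (σ' 1) (σ' 3) ∧
        ∀ r, r < 16 ∨ 19 < r → τ r = σ' r := by
      refine ⟨Function.update (Function.update (Function.update (Function.update σ' 16
        (min (σ' 0) (σ' 2))) 17 (max (σ' 0) (σ' 2))) 18 (min (σ' 1) (σ' 3))) 19
        (max (σ' 1) (σ' 3)), ?_, by simp, by simp, by simp, by simp, ?_⟩
      · simp [edgeBody, evalReg_block_cons, evalReg_block_nil, evalReg_minInto, evalReg_maxInto,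
          evalReg_assign, l9, Function.update]
      · intro r hr
        simp [Function.update, show r ≠ 16 by omega, show r ≠ 17 by omega, show r ≠ 18 by omega,
          show r ≠ 19 by omega]
    rw [hτ]
    refine HoldsBounds.clipAdd (g.congr fun r h1 h2 => ?_) ?_ ⟨?_, ?_, ?_, ?_⟩ ?_ ?_ ?_ ?_
    · rw [fr r (by omega), l r (by omega)]
    · rw [fr 9 (by norm_num), l9]
    · rw [fr 10 (by norm_num), l 10 (by norm_num), g10]
    · rw [fr 11 (by norm_num), l 11 (by norm_num), g11]
    · rw [fr 12 (by norm_num), l 12 (by norm_num), g12]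
    · rw [fr 13 (by norm_num), l 13 (by norm_num), g13]
    · rw [f16, w.r0, w.r2]
    · rw [f17, w.r0, w.r2]
    · rw [f18, w.r1, w.r3]
    · rw [f19, w.r1, w.r3]

lemma leftRay_pass {ρ : ℕ → ℝ} (h9 : ρ 9 = 0) {q : Plane} (h40 : ρ 40 = q 0) (h41 : ρ 41 = q 1)
    (h22 : ∀ j, P.vertex j 0 = P.vertex (P.next j) 0 → ρ 22 < P.vertex j 0) (h23 : ρ 23 = 0)
    {η : ℝ} (hη : P.IsOrientation η) (h14 : 0 < η * ρ 14) (hq : q ∉ P.trace) :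
    q ∈ P.region ↔ 0 < ρ 14 * passRegs P.data leftRayBody ρ P.n 23 := by
  have key := P.pass_induction (body := leftRayBody) (ρ := ρ) (I := fun k σ => σ 9 = 0 ∧
    σ 40 = q 0 ∧ σ 41 = q 1 ∧
    (∀ j : Fin P.n, (j : ℕ) < k → P.MeetsLeftRay q j → P.vertex j 0 ≤ σ 22) ∧
    (σ 22 = ρ 22 ∧ σ 23 = 0 ∨ ∃ j, P.MeetsLeftRay q j ∧ σ 22 = P.vertex j 0 ∧
      σ 23 = P.vertex j 1 - P.vertex (P.next j) 1))
    ⟨h9, h40, h41, fun j hj => absurd hj (by omega), Or.inl ⟨rfl, h23⟩⟩ ?_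
  · obtain ⟨-, -, -, h1, h2⟩ := key
    rcases h2 with ⟨h2, h3⟩ | ⟨j, hj, h2, h3⟩
    · rw [h3, mul_zero]
      refine iff_of_false (notMem_region_of_leftRay hq fun j hj => ?_) (lt_irrefl 0)
      have := h1 j j.2 hj
      rw [h2] at this
      exact absurd (h22 j hj.1) (not_lt.2 this)
    · rw [mem_region_iff_of_leftRay hη hq hj fun j' hj' => h2 ▸ h1 j' j'.2 hj', h3,
        ← neg_lt_zero, ← mul_neg, mul_neg_iff_of_orientation hη.mul_self h14, mul_neg,
        neg_lt_zero]
  · rintro i σ ⟨g9, g40, g41, g1, g2⟩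
    have w := P.isWindow_loadRegs i σ
    have l : ∀ r, 8 ≤ r → loadRegs P.data i σ r = σ r := fun r => loadRegs_of_le _ _ _
    have l9 := (l 9 (by norm_num)).trans g9
    have keep : ∀ r, 8 ≤ r → writesReg r leftRayBody = false →
        evalReg leftRayBody (loadRegs P.data i σ) r = σ r := fun r hr h =>
      (evalReg_of_not_writes _ h _).trans (l r hr)
    refine ⟨(keep 9 (by norm_num) (by decide)).trans g9,
      (keep 40 (by norm_num) (by decide)).trans g40,
      (keep 41 (by norm_num) (by decide)).trans g41, ?_⟩
    obtain ⟨e1, e2⟩ := evalReg_leftRayBody l9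
    rw [w.r0, w.r1, w.r2, w.r3, l 22 (by norm_num), l 40 (by norm_num), l 41 (by norm_num), g40,
      g41] at e1 e2
    rw [l 23 (by norm_num)] at e2
    have hlt : ∀ j : Fin P.n, (j : ℕ) < i + 1 → (j : ℕ) < i ∨ j = i := fun j hj =>
      (Nat.lt_succ_iff_lt_or_eq.1 hj).imp id Fin.ext
    by_cases hc : P.vertex i 0 = P.vertex (P.next i) 0 ∧ P.vertex i 0 < q 0 ∧
        q 1 ∈ uIcc (P.vertex i 1) (P.vertex (P.next i) 1) ∧ σ 22 < P.vertex i 0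
    · obtain ⟨f22, f23⟩ := e1 hc
      rw [f22, f23]
      refine ⟨fun j hj hjm => ?_, Or.inr ⟨i, ⟨hc.1, hc.2.1, hc.2.2.1⟩, rfl, rfl⟩⟩
      rcases hlt j hj with hj | rfl
      · exact (g1 j hj hjm).trans hc.2.2.2.le
      · exact le_rfl
    · obtain ⟨f22, f23⟩ := e2 hc
      rw [f22, f23]
      refine ⟨fun j hj hjm => ?_, g2⟩
      rcases hlt j hj with hj | rfl
      · exact g1 j hj hjm
      · exact not_lt.1 fun h => hc ⟨hjm.1, hjm.2.1, hjm.2.2, h⟩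

/-- What the registers `8, …, 15` hold after the rectangle has been found. -/
structure HoldsRectangle (P : RectilinearPolygon) (a b : Plane) (η : ℝ) (ρ : ℕ → ℝ) : Prop where
  one : ρ 8 = 1
  zero : ρ 9 = 0
  box : HoldsBox a b ρ
  orientation : 0 < η * ρ 14
  left : ∀ j, P.vertex j 0 = P.vertex (P.next j) 0 → ρ 15 ≤ P.vertex j 0

lemma HoldsRectangle.congr {a b : Plane} {η : ℝ} {ρ σ : ℕ → ℝ} (h : P.HoldsRectangle a b η ρ)
    (e : ∀ r, 8 ≤ r → r ≤ 15 → σ r = ρ r) : P.HoldsRectangle a b η σ := by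
  obtain ⟨h1, h2, ⟨h3, h4, h5, h6⟩, h7, h8⟩ := h
  refine ⟨(e 8 ?_ ?_).trans h1, (e 9 ?_ ?_).trans h2, ⟨(e 10 ?_ ?_).trans h3,
    (e 11 ?_ ?_).trans h4, (e 12 ?_ ?_).trans h5, (e 13 ?_ ?_).trans h6⟩, ?_, ?_⟩
  any_goals norm_num
  · rwa [e 14 (by norm_num) (by norm_num)]
  · rwa [e 15 (by norm_num) (by norm_num)]

end RectilinearPolygon

namespace RAMProgram

/-- The bounds of the empty set of points. -/
def boundsInit : RAMProgram :=
  block [assign 30 11, assign 31 10, assign 32 13, assign 33 12, .instr (.rconst 34 0)]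

/-- The point with the coordinates in the registers `c` and `d` is chosen for `leftRayBody`. -/
def leftRayInit (c d : ℕ) : RAMProgram :=
  block [assign 40 c, assign 41 d, .instr (.rsub 22 15 8), .instr (.rconst 23 0)]

end RAMProgram

lemma HoldsBounds.addCorner {S : Set Plane} {a b q : Plane} {ρ : ℕ → ℝ}
    (h : HoldsBounds S a b ρ) (h9 : ρ 9 = 0) (hb : HoldsBox a b ρ) (h40 : ρ 40 = q 0)
    (h41 : ρ 41 = q 1) :
    HoldsBounds (S ∪ {z | z = q ∧ z ∈ box a b ∧ 0 < ρ 14 * ρ 23}) a b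
      (evalReg addCorner ρ) := by
  set σ := Function.update ρ 24 (ρ 14 * ρ 23) with hσ
  have hr : ∀ r, r ≠ 24 → σ r = ρ r := fun r hr => by simp [hσ, hr]
  have e : evalReg RAMProgram.addCorner ρ = evalReg (.ite (.rlt 9 24) (block
      [assign 16 40, assign 17 40, assign 18 41, assign 19 41, RAMProgram.clipAdd]) .skip) σ := rfl
  rw [e, evalReg, hr 9 (by norm_num), h9, show σ 24 = ρ 14 * ρ 23 by simp [hσ]]
  split_ifs with hc
  · have hS : {z | z = q ∧ z ∈ box a b ∧ 0 < ρ 14 * ρ 23} = box q q ∩ box a b := by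
      ext z
      simp only [mem_ofPred_eq, hc, and_true, mem_inter_iff]
      refine and_congr_left fun _ => ⟨?_, fun hz => ?_⟩
      · rintro rfl k
        exact ⟨le_rfl, le_rfl⟩
      · exact PiLp.ext fun k => le_antisymm (hz k).2 (hz k).1
    rw [hS]
    set τ := Function.update (Function.update (Function.update (Function.update σ 16 (q 0)) 17
      (q 0)) 18 (q 1)) 19 (q 1) with hτ
    have e : evalReg (block [assign 16 40, assign 17 40, assign 18 41, assign 19 41,
        RAMProgram.clipAdd]) σ =
        evalReg RAMProgram.clipAdd τ := by
      simp [evalReg_block_cons, evalReg_block_nil, evalReg_assign, hτ, hσ, h9, h40, h41,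
        Function.update]
    rw [e]
    have hr' : ∀ r, r < 16 ∨ 24 < r → τ r = ρ r := fun r hr => by
      simp [hτ, hσ, Function.update, show r ≠ 16 by omega, show r ≠ 17 by omega,
        show r ≠ 18 by omega, show r ≠ 19 by omega, show r ≠ 24 by omega]
    obtain ⟨h10, h11, h12, h13⟩ := hb
    refine (h.congr fun r h1 h2 => hr' r (by omega)).clipAdd ((hr' 9 (by norm_num)).trans h9)
      ⟨(hr' 10 (by norm_num)).trans h10, (hr' 11 (by norm_num)).trans h11,
       (hr' 12 (by norm_num)).trans h12, (hr' 13 (by norm_num)).trans h13⟩ ?_ ?_ ?_ ?_ <;>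
      simp [hτ]
  · have hS : {z | z = q ∧ z ∈ box a b ∧ 0 < ρ 14 * ρ 23} = ∅ := by
      simp [hc]
    rw [hS, union_empty]
    exact h.congr fun r h1 h2 => hr r (by omega)

namespace RectilinearPolygon

variable {P : RectilinearPolygon}

lemma holdsBounds_init {ρ : ℕ → ℝ} {a b : Plane} (h9 : ρ 9 = 0) (hb : HoldsBox a b ρ) :
    HoldsBounds ∅ a b (evalReg boundsInit ρ) := by
  obtain ⟨h10, h11, h12, h13⟩ := hb
  refine ⟨by simp, Or.inl ?_, Or.inl ?_, Or.inl ?_, Or.inl ?_, Or.inl ⟨?_, rfl⟩⟩ <;>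
    simp [boundsInit, evalReg_block_cons, evalReg_block_nil, evalReg_assign, h9, Function.update,
      evalReg, h10, h11, h12, h13]

/-- The registers after the treatment of a corner of the rectangle. -/
noncomputable def cornerRegs (P : RectilinearPolygon) (c d : ℕ) (ρ : ℕ → ℝ) : ℕ → ℝ :=
  evalReg addCorner (passRegs P.data leftRayBody (evalReg (leftRayInit c d) ρ) P.n)

/-- A corner outside the boundary is added if and only if the ray test finds it inside. A corner on
the boundary may be added or not, as it is among the points `S` already. -/
lemma corner_stage {S : Set Plane} {a b q : Plane} {η : ℝ} {ρ : ℕ → ℝ} {c d : ℕ}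
    (hK : P.KernelIsBox a b) (hη : P.IsOrientation η) (hρ : P.HoldsRectangle a b η ρ)
    (hS : HoldsBounds S a b ρ) (hSK : S ⊆ P.kernel) (hSt : P.trace ∩ box a b ⊆ S)
    (hc : ρ c = q 0) (hd : ρ d = q 1) (hd' : d < 16) :
    P.HoldsRectangle a b η (P.cornerRegs c d ρ) ∧ ∃ S', HoldsBounds S' a b (P.cornerRegs c d ρ) ∧
      S ⊆ S' ∧ S' ⊆ P.kernel ∧ (q ∈ P.kernel → q ∈ S') := by
  have h9 := hρ.zero
  have i40 : evalReg (leftRayInit c d) ρ 40 = q 0 := by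
    simp [leftRayInit, evalReg_block_cons, evalReg_block_nil, evalReg_assign, h9, Function.update,
      evalReg, hc]
  have i41 : evalReg (leftRayInit c d) ρ 41 = q 1 := by
    simp [leftRayInit, evalReg_block_cons, evalReg_block_nil, evalReg_assign, h9, Function.update,
      evalReg, hd, show d ≠ 40 by omega]
  have i22 : evalReg (leftRayInit c d) ρ 22 = ρ 15 - 1 := by
    simp [leftRayInit, evalReg_block_cons, evalReg_block_nil, evalReg_assign, h9, Function.update,
      evalReg, hρ.one]
  have i23 : evalReg (leftRayInit c d) ρ 23 = 0 := by
    simp [leftRayInit, evalReg_block_cons, evalReg_block_nil, evalReg]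
  have ir : ∀ r, writesReg r (leftRayInit c d) = false → evalReg (leftRayInit c d) ρ r = ρ r :=
    fun r h => evalReg_of_not_writes _ h ρ
  have iw : ∀ r, (8 ≤ r ∧ r ≤ 15) ∨ (30 ≤ r ∧ r ≤ 34) → writesReg r (leftRayInit c d) = false :=
    fun r hr => by
      have h1 : r ≠ 40 := by omega
      have h2 : r ≠ 41 := by omega
      have h3 : r ≠ 22 := by omega
      have h4 : r ≠ 23 := by omega
      simp [leftRayInit, block, writesReg, assign, h1, h2, h3, h4]
  set σ := evalReg (leftRayInit c d) ρ with hσ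
  have pr : ∀ r, (8 ≤ r ∧ r ≤ 15) ∨ (30 ≤ r ∧ r ≤ 41) →
      passRegs P.data leftRayBody σ P.n r = σ r := fun r hr => by
    refine passRegs_of_not_writes _ _ _ _ (by omega) ?_
    rcases hr with ⟨h1, h2⟩ | ⟨h1, h2⟩ <;> interval_cases r <;> decide
  have pr' : ∀ r, (8 ≤ r ∧ r ≤ 15) ∨ (30 ≤ r ∧ r ≤ 34) →
      passRegs P.data leftRayBody σ P.n r = ρ r := fun r hr =>
    (pr r (by omega)).trans (ir r (iw r hr))
  have hσρ : P.HoldsRectangle a b η (passRegs P.data leftRayBody σ P.n) :=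
    hρ.congr fun r h1 h2 => pr' r (by omega)
  have hadd := (hS.congr (σ := passRegs P.data leftRayBody σ P.n)
    fun r h1 h2 => pr' r (by omega)).addCorner (q := q) hσρ.zero hσρ.box
    ((pr 40 (by norm_num)).trans i40) ((pr 41 (by norm_num)).trans i41)
  have h14 : σ 14 = ρ 14 := ir 14 (iw 14 (by norm_num))
  have hmem : q ∉ P.trace →
      (q ∈ P.region ↔ 0 < σ 14 * passRegs P.data leftRayBody σ P.n 23) :=
    leftRay_pass ((ir 9 (iw 9 (by norm_num))).trans h9) i40 i41
      (fun j hj => by have := hρ.left j hj; rw [i22]; linarith) i23 hη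
      (by rw [h14]; exact hρ.orientation)
  rw [pr 14 (by norm_num)] at hadd
  refine ⟨hσρ.congr fun r h1 h2 => evalReg_of_not_writes _ ?_ _, _, hadd, subset_union_left,
    union_subset hSK ?_, fun hq => ?_⟩
  · interval_cases r <;> decide
  · rintro z ⟨rfl, hzb, hpos⟩
    rw [KernelIsBox] at hK
    rw [hK]
    refine ⟨hzb, ?_⟩
    by_cases hzt : z ∈ P.trace
    · exact P.trace_subset_region hzt
    · exact (hmem hzt).2 hpos
  · rw [KernelIsBox] at hK
    rw [hK] at hq
    by_cases hqt : q ∈ P.trace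
    · exact Or.inl (hSt ⟨hqt, hq.1⟩)
    · exact Or.inr ⟨rfl, hq.1, (hmem hqt).1 hq.2⟩

end RectilinearPolygon

/-! ### The whole program -/

/-- Started in a state that is ready for passes, `c` halts after at most `T` steps in such a state,
and it changes the real registers by `f`. -/
def Transforms (n : ℕ) (data : ℕ → ℝ) (c : RAMProgram) (T : ℕ) (f : (ℕ → ℝ) → ℕ → ℝ) : Prop :=
  ∀ s, IsReady n data s → RAMRuns c s T fun s' => IsReady n data s' ∧ s'.reg = f s.reg

namespace Transforms

variable {n : ℕ} {data : ℕ → ℝ}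

lemma seq {c d : RAMProgram} {T T' : ℕ} {f g : (ℕ → ℝ) → ℕ → ℝ} (hc : Transforms n data c T f)
    (hd : Transforms n data d T' g) : Transforms n data (.seq c d) (T + T') fun ρ => g (f ρ) := by
  intro s hs
  refine (hc s hs).seq fun s' h => (hd s' h.1).mono le_rfl fun s'' h' => ⟨h'.1, ?_⟩
  rw [h'.2, h.2]

lemma evalReg {c : RAMProgram} (hc : isRegProgram c = true) :
    Transforms n data c (stepBound c) (evalReg c) := by
  intro s hs
  refine (runs_evalReg c hc s).mono le_rfl ?_
  rintro _ rfl
  obtain ⟨h0, h1, h3, h4, h6, h7, hm⟩ := hs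
  exact ⟨⟨h0, h1, h3, h4, h6, h7, hm⟩, rfl⟩

lemma pass {body : RAMProgram} (hb : isRegProgram body = true) :
    Transforms n data (.pass body) ((stepBound body + 24) * n + 4)
      fun ρ => passRegs data body ρ n := fun _ hs =>
  (runs_pass hb hs).mono le_rfl fun _ h => ⟨h.1, h.2.1⟩

end Transforms

namespace RAMProgram

/-- The instructions that copy one number from the beginning of the input to its end. -/
def copyStep : List RAMInstr := [.rload 0 2, .rstore 1 0, .iadd 2 2 3, .iadd 1 1 3]

/-- The first `k` numbers of the input are copied to its end. -/
def copy : ℕ → RAMProgram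
  | 0 => .skip
  | k + 1 => .seq (copy k) (.ofList copyStep)

/-- The first three vertices are appended to the input, so that the windows of a pass need no
reduction of indices, and the registers for `boundsBody` are initialized by the first vertex. -/
def setup : RAMProgram :=
  .seq (.ofList [.iconst 3 1, .iadd 4 0 0, .iconst 6 6, .iadd 1 4 7]) (.seq (copy 6)
    (.ofList [.iconst 2 0, .rload 10 2, .rload 11 2, .rload 15 2, .iadd 2 2 3, .rload 12 2,
      .rload 13 2, .rconst 8 1, .radd 15 15 8]))

/-- The treatment of the corner of the rectangle with the coordinates in the registers `c`
and `d`. -/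
def corner (c d : ℕ) : RAMProgram := .seq (leftRayInit c d) (.seq (pass leftRayBody) addCorner)

/-- The program that computes the kernel of a rectilinear polygon: the bounding box and the
orientation of the polygon, the reflex rectangle, the bounding box of the kernel, and finally the
vertices clamped to this box. -/
def kernelProgram : RAMProgram :=
  .seq setup (.seq (.seq (pass boundsBody) (.seq (pass reflexBody) (.seq boundsInit
    (.seq (pass edgeBody) (.seq (corner 10 12) (corner 11 13))))))
    (.ite (.req 34 9) (.instr (.iconst 0 0)) (pass clampBody)))

end RAMProgram

namespace RectilinearPolygon

variable (P : RectilinearPolygon)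

lemma data_add (k : ℕ) : P.data (2 * P.n + k) = P.data k := by
  have h1 : (2 * P.n + k) / 2 = k / 2 + P.n := by omega
  have h2 : (2 * P.n + k) % 2 = k % 2 := by omega
  simp [data, h1, h2, cyclicVertex]

lemma input_rmem {m : ℕ} (hm : m < 2 * P.n) : (RAMState.input P.vertex).rmem m = P.data m := by
  have h : m / 2 < P.n := by omega
  simp only [RAMState.input, h, dif_pos, data, cyclicVertex, Nat.mod_eq_of_lt h]

lemma runs_copy (k : ℕ) (hk : k ≤ 6) {s : RAMState} (h0 : s.idx 0 = P.n) (h1 : s.idx 1 = 2 * P.n)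
    (h2 : s.idx 2 = 0) (h3 : s.idx 3 = 1) (h4 : s.idx 4 = 2 * P.n) (h6 : s.idx 6 = 6)
    (h7 : s.idx 7 = 0) (hr : s.reg = fun _ => 0) (hm : ∀ m < 2 * P.n, s.rmem m = P.data m) :
    RAMRuns (copy k) s (5 * k + 1) fun s' => s'.idx 0 = P.n ∧ s'.idx 1 = 2 * P.n + k ∧
      s'.idx 2 = k ∧ s'.idx 3 = 1 ∧ s'.idx 4 = 2 * P.n ∧ s'.idx 6 = 6 ∧ s'.idx 7 = 0 ∧
      (∀ r, r ≠ 0 → s'.reg r = 0) ∧ ∀ m < 2 * P.n + k, s'.rmem m = P.data m := by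
  induction k with
  | zero => exact ⟨1, s, .skip s, le_rfl, h0, h1, h2, h3, h4, h6, h7, fun r _ => by rw [hr], hm⟩
  | succ k ih =>
    refine ((ih (by omega)).seq fun s' h => RAMRuns.ofList copyStep s' ?_).mono
      (by simp [copyStep]; omega) fun _ h => h
    obtain ⟨g0, g1, g2, g3, g4, g6, g7, gr, gm⟩ := h
    have hn := P.four_le
    refine ⟨?_, ?_, ?_, ?_, ?_, ?_, ?_, ?_, ?_⟩
    · simp [applyList, copyStep, RAMInstr.apply, g0]
    · simp [applyList, copyStep, RAMInstr.apply, g1, g3]; ring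
    · simp [applyList, copyStep, RAMInstr.apply, g2, g3]
    · simp [applyList, copyStep, RAMInstr.apply, g3]
    · simp [applyList, copyStep, RAMInstr.apply, g4]
    · simp [applyList, copyStep, RAMInstr.apply, g6]
    · simp [applyList, copyStep, RAMInstr.apply, g7]
    · intro r hr
      simp [applyList, copyStep, RAMInstr.apply, hr, gr r hr]
    · intro m hm
      simp only [applyList, copyStep, RAMInstr.apply, List.foldl_cons, List.foldl_nil, g1, g2,
        Function.update_self]
      by_cases e : m = 2 * P.n + k
      · subst e
        rw [Function.update_self, gm k (by omega), data_add]
      · rw [Function.update_of_ne e]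
        exact gm m (by omega)

lemma runs_setup : RAMRuns setup (RAMState.input P.vertex) 46 fun s => IsReady P.n P.data s ∧
    s.reg 8 = 1 ∧ s.reg 9 = 0 ∧ s.reg 15 = P.cyclicVertex 0 0 + 1 := by
  refine ((RAMRuns.ofList _ _ (Q := fun s => s.idx 0 = P.n ∧ s.idx 1 = 2 * P.n ∧ s.idx 2 = 0 ∧
    s.idx 3 = 1 ∧ s.idx 4 = 2 * P.n ∧ s.idx 6 = 6 ∧ s.idx 7 = 0 ∧ (s.reg = fun _ => 0) ∧
    ∀ m < 2 * P.n, s.rmem m = P.data m) ?_).seq (T' := 41) fun s h => ?_).mono (by simp)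
    fun _ h => h
  · refine ⟨?_, ?_, ?_, ?_, ?_, ?_, ?_, ?_, ?_⟩
    any_goals simp [applyList, RAMInstr.apply, RAMState.input]
    any_goals omega
    intro m hm
    exact P.input_rmem hm
  · obtain ⟨h0, h1, h2, h3, h4, h6, h7, hr, hm⟩ := h
    refine ((P.runs_copy 6 le_rfl h0 h1 h2 h3 h4 h6 h7 hr hm).seq fun s' h =>
      RAMRuns.ofList _ s' ?_).mono (by simp) fun _ h => h
    obtain ⟨g0, g1, g2, g3, g4, g6, g7, gr, gm⟩ := h
    refine ⟨⟨?_, ?_, ?_, ?_, ?_, ?_, ?_⟩, ?_, ?_, ?_⟩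
    · simp [applyList, RAMInstr.apply, g0]
    · simp [applyList, RAMInstr.apply, g1]
    · simp [applyList, RAMInstr.apply, g3]
    · simp [applyList, RAMInstr.apply, g4]
    · simp [applyList, RAMInstr.apply, g6]
    · simp [applyList, RAMInstr.apply, g7]
    · exact gm
    · simp [applyList, RAMInstr.apply]
    · simp [applyList, RAMInstr.apply, gr 9]
    · have := P.data_even 0
      simp only [mul_zero] at this
      simp [applyList, RAMInstr.apply, gm 0, this]

/-- The registers before the output pass, computed from those after the setup. -/
noncomputable def boxRegs (ρ : ℕ → ℝ) : ℕ → ℝ :=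
  P.cornerRegs 11 13 (P.cornerRegs 10 12 (passRegs P.data edgeBody (evalReg boundsInit
    (passRegs P.data reflexBody (passRegs P.data boundsBody ρ P.n) P.n)) P.n))

lemma exists_transforms_boxRegs : ∃ T, T ≤ 1000 * P.n ∧ Transforms P.n P.data
    (.seq (pass boundsBody) (.seq (pass reflexBody) (.seq boundsInit
      (.seq (pass edgeBody) (.seq (corner 10 12) (corner 11 13)))))) T P.boxRegs := by
  have hcorner : ∀ c d, Transforms P.n P.data (corner c d) _ (P.cornerRegs c d) := fun c d =>
    (Transforms.evalReg (c := leftRayInit c d) rfl).seq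
      ((Transforms.pass (body := leftRayBody) rfl).seq (Transforms.evalReg (c := addCorner) rfl))
  refine ⟨_, ?_, (Transforms.pass (body := boundsBody) rfl).seq
    ((Transforms.pass (body := reflexBody) rfl).seq
    ((Transforms.evalReg (c := boundsInit) rfl).seq
    ((Transforms.pass (body := edgeBody) rfl).seq ((hcorner 10 12).seq (hcorner 11 13)))))⟩
  have hn := P.four_le
  simp only [stepBound, boundsBody, reflexBody, boundsInit, edgeBody, leftRayBody, addCorner,
    leftRayInit, clipAdd, block, assign, minInto, maxInto]
  omega

variable {P}

/-- The registers hold the bounding box of the kernel. -/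
lemma boxRegs_spec {ρ : ℕ → ℝ} (h8 : ρ 8 = 1) (h9 : ρ 9 = 0)
    (h15 : ρ 15 = P.cyclicVertex 0 0 + 1) : P.boxRegs ρ 9 = 0 ∧
    (P.boxRegs ρ 34 = 0 ∧ P.kernel = ∅ ∨ P.boxRegs ρ 34 = 1 ∧ ∃ a b, P.KernelIsBox a b ∧
      IsBoundingBox P.kernel !₂[P.boxRegs ρ 30, P.boxRegs ρ 32]
        !₂[P.boxRegs ρ 31, P.boxRegs ρ 33]) := by
  obtain ⟨h1, h2, η, hη, h3⟩ := P.bounds_pass h9 h15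
  set ρ₁ := passRegs P.data boundsBody ρ P.n with hρ₁
  have k8 : ρ₁ 8 = 1 := (passRegs_of_not_writes _ _ _ _ (by norm_num) (by decide)).trans h8
  have k9 : ρ₁ 9 = 0 := (passRegs_of_not_writes _ _ _ _ (by norm_num) (by decide)).trans h9
  have hR := reflex_pass k9 hη h3
  set ρ₂ := passRegs P.data reflexBody ρ₁ P.n with hρ₂
  have l : ∀ r, 8 ≤ r → writesReg r reflexBody = false → ρ₂ r = ρ₁ r := fun r hr h =>
    passRegs_of_not_writes _ _ _ _ hr h
  set a : Plane := !₂[ρ₂ 10, ρ₂ 12] with ha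
  set b : Plane := !₂[ρ₂ 11, ρ₂ 13] with hb
  have hK : P.KernelIsBox a b := by
    rw [KernelIsBox, kernel_eq]
    ext p
    rw [mem_inter_iff, mem_inter_iff]
    refine and_congr_left fun hp => ?_
    rw [mem_box_iff]
    refine Iff.trans ?_ (hR p).symm
    refine ⟨fun h => ⟨⟨⟨?_, ?_⟩, ?_, ?_⟩, h⟩, fun h => h.2⟩
    · exact P.le_region_coord (fun i => (h1 i).1) hp
    · exact P.region_coord_le (fun i => (h1 i).2.1) hp
    · exact P.le_region_coord (fun i => (h1 i).2.2.1) hp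
    · exact P.region_coord_le (fun i => (h1 i).2.2.2) hp
  have hρ : P.HoldsRectangle a b η ρ₂ := by
    refine ⟨(l 8 (by norm_num) (by decide)).trans k8, (l 9 (by norm_num) (by decide)).trans k9,
      ⟨rfl, rfl, rfl, rfl⟩, ?_, ?_⟩
    · rw [l 14 (by norm_num) (by decide)]
      exact h3
    · rw [l 15 (by norm_num) (by decide)]
      exact h2
  set ρ₃ := evalReg boundsInit ρ₂ with hρ₃
  have hr3 : P.HoldsRectangle a b η ρ₃ := hρ.congr fun r h h' =>
    evalReg_of_not_writes _ (by interval_cases r <;> decide) _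
  have hb3 : HoldsBounds ∅ a b ρ₃ := holdsBounds_init hρ.zero hρ.box
  have hb4 := edge_pass (P := P) hr3.zero hr3.box hb3
  set ρ₄ := passRegs P.data edgeBody ρ₃ P.n with hρ₄
  have hr4 : P.HoldsRectangle a b η ρ₄ := hr3.congr fun r h h' =>
    passRegs_of_not_writes _ _ _ _ h (by interval_cases r <;> decide)
  have hsub : P.trace ∩ box a b ⊆ P.kernel := by
    have hK := hK
    rw [KernelIsBox] at hK
    rw [hK]
    exact fun z hz => ⟨hz.2, P.trace_subset_region hz.1⟩
  obtain ⟨hr5, S, hb5, hS1, hS2, hS3⟩ := corner_stage (q := a) hK hη hr4 hb4 hsub subset_rfl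
    hr4.box.1 hr4.box.2.2.1 (by norm_num)
  obtain ⟨hr6, S', hb6, hS1', hS2', hS3'⟩ := corner_stage (q := b) hK hη hr5 hb5 hS2 hS1
    hr5.box.2.1 hr5.box.2.2.2 (by norm_num)
  have hbox : P.boxRegs ρ = P.cornerRegs 11 13 (P.cornerRegs 10 12 ρ₄) := rfl
  rw [hbox]
  refine ⟨hr6.zero, ?_⟩
  have hext := fun p (hp : p ∈ P.kernel) k => exists_coord_le_of_mem_kernel hK (hS1.trans hS1')
    (fun h => hS1' (hS3 h)) hS3' hp k
  rcases hb6.2.2.2.2.2 with ⟨h34, hempty⟩ | ⟨h34, hne⟩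
  · refine Or.inl ⟨h34, eq_empty_iff_forall_notMem.2 fun p hp => ?_⟩
    obtain ⟨⟨s, hs, -⟩, -⟩ := hext p hp 0
    rw [hempty] at hs
    exact hs
  · refine Or.inr ⟨h34, a, b, hK, ?_⟩
    have hSb : S' ⊆ box a b := fun z hz => by
      have := hS2' hz
      rw [KernelIsBox] at hK
      rw [hK] at this
      exact this.1
    have hB := hb6.isBoundingBox hSb hne
    intro k
    obtain ⟨⟨s, hs, e⟩, ⟨s', hs', e'⟩, hall⟩ := hB k
    refine ⟨⟨s, hS2' hs, e⟩, ⟨s', hS2' hs', e'⟩, fun z hz => ?_⟩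
    obtain ⟨⟨t, ht, h⟩, t', ht', h'⟩ := hext z hz k
    exact ⟨(hall t ht).1.trans h, h'.trans (hall t' ht').2⟩

lemma chain_congr {k m : ℕ} (h : k = m) {w : Fin k → Plane} {v : Fin m → Plane}
    (hw : ∀ j : Fin k, w j = v (Fin.cast h j)) :
    chainTrace w = chainTrace v ∧ chainRegion w = chainRegion v := by
  subst h
  obtain rfl : w = v := funext hw
  exact ⟨rfl, rfl⟩

variable (P) in
lemma runs_kernelProgram : RAMRuns kernelProgram (RAMState.input P.vertex) (2000 * P.n) fun s =>
    chainTrace s.output = frontier P.kernel ∧ chainRegion s.output = P.kernel := by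
  obtain ⟨T, hT, htr⟩ := P.exists_transforms_boxRegs
  have hn := P.four_le
  refine (P.runs_setup.seq fun s h => (htr s h.1).seq (T' := 100 * P.n + 10) fun s' h' => ?_).mono
    (by omega) fun _ h => h
  obtain ⟨-, h8, h9, h15⟩ := h
  obtain ⟨hready, hreg⟩ := h'
  obtain ⟨g9, hspec⟩ := boxRegs_spec h8 h9 h15
  rw [← hreg] at g9 hspec
  rcases hspec with ⟨h34, hK⟩ | ⟨h34, a, b, hK, hB⟩
  · refine ⟨1 + 1, _, .ite_true ?_ (.instr _ _), by omega, ?_⟩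
    · simp only [RAMTest.Holds, h34, g9]
    · have h0 : (RAMInstr.apply (.iconst 0 0) s').idx 0 = 0 := by simp [RAMInstr.apply]
      rw [hK, frontier_empty]
      obtain ⟨e1, e2⟩ := chain_congr h0 (w := (RAMInstr.apply (.iconst 0 0) s').output)
        (v := fun j => j.elim0) fun j => (Fin.cast h0 j).elim0
      show chainTrace _ = ∅ ∧ chainRegion _ = ∅
      rw [e1, e2]
      exact chainRegion_of_isEmpty
  · obtain ⟨t, s'', hex, ht, hr'', hreg'', hmem⟩ :=
      runs_pass (body := clampBody) rfl hready
    refine ⟨t + 1, s'', .ite_false ?_ hex, ?_, ?_⟩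
    · simp only [RAMTest.Holds, h34, g9]
      norm_num
    · refine (Nat.succ_le_succ ht).trans ?_
      simp only [stepBound, clampBody, block, assign, minInto, maxInto]
      omega
    · obtain ⟨e1, e2⟩ := chain_congr hr''.idx0 (w := s''.output) (v := fun i => clamp
        !₂[s'.reg 30, s'.reg 32] !₂[s'.reg 31, s'.reg 33] (P.vertex i)) (by
        intro j
        set i : Fin P.n := Fin.cast hr''.idx0 j with hi
        have hij : (i : ℕ) = j := rfl
        have keep : ∀ r, 8 ≤ r → writesReg r clampBody = false →
            loadRegs P.data i (passRegs P.data clampBody s'.reg i) r = s'.reg r := fun r hr h =>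
          (loadRegs_of_le _ _ _ hr).trans (passRegs_of_not_writes _ _ _ _ hr h)
        have w := P.isWindow_loadRegs i (passRegs P.data clampBody s'.reg i)
        obtain ⟨c0, c1⟩ := evalReg_clampBody
          ((keep 9 (by norm_num) (by decide)).trans g9)
        rw [keep 30 (by norm_num) (by decide), keep 31 (by norm_num) (by decide), w.r0] at c0
        rw [keep 32 (by norm_num) (by decide), keep 33 (by norm_num) (by decide), w.r1] at c1
        obtain ⟨m0, m1⟩ := hmem i i.2
        rw [passRegs, c0, hij] at m0
        rw [passRegs, c1, hij] at m1
        apply plane_ext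
        · simp only [RAMState.output, hr''.idx1, clamp_apply]
          exact m0
        · simp only [RAMState.output, hr''.idx1, clamp_apply]
          exact m1)
      rw [e1, e2]
      exact chain_clamp hK hB

end RectilinearPolygon

theorem theorem1 :
    (∀ P : RectilinearPolygon,
      (∀ p ∈ P.region, p ∈ P.kernel ↔ ∀ i, P.IsReflexEdge i → p ∈ P.halfPlane i) ∧
      P.kernel = P.reflexRectangle ∩ P.region ∧
      IsAxisParallelRectangle P.reflexRectangle) ∧
    ∃ (c : RAMProgram) (C : ℕ), ∀ P : RectilinearPolygon, ∃ (t : ℕ) (s : RAMState),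
      RAMExec c (RAMState.input P.vertex) t s ∧ t ≤ C * P.n ∧
      chainTrace s.output = frontier P.kernel ∧ chainRegion s.output = P.kernel := by
  refine ⟨fun P => ⟨fun p hp => ?_, P.kernel_eq, P.isAxisParallelRectangle_reflexRectangle⟩,
    kernelProgram, 2000, fun P => P.runs_kernelProgram⟩
  rw [P.kernel_eq]
  exact ⟨fun h => h.1, fun h => ⟨h, hp⟩⟩
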